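/- Let $F$ be a field of characteristic $0$; all algebras are (not necessarily associative) $F$-algebras. Let $\mathcal V=\mathrm{Jord}^{(2)}$ be the variety of metabelian Jordan algebras, defined by the identities $xy=yx$, $(x^2y)x=x^2(yx)$, $(xy)(zt)=0$. For a superalgebra $A=A_0\oplus A_1$ (a $\mathbb Z_2$-graded algebra) let $G(A)=G_0\otimes A_0+G_1\otimes A_1$ be its Grassmann envelope, where $G=G_0\oplus G_1$ is the Grassmann algebra on countably many generators. A superalgebra $A$ is a $\mathcal V$-superalgebra if $G(A)\in\mathcal V$; the class of all $\mathcal V$-superalgebras is denoted $\tilde{\mathcal V}$. A superalgebra $A$ satisfies the superidentity $\tilde f=0$ corresponding to a multilinear nonassociative polynomial $f$ if $G(A)$ satisfies $f=0$. The supervariety generated by a superalgebra $A$ is the class of all superalgebras that satisfy every superidentity satisfied by $A$. For integers $r,s\ge 0$ let $\mathcal V_{r,s}$ be the supervariety generated by the free $\mathcal V$-superalgebra on $r$ even and $s$ odd generators (so $\mathcal V_{0,0}$ consists of the zero superalgebras only). Theorem. (i) For every $r\ge 0$ the following inclusions hold and are strict: $$\mathcal V_{r,0}\subset\mathcal V_{r+1,0},\qquad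 \mathcal V_{r,1}\subset\mathcal V_{r+1,1},\qquad \mathcal V_{r,0}\subset\mathcal V_{r,1},\qquad \mathcal V_{r,1}\subset\mathcal V_{r,2}.$$ (ii) $\mathcal V_{r,s}=\tilde{\mathcal V}$ for all $r\ge 0$ and $s\ge 2$. (iii) For every $n\ge 1$ the free $\mathcal V$-algebra on $n$ generators is nilpotent of index $2n+2$, that is, $2n+2$ is the least positive integer $k$ such that every product of $k$ elements, with any arrangement of brackets, is zero. -/

import Mathlib

open scoped TensorProduct

universe u

noncomputable section

/-! ### Nonassociative words, identities, nilpotency -/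

/-- The multiset of letters of a nonassociative word. -/
def FreeMagma.letters {X : Type*} : FreeMagma X → Multiset X
  | .of x => {x}
  | .mul v w => FreeMagma.letters v + FreeMagma.letters w

/-- A nonassociative polynomial in the variables `x_0, …, x_{n-1}` is multilinear if every variable
occurs exactly once in each of its monomials. -/
def IsMultilinearPoly {F : Type u} [Field F] {n : ℕ}
    (f : FreeNonUnitalNonAssocAlgebra F (Fin n)) : Prop :=
  ∀ w ∈ f.coeff.support, FreeMagma.letters w = (Finset.univ : Finset (Fin n)).val

/-- The algebra `A` satisfies the identity `f = 0`. -/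
def SatisfiesIdentity {F : Type u} [Field F] {n : ℕ}
    (f : FreeNonUnitalNonAssocAlgebra F (Fin n)) (A : Type*) [NonUnitalNonAssocRing A]
    [Module F A] [IsScalarTower F A A] [SMulCommClass F A A] : Prop :=
  ∀ a : Fin n → A, FreeNonUnitalNonAssocAlgebra.lift F a f = 0

/-- `A` is nilpotent of index `k`: `k` is the least positive integer such that every product of `k`
elements of `A`, with any arrangement of brackets, vanishes. -/
def IsNilpotentOfIndex (A : Type*) [NonUnitalNonAssocRing A] (k : ℕ) : Prop :=
  IsLeast {m : ℕ | 1 ≤ m ∧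
    ∀ w : FreeMagma A, w.length = m → FreeMagma.lift (id : A → A) w = 0} k

/-- Membership in the variety of metabelian Jordan algebras:
`xy = yx`, `(x²y)x = x²(yx)`, `(xy)(zt) = 0`. -/
structure IsMetabelianJordan (A : Type*) [NonUnitalNonAssocRing A] : Prop where
  comm : ∀ x y : A, x * y = y * x
  jordan : ∀ x y : A, ((x * x) * y) * x = (x * x) * (y * x)
  metabelian : ∀ x y z t : A, (x * y) * (z * t) = 0

/-! ### Quotients of nonassociative algebras by two-sided ideals -/

/-- A two-sided ideal of a nonassociative algebra. -/
structure AlgIdeal (F : Type u) [Field F] (W : Type*) [NonUnitalNonAssocRing W] [Module F W] where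
  toSubmodule : Submodule F W
  mul_mem_left : ∀ a b : W, b ∈ toSubmodule → a * b ∈ toSubmodule
  mul_mem_right : ∀ a b : W, a ∈ toSubmodule → a * b ∈ toSubmodule

namespace AlgIdeal

variable {F : Type u} [Field F] {W : Type*} [NonUnitalNonAssocRing W] [Module F W]

/-- The quotient algebra `W / J`. -/
def Quot (J : AlgIdeal F W) : Type _ := W ⧸ J.toSubmodule

instance (J : AlgIdeal F W) : AddCommGroup J.Quot :=
  inferInstanceAs (AddCommGroup (W ⧸ J.toSubmodule))

instance (J : AlgIdeal F W) : Module F J.Quot :=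
  inferInstanceAs (Module F (W ⧸ J.toSubmodule))

/-- The quotient map `W → W / J`. -/
def toQuot (J : AlgIdeal F W) : W →ₗ[F] J.Quot := J.toSubmodule.mkQ

theorem toQuot_surjective (J : AlgIdeal F W) : Function.Surjective J.toQuot :=
  J.toSubmodule.mkQ_surjective

theorem toQuot_eq_iff (J : AlgIdeal F W) {a b : W} : J.toQuot a = J.toQuot b ↔ a - b ∈ J.toSubmodule :=
  Submodule.Quotient.eq J.toSubmodule

theorem toQuot_eq_zero (J : AlgIdeal F W) {a : W} : J.toQuot a = 0 ↔ a ∈ J.toSubmodule :=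
  Submodule.Quotient.mk_eq_zero J.toSubmodule

instance (J : AlgIdeal F W) : Mul J.Quot where
  mul := Quotient.map₂ (· * ·) (by
    intro a a' ha b b' hb
    have ha' : a - a' ∈ J.toSubmodule := (Submodule.quotientRel_def _).1 ha
    have hb' : b - b' ∈ J.toSubmodule := (Submodule.quotientRel_def _).1 hb
    refine (Submodule.quotientRel_def _).2 ?_
    have h : a * b - a' * b' = (a - a') * b + a' * (b - b') := by
      rw [sub_mul, mul_sub]; abel
    change a * b - a' * b' ∈ J.toSubmodule
    rw [h]
    exact J.toSubmodule.add_mem (J.mul_mem_right _ _ ha') (J.mul_mem_left _ _ hb'))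

theorem toQuot_mul (J : AlgIdeal F W) (a b : W) : J.toQuot (a * b) = J.toQuot a * J.toQuot b := rfl

instance (J : AlgIdeal F W) : NonUnitalNonAssocRing J.Quot where
  left_distrib a b c := by
    obtain ⟨a, rfl⟩ := J.toQuot_surjective a
    obtain ⟨b, rfl⟩ := J.toQuot_surjective b
    obtain ⟨c, rfl⟩ := J.toQuot_surjective c
    simp only [← map_add, ← toQuot_mul, mul_add]
  right_distrib a b c := by
    obtain ⟨a, rfl⟩ := J.toQuot_surjective a
    obtain ⟨b, rfl⟩ := J.toQuot_surjective b
    obtain ⟨c, rfl⟩ := J.toQuot_surjective c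
    simp only [← map_add, ← toQuot_mul, add_mul]
  zero_mul a := by
    obtain ⟨a, rfl⟩ := J.toQuot_surjective a
    rw [← map_zero J.toQuot, ← toQuot_mul, zero_mul]
  mul_zero a := by
    obtain ⟨a, rfl⟩ := J.toQuot_surjective a
    rw [← map_zero J.toQuot, ← toQuot_mul, mul_zero]

instance [IsScalarTower F W W] (J : AlgIdeal F W) : IsScalarTower F J.Quot J.Quot where
  smul_assoc c a b := by
    obtain ⟨a, rfl⟩ := J.toQuot_surjective a
    obtain ⟨b, rfl⟩ := J.toQuot_surjective b
    simp only [smul_eq_mul, ← map_smul, ← toQuot_mul, smul_mul_assoc]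

instance [SMulCommClass F W W] (J : AlgIdeal F W) : SMulCommClass F J.Quot J.Quot where
  smul_comm c a b := by
    obtain ⟨a, rfl⟩ := J.toQuot_surjective a
    obtain ⟨b, rfl⟩ := J.toQuot_surjective b
    simp only [smul_eq_mul, ← map_smul, ← toQuot_mul, mul_smul_comm]

end AlgIdeal

/-! ### Free metabelian Jordan algebras -/

/-- The ideal of all polynomials that vanish under every substitution of elements of a metabelian
Jordan algebra for the variables. -/
def metabelianJordanIdeal (F : Type u) [Field F] (X : Type) :
    AlgIdeal F (FreeNonUnitalNonAssocAlgebra F X) where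
  toSubmodule :=
    { carrier := {f | ∀ (B : Type u) [NonUnitalNonAssocRing B] [Module F B]
        [IsScalarTower F B B] [SMulCommClass F B B], IsMetabelianJordan B →
        ∀ z : X → B, FreeNonUnitalNonAssocAlgebra.lift F z f = 0}
      add_mem' := by
        intro a b ha hb B _ _ _ _ hB z
        rw [map_add, ha B hB z, hb B hB z, add_zero]
      zero_mem' := by
        intro B _ _ _ _ hB z
        rw [map_zero]
      smul_mem' := by
        intro c a ha B _ _ _ _ hB z
        rw [map_smul, ha B hB z, smul_zero] }
  mul_mem_left := by
    intro a b hb B _ _ _ _ hB z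
    rw [map_mul, hb B hB z, mul_zero]
  mul_mem_right := by
    intro a b ha B _ _ _ _ hB z
    rw [map_mul, ha B hB z, zero_mul]

/-- The free metabelian Jordan algebra on the set `X` of generators. -/
abbrev FreeMetabelianJordanAlgebra (F : Type u) [Field F] (X : Type) : Type u :=
  (metabelianJordanIdeal F X).Quot

/-! ### Superalgebras and their Grassmann envelopes -/

/-- A (nonassociative) superalgebra over `F`: an algebra `A = A_0 ⊕ A_1` with `A_i A_j ⊆ A_{i+j}`,
the indices being taken modulo `2`. -/
structure Superalgebra (F : Type u) [Field F] : Type (u + 1) where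
  carrier : Type u
  [ring : NonUnitalNonAssocRing carrier]
  [module : Module F carrier]
  [isScalarTower : IsScalarTower F carrier carrier]
  [smulCommClass : SMulCommClass F carrier carrier]
  part : ZMod 2 → Submodule F carrier
  isInternal : DirectSum.IsInternal part
  mul_mem : ∀ (i j : ZMod 2) (a b : carrier), a ∈ part i → b ∈ part j → a * b ∈ part (i + j)

attribute [instance] Superalgebra.ring Superalgebra.module Superalgebra.isScalarTower
  Superalgebra.smulCommClass

/-- The Grassmann algebra on the countable set of generators `e_0, e_1, …`. -/
abbrev GrassmannAlgebra (F : Type u) [Field F] : Type u := ExteriorAlgebra F (ℕ →₀ F)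

/-- The even (`i = 0`) and the odd (`i = 1`) part of the Grassmann algebra. -/
def GrassmannAlgebra.part (F : Type u) [Field F] (i : ZMod 2) : Submodule F (GrassmannAlgebra F) :=
  CliffordAlgebra.evenOdd (0 : QuadraticForm F (ℕ →₀ F)) i

theorem GrassmannAlgebra.mul_mem_part {F : Type u} [Field F] {i j : ZMod 2}
    {g h : GrassmannAlgebra F} (hg : g ∈ GrassmannAlgebra.part F i)
    (hh : h ∈ GrassmannAlgebra.part F j) : g * h ∈ GrassmannAlgebra.part F (i + j) :=
  SetLike.mul_mem_graded (A := CliffordAlgebra.evenOdd (0 : QuadraticForm F (ℕ →₀ F))) hg hh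

/-- The Grassmann envelope `G(A) = G_0 ⊗ A_0 + G_1 ⊗ A_1`, a subalgebra of `G ⊗ A`. -/
def Superalgebra.envelope {F : Type u} [Field F] (A : Superalgebra F) :
    NonUnitalSubalgebra F (GrassmannAlgebra F ⊗[F] A.carrier) where
  toSubmodule := Submodule.span F
    {t | ∃ (i : ZMod 2) (g : GrassmannAlgebra F) (a : A.carrier),
      g ∈ GrassmannAlgebra.part F i ∧ a ∈ A.part i ∧ t = g ⊗ₜ[F] a}
  mul_mem' := by
    intro s t hs ht
    change s ∈ Submodule.span F _ at hs
    change t ∈ Submodule.span F _ at ht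
    change s * t ∈ Submodule.span F _
    induction hs using Submodule.span_induction with
    | mem s hs =>
      obtain ⟨i, g, a, hg, ha, rfl⟩ := hs
      induction ht using Submodule.span_induction with
      | mem t ht =>
        obtain ⟨j, h, b, hh, hb, rfl⟩ := ht
        refine Submodule.subset_span ⟨i + j, g * h, a * b,
          GrassmannAlgebra.mul_mem_part hg hh, A.mul_mem i j a b ha hb, ?_⟩
        exact Algebra.TensorProduct.tmul_mul_tmul g h a b
      | zero => rw [mul_zero]; exact Submodule.zero_mem _
      | add x y _ _ hx hy => rw [mul_add]; exact Submodule.add_mem _ hx hy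
      | smul c x _ hx => rw [mul_smul_comm]; exact Submodule.smul_mem _ c hx
    | zero => rw [zero_mul]; exact Submodule.zero_mem _
    | add x y _ _ hx hy => rw [add_mul]; exact Submodule.add_mem _ hx hy
    | smul c x _ hx => rw [smul_mul_assoc]; exact Submodule.smul_mem _ c hx

/-- `A` satisfies the superidentity corresponding to the multilinear polynomial `f`:
the Grassmann envelope of `A` satisfies `f = 0`. -/
def Superalgebra.SatisfiesSuperidentity {F : Type u} [Field F] (A : Superalgebra F) {n : ℕ}
    (f : FreeNonUnitalNonAssocAlgebra F (Fin n)) : Prop :=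
  SatisfiesIdentity f A.envelope

/-- The supervariety of all metabelian Jordan superalgebras: the superalgebras whose Grassmann
envelope is a metabelian Jordan algebra. -/
def metabelianJordanSupervariety (F : Type u) [Field F] : Set (Superalgebra F) :=
  {A | IsMetabelianJordan A.envelope}

/-- The supervariety generated by `A`: all superalgebras satisfying every superidentity of `A`. -/
def Superalgebra.generatedSupervariety {F : Type u} [Field F] (A : Superalgebra F) :
    Set (Superalgebra F) :=
  {B | ∀ (n : ℕ) (f : FreeNonUnitalNonAssocAlgebra F (Fin n)), IsMultilinearPoly f →
    A.SatisfiesSuperidentity f → B.SatisfiesSuperidentity f}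

/-! ### Free metabelian Jordan superalgebras -/

/-- The parity of a word, the letters having the parities `p`. -/
def wordParity {X : Type} (p : X → ZMod 2) (w : FreeMagma X) : ZMod 2 :=
  ((FreeMagma.letters w).map p).sum

/-- The part of parity `i` of the free nonassociative algebra on generators of parities `p`. -/
def freePart (F : Type u) [Field F] {X : Type} (p : X → ZMod 2) (i : ZMod 2) :
    Submodule F (FreeNonUnitalNonAssocAlgebra F X) :=
  Submodule.span F {f | ∃ w : FreeMagma X, wordParity p w = i ∧ f = MonoidAlgebra.single w 1}

/-- The ideal of all polynomials in generators of parities `p` that vanish under every parity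
preserving substitution of elements of a metabelian Jordan superalgebra for the generators. -/
def metabelianJordanSuperideal (F : Type u) [Field F] {X : Type} (p : X → ZMod 2) :
    AlgIdeal F (FreeNonUnitalNonAssocAlgebra F X) where
  toSubmodule :=
    { carrier := {f | ∀ B ∈ metabelianJordanSupervariety F, ∀ z : X → B.carrier,
        (∀ x, z x ∈ B.part (p x)) → FreeNonUnitalNonAssocAlgebra.lift F z f = 0}
      add_mem' := by
        intro a b ha hb B hB z hz
        rw [map_add, ha B hB z hz, hb B hB z hz, add_zero]
      zero_mem' := by
        intro B hB z hz
        rw [map_zero]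
      smul_mem' := by
        intro c a ha B hB z hz
        rw [map_smul, ha B hB z hz, smul_zero] }
  mul_mem_left := by
    intro a b hb B hB z hz
    rw [map_mul, hb B hB z hz, mul_zero]
  mul_mem_right := by
    intro a b ha B hB z hz
    rw [map_mul, ha B hB z hz, zero_mul]

theorem lift_mem_part {F : Type u} [Field F] {X : Type} {p : X → ZMod 2} (B : Superalgebra F)
    {z : X → B.carrier} (hz : ∀ x, z x ∈ B.part (p x)) {i : ZMod 2}
    {f : FreeNonUnitalNonAssocAlgebra F X} (hf : f ∈ freePart F p i) :
    FreeNonUnitalNonAssocAlgebra.lift F z f ∈ B.part i := by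
  have hw : ∀ w : FreeMagma X, FreeNonUnitalNonAssocAlgebra.lift F z
      (MonoidAlgebra.single w 1) ∈ B.part (wordParity p w) := by
    intro w
    induction w using FreeMagma.rec with
    | of x =>
      have h : FreeNonUnitalNonAssocAlgebra.lift F z (MonoidAlgebra.single (FreeMagma.of x) 1)
          = z x := FreeNonUnitalNonAssocAlgebra.lift_of_apply F z x
      have h' : wordParity p (FreeMagma.of x) = p x := by
        simp [wordParity, FreeMagma.letters]
      rw [h, h']
      exact hz x
    | mul v w hv hw =>
      have h : (MonoidAlgebra.single (FreeMagma.mul v w) (1 : F)) =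
          MonoidAlgebra.single v 1 * MonoidAlgebra.single w 1 := by
        rw [MonoidAlgebra.single_mul_single, one_mul]; rfl
      have h' : wordParity p (FreeMagma.mul v w) = wordParity p v + wordParity p w := by
        simp [wordParity, FreeMagma.letters]
      rw [h, h', map_mul]
      exact B.mul_mem _ _ _ _ hv hw
  induction hf using Submodule.span_induction with
  | mem f hf => obtain ⟨w, rfl, rfl⟩ := hf; exact hw w
  | zero => rw [map_zero]; exact Submodule.zero_mem _
  | add a b _ _ ha hb => rw [map_add]; exact Submodule.add_mem _ ha hb
  | smul c a _ ha => rw [map_smul]; exact Submodule.smul_mem _ c ha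

theorem mul_mem_freePart {F : Type u} [Field F] {X : Type} {p : X → ZMod 2} {i j : ZMod 2}
    {f g : FreeNonUnitalNonAssocAlgebra F X} (hf : f ∈ freePart F p i) (hg : g ∈ freePart F p j) :
    f * g ∈ freePart F p (i + j) := by
  induction hf using Submodule.span_induction with
  | mem f hf =>
    obtain ⟨v, rfl, rfl⟩ := hf
    induction hg using Submodule.span_induction with
    | mem g hg =>
      obtain ⟨w, rfl, rfl⟩ := hg
      refine Submodule.subset_span ⟨FreeMagma.mul v w, ?_, ?_⟩
      · simp [wordParity, FreeMagma.letters]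
      · rw [MonoidAlgebra.single_mul_single, one_mul]; rfl
    | zero => rw [mul_zero]; exact Submodule.zero_mem _
    | add a b _ _ ha hb => rw [mul_add]; exact Submodule.add_mem _ ha hb
    | smul c a _ ha => rw [mul_smul_comm]; exact Submodule.smul_mem _ c ha
  | zero => rw [zero_mul]; exact Submodule.zero_mem _
  | add a b _ _ ha hb => rw [add_mul]; exact Submodule.add_mem _ ha hb
  | smul c a _ ha => rw [smul_mul_assoc]; exact Submodule.smul_mem _ c ha

theorem zmod_two_univ : (Set.univ : Set (ZMod 2)) = {0, 1} := by
  ext x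
  simp only [Set.mem_univ, Set.mem_insert_iff, Set.mem_singleton_iff, true_iff]
  revert x
  decide

theorem freePart_sup_eq_top (F : Type u) [Field F] {X : Type} (p : X → ZMod 2) :
    freePart F p 0 ⊔ freePart F p 1 = ⊤ := by
  rw [eq_top_iff]
  intro f _
  induction f using MonoidAlgebra.induction_linear with
  | zero => exact Submodule.zero_mem _
  | add a b ha hb => exact Submodule.add_mem _ (ha trivial) (hb trivial)
  | single w c =>
    have h : MonoidAlgebra.single w c = c • (MonoidAlgebra.single w (1 : F)) := by
      rw [MonoidAlgebra.smul_single, smul_eq_mul, mul_one]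
    rw [h]
    refine Submodule.smul_mem _ c ?_
    have hw : wordParity p w ∈ ({0, 1} : Set (ZMod 2)) := zmod_two_univ ▸ Set.mem_univ _
    rcases hw with hw | hw
    · exact Submodule.mem_sup_left (Submodule.subset_span ⟨w, hw, rfl⟩)
    · exact Submodule.mem_sup_right (Submodule.subset_span ⟨w, hw, rfl⟩)

/-- The free metabelian Jordan superalgebra on a set `X` of homogeneous generators of parities
`p`. -/
def freeMetabelianJordanSuperalgebra (F : Type u) [Field F] {X : Type} (p : X → ZMod 2) :
    Superalgebra F where
  carrier := (metabelianJordanSuperideal F p).Quot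
  part i := (freePart F p i).map (metabelianJordanSuperideal F p).toQuot
  isInternal := by
    rw [DirectSum.isInternal_submodule_iff_isCompl _ (zero_ne_one (α := ZMod 2)) zmod_two_univ]
    constructor
    · rw [Submodule.disjoint_def]
      rintro _ ⟨a, ha, rfl⟩ ⟨b, hb, hab⟩
      refine (AlgIdeal.toQuot_eq_zero _).2 ?_
      intro B hB z hz
      have hab' := (AlgIdeal.toQuot_eq_iff _).1 hab B hB z hz
      rw [map_sub, sub_eq_zero] at hab'
      have h0 := lift_mem_part B hz ha
      have h1 := lift_mem_part B hz hb
      rw [hab'] at h1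
      have hc := (DirectSum.isInternal_submodule_iff_isCompl _ (zero_ne_one (α := ZMod 2))
        zmod_two_univ).1 B.isInternal
      exact (Submodule.disjoint_def.1 hc.disjoint) _ h0 h1
    · rw [codisjoint_iff, ← Submodule.map_sup, freePart_sup_eq_top, Submodule.map_top,
        LinearMap.range_eq_top]
      exact AlgIdeal.toQuot_surjective _
  mul_mem := by
    rintro i j _ _ ⟨a, ha, rfl⟩ ⟨b, hb, rfl⟩
    exact ⟨a * b, mul_mem_freePart ha hb, rfl⟩

/-- The parities of `r` even and `s` odd generators. -/
def generatorParity (r s : ℕ) : Fin r ⊕ Fin s → ZMod 2 := Sum.elim (fun _ => 0) (fun _ => 1)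

/-- The supervariety `V_{r,s}` generated by the free metabelian Jordan superalgebra on `r` even and
`s` odd generators. For `r = s = 0` that superalgebra is zero, and so `V_{0,0}` consists of the zero
superalgebras. -/
def metabelianJordanSupervarietyOfRank (F : Type u) [Field F] (r s : ℕ) : Set (Superalgebra F) :=
  (freeMetabelianJordanSuperalgebra F (generatorParity r s)).generatedSupervariety

end

/-! By metabelianity the Jordan identity says x²·u·x = 0, and its linearization is the three-term
identity `cyclic`. If w annihilates all products, one of the three terms drops out and wzut = -wtuz.
So in a left-normed word (ab)o₁e₁o₂e₂⋯ the letters at odd places may be permuted among themselves up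
to sign, and so may the letters at even places. Everything rests on this double skew-symmetry.

Nilpotency. In a word of length at least 2n+2 over n letters, at least n of the letters after ab
stand at even places. Either one of them repeats there, or all letters occur there, including a and
b; the word vanishes in both cases. The bound is sharp because of `GrassmannModel`, whose letters
act by exterior multiplication with one set of Grassmann generators at odd places and another at
even places: there x₀x₀·x₀x₁·x₁x₂⋯ is not zero. By nilpotency every multilinear polynomial of degree
2r+2 is a superidentity on r even generators. The left-normed one fails as soon as one more
generator, even or odd, can be put in the last place; this separates rank (r,0) from (r+1,0) and,
for r ≥ 1, from (r,1).

One odd generator. Consider (z₀z₁){z₂,z₃}{z₄,z₅}⋯, where {p,q} stands for the operator R_pR_q +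
R_qR_p. Such operators commute on elements that annihilate products. Grassmann multiples of the
single odd generator anticommute as operators, so a pair made of them alone is zero. Two pairs that
contain the same even generator x can be rewritten so that both occurrences of x lie in one pair,
and a third occurrence then gives zero. Hence r+1 pairs vanish over r even generators and one odd
one (`IsMetabelianJordan.foldl_symMul_eq_zero`), while r+1 even generators and one odd one give a
nonzero value. To obtain nonzero values with one odd generator, the model H is extended to H + εH
with ε odd and ε² = 0, which is enough because the odd letter is used only once.

Two odd generators. A multilinear word is a combination of normal forms, indexed by the set A of
letters at odd places and by one of the two initial letters, the other one being a fixed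
representative τ(Aᶜ) of the complement (`IsMetabelianJordan.lift_word_mem`). The ladder
superalgebra, generated by two odd elements y₀ and y₁, has for each normal form a substitution into
its envelope at which this normal form is nonzero and all others vanish. A multilinear polynomial
that vanishes on the envelope of the ladder is therefore an identity of all metabelian Jordan
algebras (`mem_metabelianJordanIdeal_of_ladder`). Since the ladder is an image of each free
superalgebra with at least two odd generators, all these ranks generate the whole supervariety. This
also puts rank (r,1) strictly below (r,2): the latter contains the free superalgebra of rank
(r+1,1), where the identity in symmetrized pairs fails. -/

noncomputable section

/-! ### Identities of metabelian Jordan algebras -/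

/-- `w` annihilates all products. -/
def AnnihilatesProducts {B : Type*} [NonUnitalNonAssocRing B] (w : B) : Prop :=
  ∀ p q : B, w * (p * q) = 0

/-- The product `w o₁ e₁ o₂ e₂ ⋯`, bracketed from the left. -/
def alternatingMul {B : Type*} [Mul B] : B → List B → List B → B
  | w, [], _ => w
  | w, o :: os, es => alternatingMul (w * o) es os
termination_by _ os es => os.length + es.length

/-- The lengths of the lists of odd and even places of an alternating product fit together. -/
def Interleavable {α β : Type*} (os : List α) (es : List β) : Prop :=
  es.length ≤ os.length ∧ os.length ≤ es.length + 1

theorem Interleavable.tail {α β : Type*} {o : α} {os : List α} {es : List β}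
    (h : Interleavable (o :: os) es) : Interleavable es os := by
  simp only [Interleavable, List.length_cons] at *
  omega

section AlternatingMul

variable {B : Type*} [Mul B]

@[simp] theorem alternatingMul_nil (w : B) (es : List B) : alternatingMul w [] es = w := by
  rw [alternatingMul]

@[simp] theorem alternatingMul_cons (w o : B) (os es : List B) :
    alternatingMul w (o :: os) es = alternatingMul (w * o) es os := by
  rw [alternatingMul]

end AlternatingMul

section Identities

variable {B : Type*} [NonUnitalNonAssocRing B]

theorem alternatingMul_zero : ∀ os es : List B, alternatingMul (0 : B) os es = 0
  | [], _ => alternatingMul_nil _ _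
  | o :: os, es => by rw [alternatingMul_cons, zero_mul, alternatingMul_zero es os]
termination_by os es => os.length + es.length

theorem alternatingMul_add : ∀ (v w : B) (os es : List B),
    alternatingMul (v + w) os es = alternatingMul v os es + alternatingMul w os es
  | v, w, [], _ => by simp
  | v, w, o :: os, es => by
    rw [alternatingMul_cons, add_mul, alternatingMul_add _ _ es os]
    simp
termination_by _ _ os es => os.length + es.length

theorem alternatingMul_neg (w : B) (os es : List B) :
    alternatingMul (-w) os es = -alternatingMul w os es := by
  rw [eq_neg_iff_add_eq_zero, ← alternatingMul_add, neg_add_cancel, alternatingMul_zero]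

theorem AnnihilatesProducts.add {v w : B} (hv : AnnihilatesProducts v)
    (hw : AnnihilatesProducts w) : AnnihilatesProducts (v + w) := by
  intro p q
  rw [add_mul, hv, hw, add_zero]

namespace IsMetabelianJordan

theorem annihilatesProducts_mul (h : IsMetabelianJordan B) (a b : B) :
    AnnihilatesProducts (a * b) := fun p q => h.metabelian a b p q

variable [IsAddTorsionFree B]

/-- The linearization of the Jordan identity. -/
theorem cyclic (h : IsMetabelianJordan B) (a b u t : B) :
    a * b * u * t + b * t * u * a + a * t * u * b = 0 := by
  -- Metabelianity kills the right side of the Jordan identity and leaves a cubic condition in x,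
  -- which is now polarized.
  have P : ∀ x : B, x * x * u * x = 0 := fun x => by rw [h.jordan, h.metabelian]
  have h1 := P (a + b + t)
  have h2 := P (a + b)
  have h3 := P (a + t)
  have h4 := P (b + t)
  simp only [add_mul, mul_add, P] at h1 h2 h3 h4
  rw [h.comm b a, h.comm t b, h.comm t a] at h1
  rw [h.comm b a] at h2
  rw [h.comm t a] at h3
  rw [h.comm t b] at h4
  -- By commutativity the six terms of the full polarization coincide in pairs, hence the factor 2
  -- and the need for torsion-freeness.
  have h5 : (2 : ℕ) • (a * b * u * t + b * t * u * a + a * t * u * b) = 0 := by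
    linear_combination (norm := abel) h1 - h2 - h3 - h4
  exact (nsmul_right_injective two_ne_zero) (h5.trans (nsmul_zero 2).symm)

/-- Of the three terms of `cyclic`, the one in which w comes last is w times a product, hence zero.
The other two give skew-symmetry in letters two places apart. -/
theorem mul_mul_mul_comm_neg (h : IsMetabelianJordan B) {w : B} (hw : AnnihilatesProducts w)
    (z u t : B) : w * z * u * t = -(w * t * u * z) := by
  have := h.cyclic w z u t
  rw [h.comm (z * t * u) w, hw, add_zero] at this
  exact eq_neg_of_add_eq_zero_left this

theorem mul_mul_mul_self (h : IsMetabelianJordan B) {w : B} (hw : AnnihilatesProducts w)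
    (z u : B) : w * z * u * z = 0 := by
  have := h.mul_mul_mul_comm_neg hw z u z
  rw [eq_neg_iff_add_eq_zero, ← two_nsmul] at this
  exact (nsmul_right_injective two_ne_zero) (this.trans (nsmul_zero 2).symm)

/-- A transposition at odd places only changes the sign. Membership in an additive subgroup absorbs
the sign, so the signature of the permutation never has to be recorded; N = ⊥ gives vanishing
statements, a span gives normal forms. -/
theorem alternatingMul_mem_of_perm_left (h : IsMetabelianJordan B) (N : AddSubgroup B)
    {os os' : List B} (hp : os.Perm os') :
    ∀ (w : B) (es : List B), AnnihilatesProducts w → Interleavable os es →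
      alternatingMul w os es ∈ N → alternatingMul w os' es ∈ N := by
  induction hp with
  | nil => exact fun w es _ _ hm => hm
  | @cons x l l' hl ih =>
    intro w es _ hb hm
    rw [alternatingMul_cons] at hm ⊢
    cases es with
    | nil => rwa [alternatingMul_nil] at hm ⊢
    | cons e es =>
      rw [alternatingMul_cons] at hm ⊢
      -- Two letters further on, the prefix is itself a product, which renews the hypothesis on w.
      exact ih _ _ (h.annihilatesProducts_mul _ _) hb.tail.tail hm
  | swap x y l =>
    intro w es hw hb hm
    cases es with
    | nil => simp [Interleavable] at hb
    | cons e es =>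
      simp only [alternatingMul_cons] at hm ⊢
      cases es with
      | nil =>
        simp only [alternatingMul_nil] at hm ⊢
        rw [h.mul_mul_mul_comm_neg hw]
        exact N.neg_mem hm
      | cons e' es =>
        simp only [alternatingMul_cons] at hm ⊢
        rw [h.mul_mul_mul_comm_neg hw, neg_mul, alternatingMul_neg]
        exact N.neg_mem hm
  | trans hp _ ih ih' =>
    intro w es hw hb hm
    refine ih' w es hw ?_ (ih w es hw hb hm)
    simpa only [Interleavable, hp.length_eq] using hb

/-- After the first letter the roles of the two lists are exchanged and the prefix is a product;
this is why nothing is required of w. -/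
theorem alternatingMul_mem_of_perm_right (h : IsMetabelianJordan B) (N : AddSubgroup B)
    {es es' : List B} (hp : es.Perm es') (w : B) (os : List B)
    (hb : Interleavable os es) (hm : alternatingMul w os es ∈ N) :
    alternatingMul w os es' ∈ N := by
  cases os with
  | nil => simpa using hm
  | cons o os =>
    rw [alternatingMul_cons] at hm ⊢
    exact h.alternatingMul_mem_of_perm_left N hp _ _ (h.annihilatesProducts_mul _ _) hb.tail hm

theorem alternatingMul_mem_of_perm (h : IsMetabelianJordan B) (N : AddSubgroup B)
    {os os' es es' : List B} (ho : os.Perm os') (he : es.Perm es') {w : B}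
    (hw : AnnihilatesProducts w)
    (hb : Interleavable os es) (hm : alternatingMul w os es ∈ N) :
    alternatingMul w os' es' ∈ N :=
  h.alternatingMul_mem_of_perm_right N he w _
    (by simpa only [Interleavable, ho.length_eq] using hb)
    (h.alternatingMul_mem_of_perm_left N ho w es hw hb hm)

theorem alternatingMul_eq_zero_of_perm (h : IsMetabelianJordan B)
    {os os' es es' : List B} (ho : os.Perm os') (he : es.Perm es') {w : B}
    (hw : AnnihilatesProducts w) (hb : Interleavable os es)
    (hm : alternatingMul w os es = 0) : alternatingMul w os' es' = 0 := by
  have := h.alternatingMul_mem_of_perm ⊥ ho he hw hb (by simpa using hm)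
  simpa using this

/-- An alternating product vanishes if a letter occurs twice at odd places. -/
theorem alternatingMul_eq_zero_of_not_nodup_left (h : IsMetabelianJordan B) {w : B}
    (hw : AnnihilatesProducts w) {os es : List B} (hb : Interleavable os es) (hd : ¬ os.Nodup) :
    alternatingMul w os es = 0 := by
  rw [← List.exists_duplicate_iff_not_nodup] at hd
  obtain ⟨x, hx⟩ := hd
  obtain ⟨l, hl⟩ : ∃ l, (x :: x :: l).Perm os := by
    obtain ⟨l, hl⟩ := (List.duplicate_iff_sublist.1 hx).exists_perm_append
    exact ⟨l, hl.symm⟩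
  refine h.alternatingMul_eq_zero_of_perm hl (List.Perm.refl es) hw
    (by simpa only [Interleavable, hl.length_eq] using hb) ?_
  have hb' : Interleavable (x :: x :: l) es := by
    simpa only [Interleavable, hl.length_eq] using hb
  cases es with
  | nil => simp [Interleavable] at hb'
  | cons e es =>
    simp only [alternatingMul_cons]
    cases es with
    | nil => simp [h.mul_mul_mul_self hw]
    | cons e' es => simp [h.mul_mul_mul_self hw, alternatingMul_zero]

/-- An alternating product vanishes if a letter occurs twice at even places. -/
theorem alternatingMul_eq_zero_of_not_nodup_right (h : IsMetabelianJordan B) {w : B}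
    {os es : List B} (hb : Interleavable os es) (hd : ¬ es.Nodup) :
    alternatingMul w os es = 0 := by
  cases os with
  | nil =>
    have : es = [] := by
      simpa [Interleavable] using hb.1
    simp [this] at hd
  | cons o os =>
    rw [alternatingMul_cons]
    exact h.alternatingMul_eq_zero_of_not_nodup_left (h.annihilatesProducts_mul _ _) hb.tail hd

end IsMetabelianJordan

end Identities

/-! ### Normal forms of words and nilpotency -/

theorem FreeMagma.lift_mul' {X B : Type*} [Mul B] (z : X → B) (v w : FreeMagma X) :
    FreeMagma.lift z (FreeMagma.mul v w) = FreeMagma.lift z v * FreeMagma.lift z w := rfl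

theorem FreeMagma.card_letters {X : Type*} (w : FreeMagma X) :
    Multiset.card (FreeMagma.letters w) = w.length := by
  induction w using FreeMagma.rec with
  | of x => rfl
  | mul v w hv hw => simp [FreeMagma.letters, FreeMagma.length, hv, hw]

namespace IsMetabelianJordan

variable {B : Type*} [NonUnitalNonAssocRing B] {X : Type*}

/-- Every word of length at least two vanishes or equals a left-normed word. -/
theorem lift_word_eq (h : IsMetabelianJordan B) (z : X → B) (w : FreeMagma X) :
    (∃ x, w = FreeMagma.of x) ∨ ((∃ p q, FreeMagma.lift z w = p * q) ∧ (FreeMagma.lift z w = 0 ∨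
      ∃ (a b : X) (cs : List X), FreeMagma.letters w = ↑(a :: b :: cs) ∧
        FreeMagma.lift z w = (cs.map z).foldl (· * ·) (z a * z b))) := by
  induction w using FreeMagma.rec with
  | of x => exact Or.inl ⟨x, rfl⟩
  | mul v w hv hw =>
    -- Recording that the value is a product lets metabelianity kill every node both of whose
    -- factors have length at least two. What survives has a letter at each node, and commutativity
    -- moves it to the right.
    refine Or.inr ⟨⟨_, _, FreeMagma.lift_mul' z v w⟩, ?_⟩
    rw [FreeMagma.lift_mul']
    rcases hv with ⟨x, rfl⟩ | ⟨⟨p, q, hpq⟩, hv⟩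
    · rcases hw with ⟨y, rfl⟩ | ⟨-, hw | ⟨a, b, cs, hl, hw⟩⟩
      · exact Or.inr ⟨x, y, [], rfl, rfl⟩
      · left; rw [hw, mul_zero]
      · refine Or.inr ⟨a, b, cs ++ [x], ?_, ?_⟩
        · simp only [FreeMagma.letters, hl]
          rw [add_comm]
          rfl
        · rw [h.comm, hw, List.map_append, List.foldl_append]
          rfl
    · rcases hw with ⟨y, rfl⟩ | ⟨⟨p', q', hpq'⟩, hw⟩
      · rcases hv with hv | ⟨a, b, cs, hl, hv⟩
        · left; rw [hv, zero_mul]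
        · refine Or.inr ⟨a, b, cs ++ [y], ?_, ?_⟩
          · simp only [FreeMagma.letters, hl]
            rfl
          · rw [hv, List.map_append, List.foldl_append]
            rfl
      · left; rw [hpq, hpq', h.metabelian]

/-- Removing the first letter exchanges odd and even places, so in the induction the two lists swap
at each step. -/
theorem _root_.foldl_mul_eq_alternatingMul (z : X → B) (cs : List X) :
    ∀ w : B, ∃ os es : List X, Interleavable os es ∧ (os ++ es).Perm cs ∧
      (cs.map z).foldl (· * ·) w = alternatingMul w (os.map z) (es.map z) := by
  induction cs with
  | nil => exact fun w => ⟨[], [], by simp [Interleavable], by simp, by simp⟩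
  | cons c cs ih =>
    intro w
    obtain ⟨os, es, hb, hp, he⟩ := ih (w * z c)
    refine ⟨c :: es, os, ?_, ?_, ?_⟩
    · simp only [Interleavable, List.length_cons] at *
      omega
    · exact (List.perm_append_comm.trans hp).cons c
    · rw [List.map_cons, List.foldl_cons, he, List.map_cons, alternatingMul_cons]

theorem _root_.Interleavable.map {α β γ δ : Type*} {os : List α} {es : List β}
    (h : Interleavable os es) (f : α → γ) (g : β → δ) :
    Interleavable (os.map f) (es.map g) := by
  simpa [Interleavable] using h

theorem mul_self_mul_mul_self (h : IsMetabelianJordan B) (a u : B) : a * a * u * a = 0 := by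
  rw [h.jordan, h.metabelian]

variable [IsAddTorsionFree B]

/-- With t = a, `cyclic` turns abua into -½·a²ub. Then b stands twice at places of the same parity
behind a product. -/
theorem mul_mul_mul_left_mul_mul (h : IsMetabelianJordan B) (a b u v : B) :
    a * b * u * a * v * b = 0 := by
  have h1 := h.cyclic a b u a
  rw [h.comm b a] at h1
  have h2 : (2 : ℕ) • (a * b * u * a) = -(a * a * u * b) := by
    rw [eq_neg_iff_add_eq_zero, two_nsmul, h1]
  apply nsmul_right_injective two_ne_zero
  change 2 • (a * b * u * a * v * b) = 2 • 0
  rw [nsmul_zero, ← smul_mul_assoc, ← smul_mul_assoc, h2, neg_mul, neg_mul,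
    h.mul_mul_mul_self (h.annihilatesProducts_mul _ _), neg_zero]

/-- Move the two letters to the first even places. If a = b, already a²·o·a = 0; otherwise the
prefix is (ab)·o·a·o'·b, which is zero. -/
theorem alternatingMul_eq_zero_of_mem (h : IsMetabelianJordan B) (z : X → B) {a b : X}
    {os es : List X} (hb : Interleavable os es) (ha : a ∈ es) (hb' : b ∈ es) :
    alternatingMul (z a * z b) (os.map z) (es.map z) = 0 := by
  classical
  by_cases hab : a = b
  · subst hab
    have hp := List.perm_cons_erase ha
    refine h.alternatingMul_eq_zero_of_perm (List.Perm.refl _) (hp.symm.map z)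
      (h.annihilatesProducts_mul _ _) ?_ ?_
    · simpa only [Interleavable, List.length_map, hp.length_eq] using hb
    · cases os with
      | nil => simp [Interleavable] at hb; simp [hb] at ha
      | cons o os =>
        rw [List.map_cons, List.map_cons, alternatingMul_cons, alternatingMul_cons,
          h.mul_self_mul_mul_self, alternatingMul_zero]
  · have hp := List.perm_cons_erase ha
    have hp' := List.perm_cons_erase ((List.mem_erase_of_ne (Ne.symm hab)).2 hb')
    have hq := (hp.trans (hp'.cons a)).symm
    have hb2 : Interleavable os (a :: b :: (es.erase a).erase b) := by
      simpa only [Interleavable, List.length_map, hq.length_eq] using hb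
    refine h.alternatingMul_eq_zero_of_perm (List.Perm.refl _) (hq.map z)
      (h.annihilatesProducts_mul _ _) (hb2.map z z) ?_
    match os, hb2 with
    | [], hb2 => simp [Interleavable] at hb2
    | [o], hb2 => simp [Interleavable] at hb2
    | o :: o' :: os, hb2 =>
      simp only [List.map_cons, alternatingMul_cons, h.mul_mul_mul_left_mul_mul,
        alternatingMul_zero]

/-- At least 2n letters follow the initial two, and the numbers of odd and even places differ by at
most one, so n or more letters are at even places. Without repetition these are all the letters, in
particular the two initial ones. -/
theorem lift_word_eq_zero (h : IsMetabelianJordan B) {n : ℕ} (z : Fin n → B)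
    (w : FreeMagma (Fin n)) (hw : 2 * n + 2 ≤ w.length) : FreeMagma.lift z w = 0 := by
  rcases h.lift_word_eq z w with ⟨x, rfl⟩ | ⟨-, h0 | ⟨a, b, cs, hl, he⟩⟩
  · simp [FreeMagma.length] at hw
  · exact h0
  · obtain ⟨os, es, hb, hp, hf⟩ := foldl_mul_eq_alternatingMul z cs (z a * z b)
    rw [he, hf]
    have hc : 2 * n ≤ os.length + es.length := by
      rw [← FreeMagma.card_letters, hl, Multiset.coe_card] at hw
      rw [← List.length_append, hp.length_eq]
      simpa using hw
    have hes : n ≤ es.length := by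
      have := hb.2; omega
    by_cases hd : es.Nodup
    · have hall : ∀ x, x ∈ es := by
        intro x
        rw [← List.mem_toFinset]
        have : es.toFinset = Finset.univ := by
          rw [← Finset.card_eq_iff_eq_univ]
          apply le_antisymm (Finset.card_le_univ _)
          rw [List.toFinset_card_of_nodup hd, Fintype.card_fin]
          exact hes
        rw [this]
        exact Finset.mem_univ x
      exact h.alternatingMul_eq_zero_of_mem z hb (hall a) (hall b)
    · exact h.alternatingMul_eq_zero_of_not_nodup_right (hb.map z z)
        (fun hn => hd (List.Nodup.of_map z hn))

/-- A metabelian Jordan algebra with `n` generators is nilpotent. -/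
theorem lift_id_eq_zero (h : IsMetabelianJordan B) (F : Type*) [Field F] [Module F B]
    [IsScalarTower F B B] [SMulCommClass F B B] {n : ℕ} (z : Fin n → B)
    (hz : Submodule.span F (Set.range fun w => FreeMagma.lift z w) = ⊤)
    (w : FreeMagma B) (hw : 2 * n + 2 ≤ w.length) : FreeMagma.lift (id : B → B) w = 0 := by
  -- Expanding the factors in words of the generators cannot shorten the product, so only generator
  -- words of length at least that of w appear.
  have key : ∀ w : FreeMagma B, FreeMagma.lift (id : B → B) w ∈
      Submodule.span F {b | ∃ v : FreeMagma (Fin n), w.length ≤ v.length ∧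
        b = FreeMagma.lift z v} := by
    intro w
    induction w using FreeMagma.rec with
    | of x =>
      have hx : x ∈ Submodule.span F (Set.range fun w => FreeMagma.lift z w) := by
        rw [hz]; trivial
      refine Submodule.span_mono ?_ hx
      rintro _ ⟨v, rfl⟩
      refine ⟨v, ?_, rfl⟩
      cases v with
      | of _ => exact le_rfl
      | mul v w =>
        have : ∀ v : FreeMagma (Fin n), 1 ≤ v.length := fun v => by
          induction v using FreeMagma.rec with
          | of _ => exact le_rfl
          | mul v w hv hw => exact hv.trans (Nat.le_add_right _ _)
        exact this _
    | mul v w hv hw =>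
      rw [FreeMagma.lift_mul']
      generalize FreeMagma.lift id v = a at hv
      generalize FreeMagma.lift id w = b at hw
      induction hv using Submodule.span_induction with
      | mem a ha =>
        obtain ⟨v', hv', rfl⟩ := ha
        induction hw using Submodule.span_induction with
        | mem b hb =>
          obtain ⟨w', hw', rfl⟩ := hb
          exact Submodule.subset_span ⟨FreeMagma.mul v' w', Nat.add_le_add hv' hw', rfl⟩
        | zero => rw [mul_zero]; exact Submodule.zero_mem _
        | add a b _ _ ha hb => rw [mul_add]; exact Submodule.add_mem _ ha hb
        | smul c a _ ha => rw [mul_smul_comm]; exact Submodule.smul_mem _ c ha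
      | zero => rw [zero_mul]; exact Submodule.zero_mem _
      | add a b _ _ ha hb => rw [add_mul]; exact Submodule.add_mem _ ha hb
      | smul c a _ ha => rw [smul_mul_assoc]; exact Submodule.smul_mem _ c ha
  have hle : Submodule.span F {b | ∃ v : FreeMagma (Fin n), w.length ≤ v.length ∧
        b = FreeMagma.lift z v} ≤ ⊥ := by
    rw [Submodule.span_le]
    rintro _ ⟨v, hv, rfl⟩
    exact h.lift_word_eq_zero z v (hw.trans hv)
  exact hle (key w)

end IsMetabelianJordan

/-! ### Symmetrized pairs of multiplications -/

section SymMul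

variable {B : Type*} [NonUnitalNonAssocRing B]

/-- `w (R_p R_q + R_q R_p)`. -/
def symMul (w : B) (pq : B × B) : B := w * pq.1 * pq.2 + w * pq.2 * pq.1

theorem symMul_swap (w p q : B) : symMul w (p, q) = symMul w (q, p) := add_comm _ _

theorem symMul_zero (pq : B × B) : symMul 0 pq = 0 := by simp [symMul]

theorem symMul_add (v w : B) (pq : B × B) : symMul (v + w) pq = symMul v pq + symMul w pq := by
  simp only [symMul, add_mul]; abel

theorem foldl_symMul_zero (l : List (B × B)) : l.foldl symMul 0 = 0 := by
  induction l with
  | nil => rfl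
  | cons pq l ih => rw [List.foldl_cons, symMul_zero, ih]

theorem foldl_symMul_add (l : List (B × B)) : ∀ v w : B,
    l.foldl symMul (v + w) = l.foldl symMul v + l.foldl symMul w := by
  induction l with
  | nil => exact fun v w => rfl
  | cons pq l ih => intro v w; rw [List.foldl_cons, symMul_add, ih]; rfl

theorem foldl_symMul_nsmul (l : List (B × B)) (n : ℕ) (w : B) :
    l.foldl symMul (n • w) = n • l.foldl symMul w := by
  induction n with
  | zero => rw [zero_smul, zero_smul, foldl_symMul_zero]
  | succ n ih => rw [succ_nsmul, succ_nsmul, foldl_symMul_add, ih]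

theorem foldl_symMul_neg (l : List (B × B)) (w : B) :
    l.foldl symMul (-w) = -l.foldl symMul w := by
  rw [eq_neg_iff_add_eq_zero, ← foldl_symMul_add, neg_add_cancel, foldl_symMul_zero]

namespace IsMetabelianJordan

theorem annihilatesProducts_symMul (h : IsMetabelianJordan B) (w : B) (pq : B × B) :
    AnnihilatesProducts (symMul w pq) :=
  (h.annihilatesProducts_mul _ _).add (h.annihilatesProducts_mul _ _)

/-- The set `X` consists of even multiples of a single even letter, as far as multiplications are
concerned. -/
structure _root_.IsEvenLetter (X : Set B) : Prop where
  comm : ∀ p ∈ X, ∀ q ∈ X, ∀ w : B, w * p * q = w * q * p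
  mul_mul : ∀ p ∈ X, ∀ q ∈ X, ∀ w : B, AnnihilatesProducts w → ∀ u, w * p * u * q = 0

/-- In each of the four terms, p'' is two places away from p or from p', so the second property of
an even letter applies. -/
theorem symMul_symMul_eq_zero (h : IsMetabelianJordan B) {w : B} (hw : AnnihilatesProducts w)
    {X : Set B} (hX : IsEvenLetter X) {p p' p'' : B} (hp : p ∈ X) (hp' : p' ∈ X) (hp'' : p'' ∈ X)
    (q : B) : symMul (symMul w (p, p')) (p'', q) = 0 := by
  simp only [symMul, add_mul]
  rw [hX.mul_mul p hp p'' hp'' w hw, hX.mul_mul p' hp' p'' hp'' w hw,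
    hX.mul_mul p' hp' p'' hp'' _ (h.annihilatesProducts_mul _ _),
    hX.mul_mul p hp p'' hp'' _ (h.annihilatesProducts_mul _ _)]
  simp

variable [IsAddTorsionFree B]

/-- Exchanging the pairs is one transposition at odd places and one at even places; the two signs
cancel. -/
theorem mul_pair_comm (h : IsMetabelianJordan B) {w : B} (hw : AnnihilatesProducts w)
    (p q p' q' : B) : w * p * q * p' * q' = w * p' * q' * p * q := by
  rw [h.mul_mul_mul_comm_neg hw, neg_mul,
    h.mul_mul_mul_comm_neg (h.annihilatesProducts_mul w p') q p q', neg_neg]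

theorem symMul_comm (h : IsMetabelianJordan B) {w : B} (hw : AnnihilatesProducts w)
    (x y : B × B) : symMul (symMul w x) y = symMul (symMul w y) x := by
  obtain ⟨p, q⟩ := x
  obtain ⟨p', q'⟩ := y
  simp only [symMul, add_mul]
  rw [h.mul_pair_comm hw p q p' q', h.mul_pair_comm hw q p p' q', h.mul_pair_comm hw p q q' p',
    h.mul_pair_comm hw q p q' p']
  abel

theorem foldl_symMul_perm (h : IsMetabelianJordan B) {l l' : List (B × B)} (hp : l.Perm l') :
    ∀ {w : B}, AnnihilatesProducts w → l.foldl symMul w = l'.foldl symMul w := by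
  induction hp with
  | nil => exact fun _ => rfl
  | cons x _ ih => exact fun _ => ih (h.annihilatesProducts_symMul _ _)
  | swap x y l =>
    intro w hw
    simp only [List.foldl_cons]
    rw [h.symMul_comm hw]
  | trans _ _ ih ih' => exact fun hw => (ih hw).trans (ih' hw)

/-- Expanded, the left side has two kinds of terms. Those with p and p' at places of the same parity
vanish; in the others skew-symmetry brings p and p' together. As p and p' commute, {p,p'} is twice
R_pR_p', which accounts for the factor 2. -/
theorem symMul_symMul (h : IsMetabelianJordan B) {w : B} (hw : AnnihilatesProducts w)
    {X : Set B} (hX : IsEvenLetter X) {p p' : B} (hp : p ∈ X) (hp' : p' ∈ X) (q q' : B) :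
    2 • symMul (symMul w (p, q)) (p', q') = -symMul (symMul w (p, p')) (q, q') := by
  have e1 : w * p * q * p' * q' = 0 := by rw [hX.mul_mul p hp p' hp' w hw, zero_mul]
  have e2 : w * q * p * q' * p' = 0 :=
    hX.mul_mul p hp p' hp' _ (h.annihilatesProducts_mul _ _) _
  have e3 : w * p * q * q' * p' = -(w * p * p' * q' * q) := by
    rw [h.mul_mul_mul_comm_neg (h.annihilatesProducts_mul w p) q q' p']
  have e4 : w * q * p * p' * q' = -(w * p * p' * q * q') := by
    rw [h.mul_mul_mul_comm_neg hw q p p', neg_mul, hX.comm p' hp' p hp]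
  simp only [symMul, add_mul]
  rw [e1, e2, e3, e4, hX.comm p' hp' p hp]
  abel

/-- A pair that contains a letter outside L' contains one from X. Since pairs commute and are
symmetric, it can be moved to the front with that letter first. -/
theorem exists_foldl_symMul_eq (h : IsMetabelianJordan B) {X L L' : Set B}
    (hL : L ⊆ X ∪ L') {l : List (B × B)} (hl : ∀ x ∈ l, x.1 ∈ L ∧ x.2 ∈ L)
    (hn : ¬ ∀ x ∈ l, x.1 ∈ L' ∧ x.2 ∈ L') :
    ∃ (p q : B) (l' : List (B × B)), p ∈ X ∧ q ∈ L ∧ (∀ x ∈ l', x.1 ∈ L ∧ x.2 ∈ L) ∧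
      l.length = l'.length + 1 ∧
      ∀ w, AnnihilatesProducts w → l.foldl symMul w = l'.foldl symMul (symMul w (p, q)) := by
  classical
  push Not at hn
  obtain ⟨⟨p, q⟩, hx, hx'⟩ := hn
  have hperm := List.perm_cons_erase hx
  have hlx := hl _ hx
  have hsub : ∀ x ∈ l.erase (p, q), x.1 ∈ L ∧ x.2 ∈ L := fun x hx => hl x (List.mem_of_mem_erase hx)
  by_cases hp : p ∈ L'
  · refine ⟨q, p, l.erase (p, q), (hL hlx.2).resolve_right (hx' hp), hlx.1, hsub,
      hperm.length_eq, fun w hw => ?_⟩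
    rw [h.foldl_symMul_perm hperm hw, List.foldl_cons, symMul_swap]
  · refine ⟨p, q, l.erase (p, q), (hL hlx.1).resolve_right hp, hlx.2, hsub,
      hperm.length_eq, fun w hw => ?_⟩
    rw [h.foldl_symMul_perm hperm hw, List.foldl_cons]

/-- A product of more than `r` symmetrized pairs over `r` even letters and one odd letter
vanishes. -/
theorem foldl_symMul_eq_zero (h : IsMetabelianJordan B) {ι : Type*} [DecidableEq ι]
    (X : ι → Set B) (hX : ∀ i, IsEvenLetter (X i)) (Y K : Set B)
    (hK : ∀ w ∈ K, AnnihilatesProducts w) (hKmul : ∀ w ∈ K, ∀ x, symMul w x ∈ K)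
    (hY : ∀ p ∈ Y, ∀ q ∈ Y, ∀ w ∈ K, w * p * q = -(w * q * p))
    (J : Finset ι) : ∀ l : List (B × B),
      (∀ x ∈ l, x.1 ∈ Y ∪ ⋃ j ∈ J, X j ∧ x.2 ∈ Y ∪ ⋃ j ∈ J, X j) → J.card < l.length →
      ∀ w ∈ K, l.foldl symMul w = 0 := by
  induction J using Finset.induction_on with
  | empty =>
    intro l hl hc w hw
    cases l with
    | nil => simp at hc
    | cons x l =>
      have hx := hl x List.mem_cons_self
      simp only [Finset.notMem_empty, Set.iUnion_of_empty, Set.iUnion_empty, Set.union_empty] at hx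
      have : symMul w x = 0 := by
        rw [symMul, hY _ hx.1 _ hx.2 w hw, neg_add_cancel]
      rw [List.foldl_cons, this, foldl_symMul_zero]
  | insert j J hj ih =>
    intro l hl hc w hw
    rw [Finset.card_insert_of_notMem hj] at hc
    set L := Y ∪ ⋃ i ∈ insert j J, X i with hLdef
    have hL : L ⊆ X j ∪ (Y ∪ ⋃ i ∈ J, X i) := by
      rw [hLdef, Finset.set_biUnion_insert]
      intro x
      simp only [Set.mem_union]
      tauto
    by_cases hf : ∀ x ∈ l, x.1 ∈ Y ∪ ⋃ j ∈ J, X j ∧ x.2 ∈ Y ∪ ⋃ j ∈ J, X j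
    · exact ih l hf (by omega) w hw
    obtain ⟨p, q, l', hp, hq, hl', hlen, he⟩ := h.exists_foldl_symMul_eq hL hl hf
    rw [he w (hK w hw)]
    by_cases hf' : ∀ x ∈ l', x.1 ∈ Y ∪ ⋃ j ∈ J, X j ∧ x.2 ∈ Y ∪ ⋃ j ∈ J, X j
    -- The letter j occurs in one pair only. Discarding that pair costs one pair and one even
    -- letter, so the bound survives.
    · exact ih l' hf' (by omega) _ (hKmul _ hw _)
    obtain ⟨p', q', l'', hp', hq', hl'', hlen', he'⟩ := h.exists_foldl_symMul_eq hL hl' hf'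
    rw [he' _ (h.annihilatesProducts_symMul _ _)]
    -- The letter j occurs in two pairs. Both occurrences are collected in one pair, so that again
    -- only one pair is lost on eliminating j.
    apply nsmul_right_injective two_ne_zero
    change 2 • _ = 2 • 0
    rw [← foldl_symMul_nsmul, h.symMul_symMul (hK w hw) (hX j) hp hp', foldl_symMul_neg, nsmul_zero,
      neg_eq_zero]
    change ((q, q') :: l'').foldl symMul (symMul w (p, p')) = 0
    have hl3 : ∀ x ∈ (q, q') :: l'', x.1 ∈ L ∧ x.2 ∈ L := by
      intro x hx
      rcases List.mem_cons.1 hx with rfl | hx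
      · exact ⟨hq, hq'⟩
      · exact hl'' x hx
    by_cases hf'' : ∀ x ∈ (q, q') :: l'', x.1 ∈ Y ∪ ⋃ j ∈ J, X j ∧ x.2 ∈ Y ∪ ⋃ j ∈ J, X j
    · exact ih _ hf'' (by rw [List.length_cons]; omega) _ (hKmul _ hw _)
    -- A further occurrence of j lies in some remaining pair, and together with the collected pair
    -- it gives zero.
    obtain ⟨p3, q3, l3, hp3, -, -, -, he3⟩ := h.exists_foldl_symMul_eq hL hl3 hf''
    rw [he3 _ (h.annihilatesProducts_symMul _ _), h.symMul_symMul_eq_zero (hK w hw) (hX j) hp hp' hp3,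
      foldl_symMul_zero]

end IsMetabelianJordan

end SymMul

/-! ### The Grassmann algebra -/

namespace GrassmannAlgebra

variable {F : Type u} [Field F]

/-- The `i`-th generator of the Grassmann algebra. -/
def gen (F : Type u) [Field F] (i : ℕ) : GrassmannAlgebra F :=
  ExteriorAlgebra.ι F (Finsupp.single i 1)

theorem gen_mem_part (i : ℕ) : gen F i ∈ part F 1 :=
  CliffordAlgebra.ι_mem_evenOdd_one (0 : QuadraticForm F (ℕ →₀ F)) (Finsupp.single i 1)

theorem one_mem_part : (1 : GrassmannAlgebra F) ∈ part F 0 :=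
  SetLike.one_mem_graded (CliffordAlgebra.evenOdd (0 : QuadraticForm F (ℕ →₀ F)))

theorem ι_mul_ι (a b : ℕ →₀ F) : ExteriorAlgebra.ι F a * ExteriorAlgebra.ι F b =
    -(ExteriorAlgebra.ι F b * ExteriorAlgebra.ι F a) :=
  eq_neg_of_add_eq_zero_left (ExteriorAlgebra.ι_add_mul_swap a b)

theorem ι_mul_ι_comm (a b : ℕ →₀ F) (h : GrassmannAlgebra F) :
    ExteriorAlgebra.ι F a * ExteriorAlgebra.ι F b * h =
      h * (ExteriorAlgebra.ι F a * ExteriorAlgebra.ι F b) := by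
  induction h using ExteriorAlgebra.induction with
  | algebraMap r => rw [Algebra.commutes]
  | ι c => rw [mul_assoc, ι_mul_ι b c, mul_neg, ← mul_assoc, ι_mul_ι a c, neg_mul, neg_neg,
      mul_assoc]
  | mul x y hx hy => rw [← mul_assoc, hx, mul_assoc, hy, mul_assoc]
  | add x y hx hy => rw [mul_add, hx, hy, add_mul]

theorem even_comm {g : GrassmannAlgebra F} (hg : g ∈ part F 0) (h : GrassmannAlgebra F) :
    g * h = h * g := by
  refine CliffordAlgebra.even_induction (0 : QuadraticForm F (ℕ →₀ F))
    (motive := fun g _ => g * h = h * g) ?_ ?_ ?_ g hg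
  · intro r; exact Algebra.commutes r h
  · intro x y _ _ hx hy; exact (add_mul x y h).trans (by rw [hx, hy]; exact (mul_add h x y).symm)
  · intro a b x _ hx
    change ExteriorAlgebra.ι F a * ExteriorAlgebra.ι F b * x * h =
      h * (ExteriorAlgebra.ι F a * ExteriorAlgebra.ι F b * x)
    rw [mul_assoc _ x h, hx, ← mul_assoc, ι_mul_ι_comm a b h, mul_assoc]

theorem ι_mul_odd (a : ℕ →₀ F) {g : GrassmannAlgebra F} (hg : g ∈ part F 1) :
    ExteriorAlgebra.ι F a * g = -(g * ExteriorAlgebra.ι F a) := by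
  refine CliffordAlgebra.odd_induction (0 : QuadraticForm F (ℕ →₀ F))
    (P := fun g _ => ExteriorAlgebra.ι F a * g = -(g * ExteriorAlgebra.ι F a)) ?_ ?_ ?_ g hg
  · intro v; exact ι_mul_ι a v
  · intro x y _ _ hx hy
    refine (mul_add (ExteriorAlgebra.ι F a) x y).trans ?_
    rw [hx, hy]
    refine Eq.trans ?_ (congrArg Neg.neg (add_mul x y (ExteriorAlgebra.ι F a)).symm)
    exact (neg_add _ _).symm
  · intro b c x _ hx
    change ExteriorAlgebra.ι F a * (ExteriorAlgebra.ι F b * ExteriorAlgebra.ι F c * x) =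
      -(ExteriorAlgebra.ι F b * ExteriorAlgebra.ι F c * x * ExteriorAlgebra.ι F a)
    rw [← mul_assoc, ← ι_mul_ι_comm b c, mul_assoc, hx, mul_neg]
    rw [← mul_assoc (_ * _) x]

theorem odd_anticomm {g h : GrassmannAlgebra F} (hg : g ∈ part F 1) (hh : h ∈ part F 1) :
    g * h = -(h * g) := by
  refine CliffordAlgebra.odd_induction (0 : QuadraticForm F (ℕ →₀ F))
    (P := fun g _ => g * h = -(h * g)) ?_ ?_ ?_ g hg
  · intro v; exact ι_mul_odd v hh
  · intro x y _ _ hx hy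
    refine (add_mul x y h).trans ?_
    rw [hx, hy]
    refine Eq.trans ?_ (congrArg Neg.neg (mul_add h x y).symm)
    exact (neg_add _ _).symm
  · intro b c x _ hx
    change ExteriorAlgebra.ι F b * ExteriorAlgebra.ι F c * x * h =
      -(h * (ExteriorAlgebra.ι F b * ExteriorAlgebra.ι F c * x))
    rw [mul_assoc, hx, mul_neg, ← mul_assoc, ι_mul_ι_comm b c h, mul_assoc]

/-- The sign stays unspecified, since only the nonvanishing of the product is needed. -/
theorem prod_gen (l : List ℕ) (hl : l.Nodup) : ∃ c : ℤˣ, (l.map (gen F)).prod =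
    c • (Finsupp.basisSingleOne (R := F) (ι := ℕ)).ExteriorAlgebra l.toFinset := by
  induction l with
  | nil =>
    refine ⟨1, ?_⟩
    rw [ExteriorAlgebra.basis_apply_ofCard (n := 0) _ (by simp)]
    simp [ExteriorAlgebra.ιMulti_family, ExteriorAlgebra.ιMulti_apply]
  | cons i l ih =>
    obtain ⟨c, hc⟩ := ih (List.nodup_cons.1 hl).2
    have hi : gen F i = (Finsupp.basisSingleOne (R := F) (ι := ℕ)).ExteriorAlgebra {i} := by
      rw [ExteriorAlgebra.basis_apply_ofCard (n := 1) _ (by simp), ExteriorAlgebra.ιMulti_family,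
        ExteriorAlgebra.ιMulti_apply]
      have hmem : (Set.powersetCard.ofFinEmbEquiv.symm
          (Set.powersetCard.ofCard (s := ({i} : Finset ℕ)) (n := 1) (by simp))) 0 = i := by
        have := (Set.powersetCard.mem_range_ofFinEmbEquiv_symm_iff_mem
          (Set.powersetCard.ofCard (s := ({i} : Finset ℕ)) (n := 1) (by simp)) _).1 ⟨0, rfl⟩
        simpa [← Set.powersetCard.mem_coe_iff] using this
      simp [gen, hmem]
    have hd : Disjoint ({i} : Finset ℕ) l.toFinset := by
      simpa using (List.nodup_cons.1 hl).1
    obtain ⟨d, h⟩ : ∃ d : ℤˣ, (Finsupp.basisSingleOne (R := F) (ι := ℕ)).ExteriorAlgebra {i} *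
        (Finsupp.basisSingleOne (R := F) (ι := ℕ)).ExteriorAlgebra l.toFinset =
        d • (Finsupp.basisSingleOne (R := F) (ι := ℕ)).ExteriorAlgebra
          (({i} : Finset ℕ).disjUnion l.toFinset hd) :=
      ⟨_, ExteriorAlgebra.basis_mul_of_disjoint (Finsupp.basisSingleOne (R := F) (ι := ℕ))
      (Set.powersetCard.ofCard (s := ({i} : Finset ℕ)) (n := 1) (by simp))
      (Set.powersetCard.ofCard (s := l.toFinset) rfl) hd⟩
    refine ⟨c * d, ?_⟩
    rw [List.map_cons, List.prod_cons, hc, mul_smul_comm, hi, h, mul_smul, List.toFinset_cons]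
    congr 3
    rw [Finset.disjUnion_eq_union, Finset.insert_eq]

theorem prod_gen_ne_zero (l : List ℕ) (hl : l.Nodup) : (l.map (gen F)).prod ≠ 0 := by
  obtain ⟨c, hc⟩ := prod_gen (F := F) l hl
  rw [hc, Ne, smul_eq_zero_iff_eq]
  exact (Finsupp.basisSingleOne (R := F) (ι := ℕ)).ExteriorAlgebra.ne_zero _

end GrassmannAlgebra

/-! ### Grassmann envelopes -/

section Envelope

variable {F : Type u} [Field F]

theorem FreeNonUnitalNonAssocAlgebra.map_lift {X : Type*} {A B : Type*} [NonUnitalNonAssocSemiring A]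
    [Module F A] [IsScalarTower F A A] [SMulCommClass F A A] [NonUnitalNonAssocSemiring B]
    [Module F B] [IsScalarTower F B B] [SMulCommClass F B B] (φ : A →ₙₐ[F] B) (a : X → A)
    (f : FreeNonUnitalNonAssocAlgebra F X) :
    φ (FreeNonUnitalNonAssocAlgebra.lift F a f) =
      FreeNonUnitalNonAssocAlgebra.lift F (fun x => φ (a x)) f := by
  have : φ.comp (FreeNonUnitalNonAssocAlgebra.lift F a) =
      FreeNonUnitalNonAssocAlgebra.lift F (fun x => φ (a x)) := by
    refine FreeNonUnitalNonAssocAlgebra.hom_ext F fun x => ?_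
    rw [NonUnitalAlgHom.comp_apply, FreeNonUnitalNonAssocAlgebra.lift_of_apply,
      FreeNonUnitalNonAssocAlgebra.lift_of_apply]
  exact DFunLike.congr_fun this f

theorem FreeNonUnitalNonAssocAlgebra.lift_single {X : Type*} {A : Type*} [NonUnitalNonAssocSemiring A]
    [Module F A] [IsScalarTower F A A] [SMulCommClass F A A] (a : X → A) (w : FreeMagma X) (c : F) :
    FreeNonUnitalNonAssocAlgebra.lift F a (MonoidAlgebra.single w c) =
      c • FreeMagma.lift a w := by
  have h1 : ∀ w : FreeMagma X, FreeNonUnitalNonAssocAlgebra.lift F a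
      (MonoidAlgebra.single w (1 : F)) = FreeMagma.lift a w := by
    intro w
    induction w using FreeMagma.rec with
    | of x => exact FreeNonUnitalNonAssocAlgebra.lift_of_apply F a x
    | mul v w hv hw =>
      have h : (MonoidAlgebra.single (FreeMagma.mul v w) (1 : F)) =
          MonoidAlgebra.single v 1 * MonoidAlgebra.single w 1 := by
        rw [MonoidAlgebra.single_mul_single, one_mul]; rfl
      rw [h, map_mul, hv, hw]
      rfl
  rw [← h1, ← map_smul, MonoidAlgebra.smul_single, smul_eq_mul, mul_one]

/-- The homomorphism `G ⊗ A → G ⊗ B` induced by a homomorphism `A → B`. -/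
def grassmannMap {A B : Type*} [NonUnitalNonAssocRing A]
    [Module F A] [IsScalarTower F A A] [SMulCommClass F A A] [NonUnitalNonAssocRing B]
    [Module F B] [IsScalarTower F B B] [SMulCommClass F B B] (φ : A →ₙₐ[F] B) :
    (GrassmannAlgebra F ⊗[F] A) →ₙₐ[F] (GrassmannAlgebra F ⊗[F] B) where
  toFun := LinearMap.lTensor (GrassmannAlgebra F) (φ : A →ₗ[F] B)
  map_smul' := fun c x => map_smul _ c x
  map_zero' := map_zero _
  map_add' := map_add _
  map_mul' x y := by
    induction x using TensorProduct.induction_on with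
    | zero => simp
    | add x x' hx hx' => rw [add_mul, map_add, hx, hx', map_add, add_mul]
    | tmul g a =>
      induction y using TensorProduct.induction_on with
      | zero => simp
      | add x x' hx hx' => rw [mul_add, map_add, hx, hx', map_add, mul_add]
      | tmul h b => simp [Algebra.TensorProduct.tmul_mul_tmul]

theorem grassmannMap_tmul {A B : Type*} [NonUnitalNonAssocRing A]
    [Module F A] [IsScalarTower F A A] [SMulCommClass F A A] [NonUnitalNonAssocRing B]
    [Module F B] [IsScalarTower F B B] [SMulCommClass F B B] (φ : A →ₙₐ[F] B)
    (g : GrassmannAlgebra F) (a : A) : grassmannMap φ (g ⊗ₜ a) = g ⊗ₜ φ a :=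
  LinearMap.lTensor_tmul _ _ _ _

/-- If no nonzero element of `A` is killed by all of the homomorphisms `φ i`, the same is true of
`G ⊗ A`. -/
theorem eq_zero_of_grassmannMap {A : Type*} [NonUnitalNonAssocRing A]
    [Module F A] [IsScalarTower F A A] [SMulCommClass F A A] (t : GrassmannAlgebra F ⊗[F] A)
    (P : (B : Superalgebra F) → (A →ₙₐ[F] B.carrier) → Prop)
    (hP : ∀ a : A, (∀ B φ, P B φ → φ a = 0) → a = 0)
    (ht : ∀ B φ, P B φ → grassmannMap φ t = 0) : t = 0 := by
  -- Coordinates along a basis of the Grassmann algebra commute with the induced maps, so the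
  -- coordinates of t in A are killed by all φ and are therefore zero.
  let b := Module.Free.chooseBasis F (GrassmannAlgebra F)
  have key : ∀ (B : Superalgebra F) (φ : A →ₙₐ[F] B.carrier) (t : GrassmannAlgebra F ⊗[F] A) i,
      TensorProduct.equivFinsuppOfBasisLeft b (grassmannMap φ t) i =
        φ (TensorProduct.equivFinsuppOfBasisLeft b t i) := by
    intro B φ t i
    induction t using TensorProduct.induction_on with
    | zero => simp
    | add x y hx hy => simp only [map_add, Finsupp.add_apply, hx, hy]
    | tmul g a =>
      simp [grassmannMap_tmul]
  apply (TensorProduct.equivFinsuppOfBasisLeft b).injective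
  rw [map_zero]
  ext i
  rw [Finsupp.zero_apply]
  refine hP _ fun B φ hφ => ?_
  rw [← key, ht B φ hφ, map_zero, Finsupp.zero_apply]

theorem Superalgebra.tmul_mem_envelope (A : Superalgebra F) {i : ZMod 2} {g : GrassmannAlgebra F}
    {a : A.carrier} (hg : g ∈ GrassmannAlgebra.part F i) (ha : a ∈ A.part i) :
    g ⊗ₜ[F] a ∈ A.envelope :=
  Submodule.subset_span ⟨i, g, a, hg, ha, rfl⟩

/-- A homomorphism of superalgebras maps the Grassmann envelope to the Grassmann envelope. -/
theorem grassmannMap_mem_envelope {A B : Superalgebra F} (φ : A.carrier →ₙₐ[F] B.carrier)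
    (hφ : ∀ i, ∀ a ∈ A.part i, φ a ∈ B.part i) {t : GrassmannAlgebra F ⊗[F] A.carrier}
    (ht : t ∈ A.envelope) : grassmannMap φ t ∈ B.envelope := by
  change t ∈ Submodule.span F _ at ht
  change _ ∈ Submodule.span F _
  induction ht using Submodule.span_induction with
  | mem t ht =>
    obtain ⟨i, g, a, hg, ha, rfl⟩ := ht
    rw [grassmannMap_tmul]
    exact B.tmul_mem_envelope hg (hφ i a ha)
  | zero => rw [map_zero]; exact Submodule.zero_mem _
  | add x y _ _ hx hy => rw [map_add]; exact Submodule.add_mem _ hx hy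
  | smul c x _ hx => rw [map_smul]; exact Submodule.smul_mem _ c hx

/-- The identities of a metabelian Jordan algebra, for a subalgebra. -/
theorem isMetabelianJordan_coe_iff {A : Type*} [NonUnitalNonAssocRing A] [Module F A]
    [IsScalarTower F A A] [SMulCommClass F A A] (S : NonUnitalSubalgebra F A) :
    IsMetabelianJordan S ↔ (∀ x ∈ S, ∀ y ∈ S, x * y = y * x) ∧
      (∀ x ∈ S, ∀ y ∈ S, x * x * y * x = x * x * (y * x)) ∧
      (∀ x ∈ S, ∀ y ∈ S, ∀ z ∈ S, ∀ t ∈ S, x * y * (z * t) = 0) := by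
  constructor
  · intro h
    refine ⟨fun x hx y hy => ?_, fun x hx y hy => ?_, fun x hx y hy z hz t ht => ?_⟩
    · exact congrArg Subtype.val (h.comm ⟨x, hx⟩ ⟨y, hy⟩)
    · exact congrArg Subtype.val (h.jordan ⟨x, hx⟩ ⟨y, hy⟩)
    · exact congrArg Subtype.val (h.metabelian ⟨x, hx⟩ ⟨y, hy⟩ ⟨z, hz⟩ ⟨t, ht⟩)
  · rintro ⟨h1, h2, h3⟩
    refine ⟨fun x y => ?_, fun x y => ?_, fun x y z t => ?_⟩
    · exact Subtype.ext (h1 x x.2 y y.2)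
    · exact Subtype.ext (h2 x x.2 y y.2)
    · exact Subtype.ext (h3 x x.2 y y.2 z z.2 t t.2)

theorem Superalgebra.envelope_le_span (A : Superalgebra F) (S : ZMod 2 → Set A.carrier)
    (hS : ∀ i, A.part i ≤ Submodule.span F (S i)) :
    A.envelope.toSubmodule ≤ Submodule.span F
      {t | ∃ (i : ZMod 2) (g : GrassmannAlgebra F) (a : A.carrier),
        g ∈ GrassmannAlgebra.part F i ∧ a ∈ S i ∧ t = g ⊗ₜ[F] a} := by
  change Submodule.span F _ ≤ _
  rw [Submodule.span_le]
  rintro _ ⟨i, g, a, hg, ha, rfl⟩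
  have ha' := hS i ha
  rw [SetLike.mem_coe]
  clear ha
  induction ha' using Submodule.span_induction with
  | mem a ha => exact Submodule.subset_span ⟨i, g, a, hg, ha, rfl⟩
  | zero => rw [TensorProduct.tmul_zero]; exact Submodule.zero_mem _
  | add x y _ _ hx hy => rw [TensorProduct.tmul_add]; exact Submodule.add_mem _ hx hy
  | smul c x _ hx => rw [TensorProduct.tmul_smul]; exact Submodule.smul_mem _ c hx

/-- It suffices to verify the linearized identities on a spanning set. -/
theorem isMetabelianJordan_of_span [CharZero F] {A : Type*} [NonUnitalNonAssocRing A] [Module F A]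
    [IsScalarTower F A A] [SMulCommClass F A A] (S : NonUnitalSubalgebra F A) (T : Set A)
    (hST : S.toSubmodule ≤ Submodule.span F T)
    (hcomm : ∀ x ∈ T, ∀ y ∈ T, x * y = y * x)
    (hmet : ∀ x ∈ T, ∀ y ∈ T, ∀ z ∈ T, ∀ t ∈ T, x * y * (z * t) = 0)
    (hcyc : ∀ a ∈ T, ∀ b ∈ T, ∀ v ∈ T, ∀ t ∈ T,
      a * b * v * t + b * t * v * a + a * t * v * b = 0) : IsMetabelianJordan S := by
  have hmet' : ∀ x ∈ Submodule.span F T, ∀ y ∈ Submodule.span F T, ∀ z ∈ Submodule.span F T,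
      ∀ t ∈ Submodule.span F T, x * y * (z * t) = 0 := by
    intro x hx y hy z hz t ht
    induction hx using Submodule.span_induction with
    | zero => simp
    | add x x' _ _ hx hx' => simp only [add_mul, hx, hx', add_zero]
    | smul c x _ hx => simp only [smul_mul_assoc, hx, smul_zero]
    | mem x hx =>
    induction hy using Submodule.span_induction with
    | zero => simp
    | add x x' _ _ hx hx' => simp only [add_mul, mul_add, hx, hx', add_zero]
    | smul c x _ hx => simp only [smul_mul_assoc, mul_smul_comm, hx, smul_zero]
    | mem y hy =>
    induction hz using Submodule.span_induction with
    | zero => simp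
    | add x x' _ _ hx hx' => simp only [add_mul, mul_add, hx, hx', add_zero]
    | smul c x _ hx => simp only [smul_mul_assoc, mul_smul_comm, hx, smul_zero]
    | mem z hz =>
    induction ht using Submodule.span_induction with
    | zero => simp
    | add x x' _ _ hx hx' => simp only [mul_add, hx, hx', add_zero]
    | smul c x _ hx => simp only [mul_smul_comm, hx, smul_zero]
    | mem t ht => exact hmet x hx y hy z hz t ht
  have hcyc' : ∀ a ∈ Submodule.span F T, ∀ b ∈ Submodule.span F T, ∀ v ∈ Submodule.span F T,
      ∀ t ∈ Submodule.span F T, a * b * v * t + b * t * v * a + a * t * v * b = 0 := by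
    intro x hx y hy z hz t ht
    induction hx using Submodule.span_induction with
    | zero => simp
    | add x x' _ _ hx hx' =>
      simp only [add_mul, mul_add]
      linear_combination (norm := abel) hx + hx'
    | smul c x _ hx =>
      simp only [smul_mul_assoc, mul_smul_comm, ← smul_add, hx, smul_zero]
    | mem x hx =>
    induction hy using Submodule.span_induction with
    | zero => simp
    | add x x' _ _ hx hx' =>
      simp only [add_mul, mul_add]
      linear_combination (norm := abel) hx + hx'
    | smul c x _ hx =>
      simp only [smul_mul_assoc, mul_smul_comm, ← smul_add, hx, smul_zero]
    | mem y hy =>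
    induction hz using Submodule.span_induction with
    | zero => simp
    | add x x' _ _ hx hx' =>
      simp only [add_mul, mul_add]
      linear_combination (norm := abel) hx + hx'
    | smul c x _ hx =>
      simp only [smul_mul_assoc, mul_smul_comm, ← smul_add, hx, smul_zero]
    | mem z hz =>
    induction ht using Submodule.span_induction with
    | zero => simp
    | add x x' _ _ hx hx' =>
      simp only [add_mul, mul_add]
      linear_combination (norm := abel) hx + hx'
    | smul c x _ hx =>
      simp only [smul_mul_assoc, mul_smul_comm, ← smul_add, hx, smul_zero]
    | mem t ht => exact hcyc x hx y hy z hz t ht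
  have hcomm' : ∀ x ∈ Submodule.span F T, ∀ y ∈ Submodule.span F T, x * y = y * x := by
    intro x hx y hy
    induction hx using Submodule.span_induction with
    | zero => simp
    | add x x' _ _ hx hx' => simp only [add_mul, mul_add, hx, hx']
    | smul c x _ hx => simp only [smul_mul_assoc, mul_smul_comm, hx]
    | mem x hx =>
    induction hy using Submodule.span_induction with
    | zero => simp
    | add x x' _ _ hx hx' => simp only [add_mul, mul_add, hx, hx']
    | smul c x _ hx => simp only [smul_mul_assoc, mul_smul_comm, hx]
    | mem y hy => exact hcomm x hx y hy
  rw [isMetabelianJordan_coe_iff]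
  refine ⟨fun x hx y hy => hcomm' x (hST hx) y (hST hy), fun x hx y hy => ?_,
    fun x hx y hy z hz t ht => hmet' x (hST hx) y (hST hy) z (hST hz) t (hST ht)⟩
  -- On the diagonal the three terms coincide; dividing by 3 recovers the unlinearized identity.
  have h := hcyc' x (hST hx) x (hST hx) y (hST hy) x (hST hx)
  rw [hmet' x (hST hx) x (hST hx) y (hST hy) x (hST hx)]
  have h3 : (3 : F) • (x * x * y * x) = 0 := by
    rw [← h]; module
  exact (smul_eq_zero.1 h3).resolve_left (by norm_num)

end Envelope

/-! ### Free metabelian Jordan superalgebras -/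

section Free

variable {F : Type u} [Field F] {X : Type} {p : X → ZMod 2}

/-- The homomorphism of the free metabelian Jordan superalgebra that extends a parity preserving
map of the generators. -/
def freeSuperLift {B : Superalgebra F} (hB : B ∈ metabelianJordanSupervariety F)
    (z : X → B.carrier) (hz : ∀ x, z x ∈ B.part (p x)) :
    (freeMetabelianJordanSuperalgebra F p).carrier →ₙₐ[F] B.carrier where
  toFun := (metabelianJordanSuperideal F p).toSubmodule.liftQ
    (FreeNonUnitalNonAssocAlgebra.lift F z : FreeNonUnitalNonAssocAlgebra F X →ₗ[F] B.carrier)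
    (fun f hf => LinearMap.mem_ker.2 (hf B hB z hz))
  map_smul' := fun c x => map_smul _ c x
  map_zero' := map_zero _
  map_add' := map_add _
  map_mul' x y := by
    obtain ⟨f, rfl⟩ := AlgIdeal.toQuot_surjective _ x
    obtain ⟨g, rfl⟩ := AlgIdeal.toQuot_surjective _ y
    exact map_mul (FreeNonUnitalNonAssocAlgebra.lift F z) f g

theorem freeSuperLift_toQuot {B : Superalgebra F} (hB : B ∈ metabelianJordanSupervariety F)
    (z : X → B.carrier) (hz : ∀ x, z x ∈ B.part (p x)) (f : FreeNonUnitalNonAssocAlgebra F X) :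
    freeSuperLift hB z hz ((metabelianJordanSuperideal F p).toQuot f) =
      FreeNonUnitalNonAssocAlgebra.lift F z f := rfl

theorem freeSuperLift_mem_part {B : Superalgebra F} (hB : B ∈ metabelianJordanSupervariety F)
    (z : X → B.carrier) (hz : ∀ x, z x ∈ B.part (p x)) (i : ZMod 2)
    (a : (freeMetabelianJordanSuperalgebra F p).carrier)
    (ha : a ∈ (freeMetabelianJordanSuperalgebra F p).part i) :
    freeSuperLift hB z hz a ∈ B.part i := by
  obtain ⟨f, hf, rfl⟩ := ha
  exact lift_mem_part B hz hf

/-- The substitutions into members of the supervariety separate the points of the free superalgebra,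
and also those of its tensor product with the Grassmann algebra. They map envelope to envelope, so
the identities can be checked in the targets. -/
theorem freeMetabelianJordanSuperalgebra_mem (F : Type u) [Field F] {X : Type} (p : X → ZMod 2) :
    freeMetabelianJordanSuperalgebra F p ∈ metabelianJordanSupervariety F := by
  set A := freeMetabelianJordanSuperalgebra F p with hA
  have sep : ∀ t : GrassmannAlgebra F ⊗[F] A.carrier,
      (∀ B : Superalgebra F, ∀ hB : B ∈ metabelianJordanSupervariety F, ∀ z : X → B.carrier,
        ∀ hz : ∀ x, z x ∈ B.part (p x), grassmannMap (freeSuperLift hB z hz) t = 0) → t = 0 := by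
    intro t ht
    refine eq_zero_of_grassmannMap t (fun B φ => ∃ (hB : B ∈ metabelianJordanSupervariety F)
      (z : X → B.carrier) (hz : ∀ x, z x ∈ B.part (p x)), φ = freeSuperLift hB z hz) ?_ ?_
    · intro a ha
      obtain ⟨f, rfl⟩ := AlgIdeal.toQuot_surjective _ a
      refine (AlgIdeal.toQuot_eq_zero _).2 fun B hB z hz => ?_
      exact ha B _ ⟨hB, z, hz, rfl⟩
    · rintro B _ ⟨hB, z, hz, rfl⟩
      exact ht B hB z hz
  have hmem : ∀ (B : Superalgebra F) (hB : B ∈ metabelianJordanSupervariety F) (z : X → B.carrier)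
      (hz : ∀ x, z x ∈ B.part (p x)), ∀ t ∈ A.envelope,
      grassmannMap (freeSuperLift hB z hz) t ∈ B.envelope :=
    fun B hB z hz t ht => grassmannMap_mem_envelope _ (freeSuperLift_mem_part hB z hz) ht
  change IsMetabelianJordan A.envelope
  rw [isMetabelianJordan_coe_iff]
  refine ⟨fun x hx y hy => ?_, fun x hx y hy => ?_, fun x hx y hy v hv t ht => ?_⟩
  · rw [← sub_eq_zero]
    refine sep _ fun B hB z hz => ?_
    rw [map_sub, map_mul, map_mul, sub_eq_zero]
    exact ((isMetabelianJordan_coe_iff _).1 hB).1 _ (hmem B hB z hz x hx) _ (hmem B hB z hz y hy)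
  · rw [← sub_eq_zero]
    refine sep _ fun B hB z hz => ?_
    simp only [map_sub, map_mul]
    rw [sub_eq_zero]
    exact ((isMetabelianJordan_coe_iff _).1 hB).2.1 _ (hmem B hB z hz x hx) _ (hmem B hB z hz y hy)
  · refine sep _ fun B hB z hz => ?_
    simp only [map_mul]
    exact ((isMetabelianJordan_coe_iff _).1 hB).2.2 _ (hmem B hB z hz x hx) _ (hmem B hB z hz y hy)
      _ (hmem B hB z hz v hv) _ (hmem B hB z hz t ht)

end Free

/-! ### Algebras given by bilinear maps -/

/-- A module with the multiplication given by a bilinear map. -/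
def BilinearAlgebra {F M : Type*} [Field F] [AddCommGroup M] [Module F M]
    (_ : M →ₗ[F] M →ₗ[F] M) : Type _ := M

namespace BilinearAlgebra

variable {F M : Type*} [Field F] [AddCommGroup M] [Module F M] (β : M →ₗ[F] M →ₗ[F] M)

instance : AddCommGroup (BilinearAlgebra β) := inferInstanceAs (AddCommGroup M)
instance : Module F (BilinearAlgebra β) := inferInstanceAs (Module F M)

instance : NonUnitalNonAssocRing (BilinearAlgebra β) where
  mul x y := β x y
  left_distrib x y z := map_add (β x) y z
  right_distrib x y z := LinearMap.map_add₂ β x y z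
  zero_mul x := LinearMap.map_zero₂ β x
  mul_zero x := map_zero (β x)

/-- The identity map from the underlying module. -/
def mk : M ≃ₗ[F] BilinearAlgebra β := LinearEquiv.refl F M

theorem mk_mul_mk (x y : M) : mk β x * mk β y = mk β (β x y) := rfl

instance : IsScalarTower F (BilinearAlgebra β) (BilinearAlgebra β) :=
  ⟨fun c x y => LinearMap.map_smul₂ β c x y⟩

instance : SMulCommClass F (BilinearAlgebra β) (BilinearAlgebra β) :=
  ⟨fun c x y => (map_smul (β x) c y).symm⟩

end BilinearAlgebra

/-! ### A metabelian Jordan algebra of high nilpotency index -/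

section Model

variable (F : Type u) [Field F]

/-- The embedding of the letters that act at odd places. -/
def oddPlace : (ℕ →₀ F) →ₗ[F] GrassmannAlgebra F :=
  ExteriorAlgebra.ι F ∘ₗ Finsupp.lmapDomain F F (fun i => 2 * i + 1)

/-- The embedding of the letters that act at even places. -/
def evenPlace : (ℕ →₀ F) →ₗ[F] GrassmannAlgebra F :=
  ExteriorAlgebra.ι F ∘ₗ Finsupp.lmapDomain F F (fun i => 2 * i)

/-- The multiplication of `GrassmannModel F`. -/
def grassmannModelMul : ((ℕ →₀ F) × GrassmannAlgebra F × GrassmannAlgebra F) →ₗ[F]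
    ((ℕ →₀ F) × GrassmannAlgebra F × GrassmannAlgebra F) →ₗ[F]
      ((ℕ →₀ F) × GrassmannAlgebra F × GrassmannAlgebra F) :=
  LinearMap.mk₂ F (fun x y => (0, x.1 0 • evenPlace F y.1 + y.1 0 • evenPlace F x.1 +
      x.2.2 * evenPlace F y.1 + y.2.2 * evenPlace F x.1,
      x.2.1 * oddPlace F y.1 + y.2.1 * oddPlace F x.1))
    (by
      intro x x' y
      simp only [Prod.fst_add, Prod.snd_add, Finsupp.add_apply, map_add, add_mul, mul_add,
        add_smul, smul_add, Prod.mk_add_mk, add_zero]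
      refine Prod.ext rfl (Prod.ext ?_ ?_) <;> (dsimp only; abel))
    (by
      intro c x y
      simp only [Prod.smul_fst, Prod.smul_snd, Finsupp.smul_apply, map_smul, smul_mul_assoc,
        mul_smul_comm, Prod.smul_mk, smul_zero, smul_add, smul_eq_mul, mul_smul]
      rw [smul_comm (y.1 0) c])
    (by
      intro x y y'
      simp only [Prod.fst_add, Prod.snd_add, Finsupp.add_apply, map_add, add_mul, mul_add,
        add_smul, smul_add, Prod.mk_add_mk, add_zero]
      refine Prod.ext rfl (Prod.ext ?_ ?_) <;> (dsimp only; abel))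
    (by
      intro c x y
      simp only [Prod.smul_fst, Prod.smul_snd, Finsupp.smul_apply, map_smul, smul_mul_assoc,
        mul_smul_comm, Prod.smul_mk, smul_zero, smul_add, smul_eq_mul, mul_smul]
      rw [smul_comm (x.1 0) c])

/-- A metabelian Jordan algebra generated by letters whose multiplications act, at odd and at even
places independently, by exterior multiplication. -/
abbrev GrassmannModel : Type u := BilinearAlgebra (grassmannModelMul F)

theorem grassmannModelMul_apply (x y : (ℕ →₀ F) × GrassmannAlgebra F × GrassmannAlgebra F) :
    grassmannModelMul F x y = (0, x.1 0 • evenPlace F y.1 + y.1 0 • evenPlace F x.1 +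
      x.2.2 * evenPlace F y.1 + y.2.2 * evenPlace F x.1,
      x.2.1 * oddPlace F y.1 + y.2.1 * oddPlace F x.1) := rfl

theorem evenPlace_mul_oddPlace_mul_evenPlace (a b : ℕ →₀ F) :
    evenPlace F a * oddPlace F b * evenPlace F a = 0 := by
  change ExteriorAlgebra.ι F _ * ExteriorAlgebra.ι F _ * ExteriorAlgebra.ι F _ = 0
  rw [mul_assoc, GrassmannAlgebra.ι_mul_ι, mul_neg, ← mul_assoc, ExteriorAlgebra.ι_sq_zero,
    zero_mul, neg_zero]

theorem oddPlace_mul_evenPlace_mul_oddPlace (a b : ℕ →₀ F) :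
    oddPlace F a * evenPlace F b * oddPlace F a = 0 := by
  change ExteriorAlgebra.ι F _ * ExteriorAlgebra.ι F _ * ExteriorAlgebra.ι F _ = 0
  rw [mul_assoc, GrassmannAlgebra.ι_mul_ι, mul_neg, ← mul_assoc, ExteriorAlgebra.ι_sq_zero,
    zero_mul, neg_zero]

/-- Products lie in the two Grassmann copies, which multiply to zero among themselves. The first
copy awaits a letter at an odd place, the second one at an even place, and each action leads to the
other copy. The Jordan identity holds because x would act twice at places of equal parity, where
exterior multiplication gives zero. -/
theorem GrassmannModel.isMetabelianJordan : IsMetabelianJordan (GrassmannModel F) where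
  comm x y := by
    obtain ⟨x, rfl⟩ := (BilinearAlgebra.mk (grassmannModelMul F)).surjective x
    obtain ⟨y, rfl⟩ := (BilinearAlgebra.mk (grassmannModelMul F)).surjective y
    rw [BilinearAlgebra.mk_mul_mk, BilinearAlgebra.mk_mul_mk, grassmannModelMul_apply,
      grassmannModelMul_apply]
    congr 1
    refine Prod.ext rfl (Prod.ext ?_ ?_) <;> (dsimp only; abel)
  metabelian x y z t := by
    obtain ⟨x, rfl⟩ := (BilinearAlgebra.mk (grassmannModelMul F)).surjective x
    obtain ⟨y, rfl⟩ := (BilinearAlgebra.mk (grassmannModelMul F)).surjective y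
    obtain ⟨z, rfl⟩ := (BilinearAlgebra.mk (grassmannModelMul F)).surjective z
    obtain ⟨t, rfl⟩ := (BilinearAlgebra.mk (grassmannModelMul F)).surjective t
    rw [BilinearAlgebra.mk_mul_mk, BilinearAlgebra.mk_mul_mk, BilinearAlgebra.mk_mul_mk,
      ← map_zero (BilinearAlgebra.mk (grassmannModelMul F))]
    congr 1
    simp only [grassmannModelMul_apply, map_zero, mul_zero, Finsupp.zero_apply, zero_smul, add_zero]
    rfl
  jordan x y := by
    obtain ⟨x, rfl⟩ := (BilinearAlgebra.mk (grassmannModelMul F)).surjective x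
    obtain ⟨y, rfl⟩ := (BilinearAlgebra.mk (grassmannModelMul F)).surjective y
    simp only [BilinearAlgebra.mk_mul_mk]
    congr 1
    simp only [grassmannModelMul_apply, map_zero, mul_zero, Finsupp.zero_apply, zero_smul,
      add_zero, zero_add, add_mul, smul_mul_assoc]
    have h1 : ∀ g : GrassmannAlgebra F,
        g * evenPlace F x.1 * oddPlace F y.1 * evenPlace F x.1 = 0 := fun g => by
      rw [mul_assoc, mul_assoc, ← mul_assoc (evenPlace F _),
        evenPlace_mul_oddPlace_mul_evenPlace, mul_zero]
    have h2 : ∀ g : GrassmannAlgebra F,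
        g * oddPlace F x.1 * evenPlace F y.1 * oddPlace F x.1 = 0 := fun g => by
      rw [mul_assoc, mul_assoc, ← mul_assoc (oddPlace F _),
        oddPlace_mul_evenPlace_mul_oddPlace, mul_zero]
    simp only [h1, h2, evenPlace_mul_oddPlace_mul_evenPlace, smul_zero, add_zero, zero_mul]

/-- The generators of `GrassmannModel F`. -/
def GrassmannModel.letter (i : ℕ) : GrassmannModel F :=
  BilinearAlgebra.mk (grassmannModelMul F) (Finsupp.single i 1, 0, 0)

/-- The elements of the square of `GrassmannModel F` that are products of an even number of
letters. -/
def GrassmannModel.square (g : GrassmannAlgebra F) : GrassmannModel F :=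
  BilinearAlgebra.mk (grassmannModelMul F) (0, g, 0)

theorem GrassmannModel.square_eq_zero {g : GrassmannAlgebra F} (h : square F g = 0) : g = 0 := by
  have := (BilinearAlgebra.mk (grassmannModelMul F)).injective (h.trans (map_zero _).symm)
  exact congrArg (fun x => x.2.1) this

theorem evenPlace_single (i : ℕ) : evenPlace F (Finsupp.single i 1) =
    GrassmannAlgebra.gen F (2 * i) := by
  simp [evenPlace, GrassmannAlgebra.gen]

theorem oddPlace_single (i : ℕ) : oddPlace F (Finsupp.single i 1) =
    GrassmannAlgebra.gen F (2 * i + 1) := by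
  simp [oddPlace, GrassmannAlgebra.gen]

/-- Letter 0 is singled out as initial letter by the coordinate at 0, and its partner acts as at an
even place. The product being symmetric, the square of letter 0 counts twice. -/
theorem GrassmannModel.letter_mul_letter (i : ℕ) : letter F 0 * letter F i =
    square F ((if i = 0 then (2 : F) else 1) • GrassmannAlgebra.gen F (2 * i)) := by
  rw [letter, letter, square, BilinearAlgebra.mk_mul_mk, grassmannModelMul_apply]
  congr 1
  rcases eq_or_ne i 0 with rfl | hi
  · simp [evenPlace_single, two_smul]
  · simp [evenPlace_single, hi]

theorem GrassmannModel.mul_letter_mul_letter (g : GrassmannAlgebra F) (i j : ℕ) :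
    square F g * letter F i * letter F j = square F (g * GrassmannAlgebra.gen F (2 * i + 1) *
        GrassmannAlgebra.gen F (2 * j)) := by
  rw [letter, letter, square, BilinearAlgebra.mk_mul_mk, BilinearAlgebra.mk_mul_mk, square]
  congr 1
  simp [grassmannModelMul_apply, evenPlace_single, oddPlace_single]

end Model

/-! ### Superalgebras given by homogeneous spanning sets -/

section Homogeneous

variable {F : Type u} [Field F]

/-- The sign rule. -/
def paritySign (i j : ZMod 2) : ℤ := if i = 1 ∧ j = 1 then -1 else 1

theorem ZMod.eq_zero_or_eq_one (i : ZMod 2) : i = 0 ∨ i = 1 := by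
  revert i; decide

theorem GrassmannAlgebra.mul_eq_paritySign {i j : ZMod 2} {g h : GrassmannAlgebra F}
    (hg : g ∈ part F i) (hh : h ∈ part F j) : g * h = paritySign i j • (h * g) := by
  rcases ZMod.eq_zero_or_eq_one i with rfl | rfl
  · simp [paritySign, even_comm hg]
  · rcases ZMod.eq_zero_or_eq_one j with rfl | rfl
    · simp [paritySign, even_comm hh]
    · simp [paritySign, odd_anticomm hg hh]

/-- The signs come from sorting the Grassmann factors of the permuted monomials, hh'g'g and gh'g'h,
into the common order ghg'h'. -/
theorem mem_metabelianJordanSupervariety_of_span [CharZero F] (A : Superalgebra F)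
    (S : ZMod 2 → Set A.carrier) (hS : ∀ i, A.part i ≤ Submodule.span F (S i))
    (hcomm : ∀ i j, ∀ a ∈ S i, ∀ b ∈ S j, a * b = paritySign i j • (b * a))
    (hmet : ∀ i j k l, ∀ a ∈ S i, ∀ b ∈ S j, ∀ c ∈ S k, ∀ d ∈ S l, a * b * (c * d) = 0)
    (hcyc : ∀ i j k l, ∀ a ∈ S i, ∀ b ∈ S j, ∀ v ∈ S k, ∀ t ∈ S l,
      a * b * v * t + (paritySign l k * (paritySign l i * (paritySign k i * paritySign j i))) •
        (b * t * v * a) + (paritySign l k * (paritySign l j * paritySign k j)) •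
        (a * t * v * b) = 0) : A ∈ metabelianJordanSupervariety F := by
  refine isMetabelianJordan_of_span _ _ (A.envelope_le_span S hS) ?_ ?_ ?_
  · rintro _ ⟨i, g, a, hg, ha, rfl⟩ _ ⟨j, h, b, hh, hb, rfl⟩
    rw [Algebra.TensorProduct.tmul_mul_tmul, Algebra.TensorProduct.tmul_mul_tmul,
      hcomm i j a ha b hb, GrassmannAlgebra.mul_eq_paritySign hg hh]
    have hs : paritySign i j * paritySign i j = 1 := by
      unfold paritySign; split_ifs <;> rfl
    rw [TensorProduct.tmul_smul, ← TensorProduct.smul_tmul', smul_smul, hs, one_smul]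
  · rintro _ ⟨i, g, a, hg, ha, rfl⟩ _ ⟨j, h, b, hh, hb, rfl⟩ _ ⟨k, g', c, hg', hc, rfl⟩
      _ ⟨l, h', d, hh', hd, rfl⟩
    simp only [Algebra.TensorProduct.tmul_mul_tmul, hmet i j k l a ha b hb c hc d hd,
      TensorProduct.tmul_zero]
  · rintro _ ⟨i, g, a, hg, ha, rfl⟩ _ ⟨j, h, b, hh, hb, rfl⟩ _ ⟨k, g', c, hg', hc, rfl⟩
      _ ⟨l, h', d, hh', hd, rfl⟩
    simp only [Algebra.TensorProduct.tmul_mul_tmul]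
    have s1 := GrassmannAlgebra.mul_eq_paritySign hh' hg'
    have s2 := GrassmannAlgebra.mul_eq_paritySign hh' hg
    have s3 := GrassmannAlgebra.mul_eq_paritySign hg' hg
    have s4 := GrassmannAlgebra.mul_eq_paritySign hh hg
    have s5 := GrassmannAlgebra.mul_eq_paritySign hh' hh
    have s6 := GrassmannAlgebra.mul_eq_paritySign hg' hh
    have e1 : h * h' * g' * g = (paritySign l k * (paritySign l i * (paritySign k i *
        paritySign j i))) • (g * h * g' * h') :=
      calc h * h' * g' * g = h * (h' * g') * g := by simp only [mul_assoc]
        _ = paritySign l k • (h * g' * (h' * g)) := by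
          rw [s1]; simp only [mul_smul_comm, smul_mul_assoc, mul_assoc]
        _ = paritySign l k • paritySign l i • (h * (g' * g) * h') := by
          rw [s2]; simp only [mul_smul_comm, mul_assoc]
        _ = paritySign l k • paritySign l i • paritySign k i • (h * g * g' * h') := by
          rw [s3]; simp only [mul_smul_comm, smul_mul_assoc, mul_assoc]
        _ = _ := by
          rw [s4]; simp only [smul_mul_assoc, mul_smul]
    have e2 : g * h' * g' * h = (paritySign l k * (paritySign l j * paritySign k j)) •
        (g * h * g' * h') :=
      calc g * h' * g' * h = g * (h' * g') * h := by simp only [mul_assoc]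
        _ = paritySign l k • (g * g' * (h' * h)) := by
          rw [s1]; simp only [mul_smul_comm, smul_mul_assoc, mul_assoc]
        _ = paritySign l k • paritySign l j • (g * (g' * h) * h') := by
          rw [s5]; simp only [mul_smul_comm, mul_assoc]
        _ = _ := by
          rw [s6]; simp only [mul_smul_comm, smul_mul_assoc, mul_smul, mul_assoc]
    rw [e1, e2, ← TensorProduct.smul_tmul', ← TensorProduct.smul_tmul', ← TensorProduct.tmul_smul,
      ← TensorProduct.tmul_smul, ← TensorProduct.tmul_add, ← TensorProduct.tmul_add,
      hcyc i j k l a ha b hb c hc d hd, TensorProduct.tmul_zero]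

end Homogeneous

/-! ### The superalgebra `H + εH` -/

theorem isAddTorsionFree_of_field (F M : Type*) [Field F] [CharZero F] [AddCommGroup M]
    [Module F M] : IsAddTorsionFree M := IsAddTorsionFree.of_isTorsionFree F M

section OddExtension

variable (F : Type u) [Field F] (H : Type u) [NonUnitalNonAssocRing H] [Module F H]
  [IsScalarTower F H H] [SMulCommClass F H H]

/-- The multiplication of `H + εH`, `ε² = 0`. -/
def oddExtensionMul : (H × H) →ₗ[F] (H × H) →ₗ[F] (H × H) :=
  LinearMap.mk₂ F (fun x y => (x.1 * y.1, x.1 * y.2 + x.2 * y.1))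
    (by
      intro x x' y
      simp only [Prod.fst_add, Prod.snd_add, add_mul, Prod.mk_add_mk]
      congr 1; abel)
    (by
      intro c x y
      simp only [Prod.smul_fst, Prod.smul_snd, smul_mul_assoc, Prod.smul_mk, smul_add])
    (by
      intro x y y'
      simp only [Prod.fst_add, Prod.snd_add, mul_add, Prod.mk_add_mk]
      congr 1; abel)
    (by
      intro c x y
      simp only [Prod.smul_fst, Prod.smul_snd, mul_smul_comm, Prod.smul_mk, smul_add])

/-- The inclusions of `H` and `εH`. -/
def oddExtensionIncl (i : ZMod 2) : H →ₗ[F] BilinearAlgebra (oddExtensionMul F H) :=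
  (BilinearAlgebra.mk (oddExtensionMul F H)).toLinearMap ∘ₗ
    (if i = 0 then LinearMap.inl F H H else LinearMap.inr F H H)

theorem oddExtensionIncl_zero_apply (a : H) :
    oddExtensionIncl F H 0 a = BilinearAlgebra.mk (oddExtensionMul F H) (a, 0) := rfl

theorem oddExtensionIncl_one_apply (a : H) :
    oddExtensionIncl F H 1 a = BilinearAlgebra.mk (oddExtensionMul F H) (0, a) := rfl

theorem oddExtensionMul_apply (x y : H × H) :
    oddExtensionMul F H x y = (x.1 * y.1, x.1 * y.2 + x.2 * y.1) := rfl

theorem oddExtensionIncl_mul (i j : ZMod 2) (a b : H) :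
    oddExtensionIncl F H i a * oddExtensionIncl F H j b =
      if i = 1 ∧ j = 1 then 0 else oddExtensionIncl F H (i + j) (a * b) := by
  rcases ZMod.eq_zero_or_eq_one i with rfl | rfl <;>
  rcases ZMod.eq_zero_or_eq_one j with rfl | rfl <;>
  simp only [zero_add, add_zero, zero_ne_one, false_and, and_false, and_self, if_true, if_false,
    oddExtensionIncl_zero_apply, oddExtensionIncl_one_apply, BilinearAlgebra.mk_mul_mk,
    oddExtensionMul_apply, mul_zero, zero_mul]
  exact map_zero _

/-- The superalgebra `H + εH`, where `ε` is odd and `ε² = 0`. -/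
def oddExtension : Superalgebra F where
  carrier := BilinearAlgebra (oddExtensionMul F H)
  part i := LinearMap.range (oddExtensionIncl F H i)
  isInternal := by
    rw [DirectSum.isInternal_submodule_iff_isCompl _ (zero_ne_one (α := ZMod 2)) zmod_two_univ]
    exact LinearMap.isCompl_range_inl_inr (R := F) (M := H) (M₂ := H)
  mul_mem := by
    rintro i j _ _ ⟨a, rfl⟩ ⟨b, rfl⟩
    rw [oddExtensionIncl_mul]
    split_ifs
    · exact Submodule.zero_mem _
    · exact ⟨_, rfl⟩

theorem oddExtensionIncl_mul_comm (hH : IsMetabelianJordan H) (i j : ZMod 2) (a b : H) :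
    oddExtensionIncl F H i a * oddExtensionIncl F H j b =
      paritySign i j • (oddExtensionIncl F H j b * oddExtensionIncl F H i a) := by
  rw [oddExtensionIncl_mul, oddExtensionIncl_mul, hH.comm b a, add_comm j i]
  rcases ZMod.eq_zero_or_eq_one i with rfl | rfl <;>
  rcases ZMod.eq_zero_or_eq_one j with rfl | rfl <;>
  simp [paritySign]

theorem oddExtensionIncl_mul_mul_mul (hH : IsMetabelianJordan H) (i j k l : ZMod 2)
    (a b c d : H) : oddExtensionIncl F H i a * oddExtensionIncl F H j b *
      (oddExtensionIncl F H k c * oddExtensionIncl F H l d) = 0 := by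
  rw [oddExtensionIncl_mul, oddExtensionIncl_mul]
  by_cases h1 : i = 1 ∧ j = 1
  · rw [if_pos h1, zero_mul]
  by_cases h2 : k = 1 ∧ l = 1
  · rw [if_pos h2, mul_zero]
  rw [if_neg h1, if_neg h2, oddExtensionIncl_mul, hH.metabelian, map_zero, ite_self]

/-- With two or more odd arguments all terms vanish because ε² = 0. With at most one, all signs are
1 and the identity is that of H. -/
theorem oddExtensionIncl_cyclic [IsAddTorsionFree H] (hH : IsMetabelianJordan H)
    (i j k l : ZMod 2) (a b v t : H) :
    oddExtensionIncl F H i a * oddExtensionIncl F H j b * oddExtensionIncl F H k v *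
      oddExtensionIncl F H l t +
    (paritySign l k * (paritySign l i * (paritySign k i * paritySign j i))) •
      (oddExtensionIncl F H j b * oddExtensionIncl F H l t * oddExtensionIncl F H k v *
      oddExtensionIncl F H i a) +
    (paritySign l k * (paritySign l j * paritySign k j)) •
      (oddExtensionIncl F H i a * oddExtensionIncl F H l t * oddExtensionIncl F H k v *
      oddExtensionIncl F H j b) = 0 := by
  have h := hH.cyclic a b v t
  rcases ZMod.eq_zero_or_eq_one i with rfl | rfl <;>
  rcases ZMod.eq_zero_or_eq_one j with rfl | rfl <;>
  rcases ZMod.eq_zero_or_eq_one k with rfl | rfl <;>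
  rcases ZMod.eq_zero_or_eq_one l with rfl | rfl <;>
  simp [paritySign, oddExtensionIncl_mul, ← map_add, h]

variable {F H}

theorem oddExtension_mem [CharZero F] (hH : IsMetabelianJordan H) :
    oddExtension F H ∈ metabelianJordanSupervariety F := by
  have := isAddTorsionFree_of_field F H
  refine mem_metabelianJordanSupervariety_of_span _
    (fun i => Set.range (oddExtensionIncl F H i)) (fun i => ?_) ?_ ?_ ?_
  · exact Submodule.subset_span
  · rintro i j _ ⟨a, rfl⟩ _ ⟨b, rfl⟩
    exact oddExtensionIncl_mul_comm F H hH i j a b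
  · rintro i j k l _ ⟨a, rfl⟩ _ ⟨b, rfl⟩ _ ⟨c, rfl⟩ _ ⟨d, rfl⟩
    exact oddExtensionIncl_mul_mul_mul F H hH i j k l a b c d
  · rintro i j k l _ ⟨a, rfl⟩ _ ⟨b, rfl⟩ _ ⟨v, rfl⟩ _ ⟨t, rfl⟩
    exact oddExtensionIncl_cyclic F H hH i j k l a b v t

end OddExtension

/-! ### A superalgebra with two odd generators -/

section Ladder

variable (F : Type u) [Field F]

/-- The products of the basis elements `y_b` (`b : Bool`) and `w_k` (`k : ℕ`) of the ladder
superalgebra. -/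
def ladderBasisMul : Bool ⊕ ℕ → Bool ⊕ ℕ → (Bool ⊕ ℕ →₀ F)
  | .inl b, .inl c => if b = c then 0 else (if b then (-1 : ℤ) else 1) • Finsupp.single (.inr 0) 1
  | .inr k, .inl b => if k.bodd = b then Finsupp.single (.inr (k + 1)) 1 else 0
  | .inl b, .inr k => paritySign 1 k •
      if k.bodd = b then Finsupp.single (.inr (k + 1)) 1 else 0
  | .inr _, .inr _ => 0

/-- The multiplication of the ladder superalgebra. -/
def ladderMul : (Bool ⊕ ℕ →₀ F) →ₗ[F] (Bool ⊕ ℕ →₀ F) →ₗ[F] (Bool ⊕ ℕ →₀ F) :=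
  Finsupp.linearCombination F fun x => Finsupp.linearCombination F (ladderBasisMul F x)

/-- The basis elements of the ladder superalgebra. -/
def ladderBasis (x : Bool ⊕ ℕ) : BilinearAlgebra (ladderMul F) :=
  BilinearAlgebra.mk _ (Finsupp.single x 1)

theorem ladderBasis_mul (x y : Bool ⊕ ℕ) : ladderBasis F x * ladderBasis F y =
    BilinearAlgebra.mk (ladderMul F) (ladderBasisMul F x y) := by
  rw [ladderBasis, ladderBasis, BilinearAlgebra.mk_mul_mk]
  simp [ladderMul]

theorem ladderBasis_inl_mul_inl (b c : Bool) : ladderBasis F (.inl b) * ladderBasis F (.inl c) =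
    if b = c then 0 else (if b then (-1 : ℤ) else 1) • ladderBasis F (.inr 0) := by
  rw [ladderBasis_mul, ladderBasisMul, ladderBasis]
  split_ifs
  · exact map_zero _
  · exact map_zsmul _ _ _
  · exact map_zsmul _ _ _

theorem ladderBasis_inr_mul_inl (k : ℕ) (b : Bool) :
    ladderBasis F (.inr k) * ladderBasis F (.inl b) =
      if k.bodd = b then ladderBasis F (.inr (k + 1)) else 0 := by
  rw [ladderBasis_mul, ladderBasisMul, ladderBasis]
  split_ifs
  · rfl
  · exact map_zero _

theorem ladderBasis_inl_mul_inr (k : ℕ) (b : Bool) :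
    ladderBasis F (.inl b) * ladderBasis F (.inr k) =
      paritySign 1 k • (ladderBasis F (.inr k) * ladderBasis F (.inl b)) := by
  rw [ladderBasis_mul, ladderBasis_mul, ladderBasisMul, ladderBasisMul, map_zsmul]

theorem ladderBasis_inr_mul_inr (k l : ℕ) :
    ladderBasis F (.inr k) * ladderBasis F (.inr l) = 0 := by
  rw [ladderBasis_mul, ladderBasisMul, map_zero]

theorem ladderBasis_mul_eq_zsmul (x y : Bool ⊕ ℕ) :
    ∃ (c : ℤ) (k : ℕ), ladderBasis F x * ladderBasis F y = c • ladderBasis F (.inr k) := by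
  rcases x with b | k <;> rcases y with c | l
  · rw [ladderBasis_inl_mul_inl]
    split_ifs
    · exact ⟨0, 0, (zero_smul _ _).symm⟩
    · exact ⟨_, _, rfl⟩
    · exact ⟨_, _, rfl⟩
  · rw [ladderBasis_inl_mul_inr, ladderBasis_inr_mul_inl]
    split_ifs
    · exact ⟨_, _, rfl⟩
    · exact ⟨0, 0, by rw [smul_zero, zero_smul]⟩
  · rw [ladderBasis_inr_mul_inl]
    split_ifs
    · exact ⟨1, _, (one_smul _ _).symm⟩
    · exact ⟨0, 0, (zero_smul _ _).symm⟩
  · exact ⟨0, 0, by rw [ladderBasis_inr_mul_inr, zero_smul]⟩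

theorem ladderBasis_mul_mul_mul (x y z t : Bool ⊕ ℕ) :
    ladderBasis F x * ladderBasis F y * (ladderBasis F z * ladderBasis F t) = 0 := by
  obtain ⟨c, k, h⟩ := ladderBasis_mul_eq_zsmul F x y
  obtain ⟨d, l, h'⟩ := ladderBasis_mul_eq_zsmul F z t
  rw [h, h', smul_mul_assoc, mul_smul_comm, ladderBasis_inr_mul_inr, smul_zero, smul_zero]

theorem ladderBasis_mul_mul_inr (x y : Bool ⊕ ℕ) (k : ℕ) :
    ladderBasis F x * ladderBasis F y * ladderBasis F (.inr k) = 0 := by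
  obtain ⟨c, k, h⟩ := ladderBasis_mul_eq_zsmul F x y
  rw [h, smul_mul_assoc, ladderBasis_inr_mul_inr, smul_zero]

theorem ladderBasis_mul_mul_mul_inr (x y z : Bool ⊕ ℕ) (k : ℕ) :
    ladderBasis F x * ladderBasis F y * ladderBasis F z * ladderBasis F (.inr k) = 0 := by
  obtain ⟨c, k, h⟩ := ladderBasis_mul_eq_zsmul F x y
  rw [h, smul_mul_assoc, smul_mul_assoc, ladderBasis_mul_mul_inr, smul_zero]

/-- The parities of the basis elements of the ladder superalgebra. -/
def ladderParity : Bool ⊕ ℕ → ZMod 2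
  | .inl _ => 1
  | .inr k => k

theorem paritySign_comm (i j : ZMod 2) : paritySign i j = paritySign j i := by
  simp only [paritySign, and_comm]

theorem paritySign_mul_self (i j : ZMod 2) : paritySign i j * paritySign i j = 1 := by
  unfold paritySign; split_ifs <;> rfl

theorem paritySign_one_one : paritySign 1 1 = -1 := rfl

theorem ladderBasis_mul_comm (x y : Bool ⊕ ℕ) : ladderBasis F x * ladderBasis F y =
    paritySign (ladderParity x) (ladderParity y) • (ladderBasis F y * ladderBasis F x) := by
  rcases x with b | k <;> rcases y with c | l
  · rw [ladderBasis_inl_mul_inl, ladderBasis_inl_mul_inl]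
    cases b <;> cases c <;> simp [ladderParity, paritySign]
  · exact ladderBasis_inl_mul_inr F l b
  · rw [ladderBasis_inl_mul_inr, smul_smul, ladderParity, ladderParity, paritySign_comm,
      paritySign_mul_self, one_smul]
  · rw [ladderBasis_inr_mul_inr, ladderBasis_inr_mul_inr, smul_zero]

/-- The rungs accept y₀ and y₁ alternately, so either side is nonzero only if b = d. As the letters
are odd, this symmetry is the super form of skew-symmetry at places of equal parity. -/
theorem ladderBasis_mul_mul_mul_swap (k : ℕ) (b c d : Bool) :
    ladderBasis F (.inr k) * ladderBasis F (.inl b) * ladderBasis F (.inl c) *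
      ladderBasis F (.inl d) = ladderBasis F (.inr k) * ladderBasis F (.inl d) *
      ladderBasis F (.inl c) * ladderBasis F (.inl b) := by
  cases hk : k.bodd <;> cases b <;> cases c <;> cases d <;>
    simp [ladderBasis_inr_mul_inl, hk, Nat.bodd_succ]

/-- A rung in the place of v kills everything, and so do two rungs among a, b, t. With exactly one
rung, the term ending in it vanishes and the other two cancel by the swap symmetry. Without rungs
there are finitely many cases. -/
theorem ladderBasis_cyclic (a b v t : Bool ⊕ ℕ) {i j k l : ZMod 2} (hi : ladderParity a = i)
    (hj : ladderParity b = j) (hk : ladderParity v = k) (hl : ladderParity t = l) :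
    ladderBasis F a * ladderBasis F b * ladderBasis F v * ladderBasis F t +
      (paritySign l k * (paritySign l i * (paritySign k i * paritySign j i))) •
      (ladderBasis F b * ladderBasis F t * ladderBasis F v * ladderBasis F a) +
      (paritySign l k * (paritySign l j * paritySign k j)) •
      (ladderBasis F a * ladderBasis F t * ladderBasis F v * ladderBasis F b) = 0 := by
  rcases v with d | v
  swap
  · simp only [ladderBasis_mul_mul_inr, zero_mul, smul_zero, add_zero]
  subst hi hj hk hl
  rcases a with a | a <;> rcases b with b | b <;> rcases t with t | t <;>
    simp only [ladderBasis_mul_mul_mul_inr, smul_zero, add_zero, zero_add, ladderParity,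
      paritySign_one_one]
  · cases a <;> cases b <;> cases t <;> cases d <;>
      simp [ladderBasis_inl_mul_inl, ladderBasis_inr_mul_inl]
  · rw [ladderBasis_inl_mul_inr, ladderBasis_inl_mul_inr]
    simp only [smul_mul_assoc]
    rw [ladderBasis_mul_mul_mul_swap, smul_smul, smul_smul, ← add_smul]
    convert zero_smul ℤ _
    ring
  · rw [ladderBasis_inl_mul_inr]
    simp only [smul_mul_assoc]
    rw [ladderBasis_mul_mul_mul_swap, paritySign_comm, ← add_smul]
    convert zero_smul ℤ _
    ring
  · rw [ladderBasis_inr_mul_inr, zero_mul, zero_mul, smul_zero]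
  · rw [ladderBasis_mul_mul_mul_swap]
    simp
  · rw [ladderBasis_inr_mul_inr, zero_mul, zero_mul, smul_zero]
  · rw [ladderBasis_inr_mul_inr, zero_mul, zero_mul]

/-- The span of the basis elements of parity `i`. -/
def ladderPart (i : ZMod 2) : Submodule F (BilinearAlgebra (ladderMul F)) :=
  Submodule.span F {a | ∃ x, ladderParity x = i ∧ a = ladderBasis F x}

theorem ladderPart_eq (i : ZMod 2) : ladderPart F i =
    (Finsupp.supported F F {x | ladderParity x = i} : Submodule F (Bool ⊕ ℕ →₀ F)) := by
  rw [Finsupp.supported_eq_span_single, ladderPart]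
  congr 1
  ext a
  constructor
  · rintro ⟨x, hx, rfl⟩
    exact ⟨x, hx, rfl⟩
  · rintro ⟨x, hx, rfl⟩
    exact ⟨x, hx, rfl⟩

theorem ladderBasis_mem_part (x : Bool ⊕ ℕ) : ladderBasis F x ∈ ladderPart F (ladderParity x) :=
  Submodule.subset_span ⟨x, rfl, rfl⟩

theorem ladderBasis_mul_mem_part (x y : Bool ⊕ ℕ) : ladderBasis F x * ladderBasis F y ∈
    ladderPart F (ladderParity x + ladderParity y) := by
  have h2 : (1 + 1 : ZMod 2) = ladderParity (.inr 0) := by decide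
  have h3 : ∀ k : ℕ, (k + 1 : ZMod 2) = ladderParity (.inr (k + 1)) := fun k => by
    simp [ladderParity]
  have h4 : ∀ (k : ℕ) (b : Bool), ladderBasis F (.inr k) * ladderBasis F (.inl b) ∈
      ladderPart F (k + 1) := by
    intro k b
    rw [ladderBasis_inr_mul_inl, h3]
    split_ifs
    · exact ladderBasis_mem_part F _
    · exact Submodule.zero_mem _
  rcases x with b | k <;> rcases y with c | l
  · rw [ladderBasis_inl_mul_inl]
    change _ ∈ ladderPart F (1 + 1)
    rw [h2]
    split_ifs
    · exact Submodule.zero_mem _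
    · exact zsmul_mem (ladderBasis_mem_part F _) _
    · exact zsmul_mem (ladderBasis_mem_part F _) _
  · rw [ladderBasis_inl_mul_inr, add_comm]
    exact zsmul_mem (h4 l b) _
  · exact h4 k c
  · rw [ladderBasis_inr_mul_inr]
    exact Submodule.zero_mem _

/-- The ladder superalgebra: it has the basis `y_0`, `y_1` (odd), `w_k` of parity `k`, and
`y_0 y_1 = w_0`, `w_k y_b = w_{k+1}` if `k` and `b` have the same parity, `w_k y_b = 0` otherwise. -/
def ladder : Superalgebra F where
  carrier := BilinearAlgebra (ladderMul F)
  part := ladderPart F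
  isInternal := by
    rw [DirectSum.isInternal_submodule_iff_isCompl _ (zero_ne_one (α := ZMod 2)) zmod_two_univ]
    rw [ladderPart_eq, ladderPart_eq]
    have hd : IsCompl {x : Bool ⊕ ℕ | ladderParity x = 0} {x | ladderParity x = 1} := by
      rw [isCompl_iff, Set.disjoint_iff, codisjoint_iff]
      constructor
      · rintro x ⟨h0, h1⟩
        exact zero_ne_one (α := ZMod 2) (h0.symm.trans h1)
      · ext x
        simpa using ZMod.eq_zero_or_eq_one (ladderParity x)
    exact ⟨Finsupp.disjoint_supported_supported hd.disjoint,
      Finsupp.codisjoint_supported_supported hd.codisjoint⟩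
  mul_mem := by
    intro i j a b ha hb
    change a ∈ Submodule.span F _ at ha
    change b ∈ Submodule.span F _ at hb
    induction ha using Submodule.span_induction with
    | mem a ha =>
      obtain ⟨x, rfl, rfl⟩ := ha
      induction hb using Submodule.span_induction with
      | mem b hb =>
        obtain ⟨y, rfl, rfl⟩ := hb
        exact ladderBasis_mul_mem_part F x y
      | zero => rw [mul_zero]; exact Submodule.zero_mem _
      | add a b _ _ ha hb => rw [mul_add]; exact Submodule.add_mem _ ha hb
      | smul c a _ ha => rw [mul_smul_comm]; exact Submodule.smul_mem _ c ha
    | zero => rw [zero_mul]; exact Submodule.zero_mem _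
    | add a b _ _ ha hb => rw [add_mul]; exact Submodule.add_mem _ ha hb
    | smul c a _ ha => rw [smul_mul_assoc]; exact Submodule.smul_mem _ c ha

theorem ladder_mem [CharZero F] : ladder F ∈ metabelianJordanSupervariety F := by
  refine mem_metabelianJordanSupervariety_of_span _
    (fun i => {a | ∃ x, ladderParity x = i ∧ a = ladderBasis F x}) (fun i => le_rfl) ?_ ?_ ?_
  · rintro i j _ ⟨a, rfl, rfl⟩ _ ⟨b, rfl, rfl⟩
    exact ladderBasis_mul_comm F a b
  · rintro i j k l _ ⟨a, rfl, rfl⟩ _ ⟨b, rfl, rfl⟩ _ ⟨c, rfl, rfl⟩ _ ⟨d, rfl, rfl⟩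
    exact ladderBasis_mul_mul_mul F a b c d
  · rintro i j k l _ ⟨a, ha, rfl⟩ _ ⟨b, hb, rfl⟩ _ ⟨v, hv, rfl⟩ _ ⟨t, ht, rfl⟩
    exact ladderBasis_cyclic F a b v t ha hb hv ht

end Ladder

/-! ### Normal forms of multilinear elements -/

section MultilinearNormalForm

theorem map_alternatingMul {A B Φ : Type*} [Mul A] [Mul B] [FunLike Φ A B] [MulHomClass Φ A B]
    (φ : Φ) : ∀ (w : A) (os es : List A),
    φ (alternatingMul w os es) = alternatingMul (φ w) (os.map φ) (es.map φ)
  | w, [], es => by simp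
  | w, o :: os, es => by
    rw [alternatingMul_cons, map_alternatingMul φ _ es os, List.map_cons, alternatingMul_cons,
      map_mul]
termination_by _ os es => os.length + es.length

variable {n : ℕ}

/-- The letters at even places of a multilinear normal form. -/
def evenLetters (τ : Finset (Fin n) → Fin n) (x : Finset (Fin n) × Fin n) : List (Fin n) :=
  ((x.1ᶜ.erase (τ x.1ᶜ)).erase x.2).toList

/-- The multilinear normal form with the set `x.1` of letters at odd places. -/
def normalForm {B : Type*} [Mul B] (z : Fin n → B) (τ : Finset (Fin n) → Fin n)
    (x : Finset (Fin n) × Fin n) : B :=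
  alternatingMul (z (τ x.1ᶜ) * z x.2) (x.1.toList.map z) ((evenLetters τ x).map z)

/-- The indices of the multilinear normal forms. -/
def normalFormIndices (τ : Finset (Fin n) → Fin n) : Set (Finset (Fin n) × Fin n) :=
  {x | x.2 ∉ x.1 ∧ x.2 ≠ τ x.1ᶜ ∧ Interleavable x.1.toList (evenLetters τ x)}

theorem map_normalForm {A B Φ : Type*} [Mul A] [Mul B] [FunLike Φ A B] [MulHomClass Φ A B]
    (φ : Φ) (z : Fin n → A) (τ : Finset (Fin n) → Fin n) (x : Finset (Fin n) × Fin n) :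
    φ (normalForm z τ x) = normalForm (fun i => φ (z i)) τ x := by
  rw [normalForm, map_alternatingMul, map_mul, List.map_map, List.map_map]
  rfl

variable {B : Type*} [NonUnitalNonAssocRing B] [IsAddTorsionFree B]

namespace IsMetabelianJordan

/-- Once the representative τ stands in the initial product, the word differs from a normal form
only by permutations within the odd and within the even places. -/
theorem normalForm_perm (h : IsMetabelianJordan B) (z : Fin n → B) (τ : Finset (Fin n) → Fin n)
    (N : AddSubgroup B) (hN : ∀ x ∈ normalFormIndices τ, normalForm z τ x ∈ N)
    (b : Fin n) (os es : List (Fin n)) (hb : Interleavable os es)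
    (hp : (τ os.toFinsetᶜ :: b :: (os ++ es)).Perm (List.finRange n)) :
    alternatingMul (z (τ os.toFinsetᶜ) * z b) (os.map z) (es.map z) ∈ N := by
  have hnd := hp.nodup_iff.2 (List.nodup_finRange n)
  have hmem : ∀ x, x ∈ τ os.toFinsetᶜ :: b :: (os ++ es) := fun x => hp.mem_iff.2
    (List.mem_finRange x)
  set t := τ os.toFinsetᶜ with ht
  have ho : os.toFinset.toList.Perm os := by
    refine (List.perm_ext_iff_of_nodup (Finset.nodup_toList _) ?_).2 fun x => by simp
    simp only [List.nodup_cons, List.nodup_append] at hnd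
    exact hnd.2.2.1
  have he : (evenLetters τ (os.toFinset, b)).Perm es := by
    simp only [List.nodup_cons, List.nodup_append, List.mem_cons, List.mem_append, not_or] at hnd
    refine (List.perm_ext_iff_of_nodup (Finset.nodup_toList _) hnd.2.2.2.1).2 fun x => ?_
    simp only [Finset.mem_toList, Finset.mem_erase, Finset.mem_compl, List.mem_toFinset, ← ht]
    have hx := hmem x
    simp only [List.mem_cons, List.mem_append] at hx
    constructor
    · tauto
    · intro hxe
      refine ⟨?_, ?_, fun hxo => hnd.2.2.2.2 x hxo x hxe rfl⟩
      · rintro rfl; exact hnd.2.1.2 hxe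
      · rintro rfl; exact hnd.1.2.2 hxe
  have hb' : Interleavable os.toFinset.toList (evenLetters τ (os.toFinset, b)) := by
    simpa only [Interleavable, ho.length_eq, he.length_eq] using hb
  refine h.alternatingMul_mem_of_perm N (ho.map z) (he.map z) (h.annihilatesProducts_mul _ _)
    (hb'.map z z) (hN (os.toFinset, b) ⟨?_, ?_, hb'⟩)
  · simp only [List.nodup_cons, List.mem_append, not_or] at hnd
    simpa using hnd.2.1.1
  · simp only [List.nodup_cons, List.mem_cons, List.mem_append, not_or] at hnd
    exact fun hbt => hnd.1.1 hbt.symm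

/-- Every multilinear word is a linear combination of normal forms. -/
theorem lift_word_mem (h : IsMetabelianJordan B) (z : Fin n → B) (τ : Finset (Fin n) → Fin n)
    (hτ : ∀ T : Finset (Fin n), T.Nonempty → τ T ∈ T)
    (N : AddSubgroup B) (hN : ∀ x ∈ normalFormIndices τ, normalForm z τ x ∈ N)
    (w : FreeMagma (Fin n)) (hn : 2 ≤ n) (hw : FreeMagma.letters w =
      (Finset.univ : Finset (Fin n)).val) : FreeMagma.lift z w ∈ N := by
  rcases h.lift_word_eq z w with ⟨x, rfl⟩ | ⟨-, h0 | ⟨a, b, cs, hl, he⟩⟩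
  · have := congrArg Multiset.card hw
    simp [FreeMagma.letters] at this
    omega
  · rw [h0]; exact N.zero_mem
  obtain ⟨os, es, hb, hp, hf⟩ := foldl_mul_eq_alternatingMul z cs (z a * z b)
  rw [he, hf]
  have hperm : (a :: b :: (os ++ es)).Perm (List.finRange n) := by
    refine ((hp.cons b).cons a).trans ?_
    rw [← Multiset.coe_eq_coe, ← hl, hw]
    rfl
  have ht : τ os.toFinsetᶜ ∈ os.toFinsetᶜ := by
    refine hτ _ ⟨a, ?_⟩
    have hnd := hperm.nodup_iff.2 (List.nodup_finRange n)
    simp only [List.nodup_cons, List.mem_cons, List.mem_append, not_or] at hnd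
    simpa using hnd.1.2.1
  have ht' : τ os.toFinsetᶜ ∈ a :: b :: (os ++ es) := hperm.mem_iff.2 (List.mem_finRange _)
  simp only [List.mem_cons, List.mem_append] at ht'
  rcases ht' with hta | htb | hto | hte
  · rw [← hta] at hperm ⊢
    exact h.normalForm_perm z τ N hN b os es hb hperm
  · rw [← htb] at hperm ⊢
    rw [h.comm]
    exact h.normalForm_perm z τ N hN a os es hb ((List.Perm.swap _ _ _).trans hperm)
  · simp [hto] at ht
  -- The representative t stands at an even place. It is moved to the first even place, so that the
  -- word begins with (ab)·o·t.
  · obtain ⟨es', hes'⟩ : ∃ es', es.Perm (τ os.toFinsetᶜ :: es') :=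
      ⟨_, List.perm_cons_erase hte⟩
    have hb' : Interleavable os (τ os.toFinsetᶜ :: es') := by
      simpa only [Interleavable, hes'.length_eq] using hb
    refine h.alternatingMul_mem_of_perm N (List.Perm.refl _) (hes'.symm.map z)
      (h.annihilatesProducts_mul _ _) (hb'.map z z) ?_
    set t := τ os.toFinsetᶜ with htdef
    have hperm' : (a :: b :: (os ++ t :: es')).Perm (List.finRange n) :=
      ((((hes'.symm.append_left os).cons b).cons a)).trans hperm
    have h1 := h.normalForm_perm z τ N hN a os (b :: es')
      (by simpa [Interleavable] using hb') (by
        refine List.Perm.trans ?_ hperm'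
        rw [← htdef, List.perm_iff_count]
        intro x
        simp only [List.count_cons, List.count_append]
        omega)
    have h2 := h.normalForm_perm z τ N hN b os (a :: es')
      (by simpa [Interleavable] using hb') (by
        refine List.Perm.trans ?_ hperm'
        rw [← htdef, List.perm_iff_count]
        intro x
        simp only [List.count_cons, List.count_append]
        omega)
    rw [← htdef] at h1 h2
    cases hos : os with
    | nil => rw [hos] at hb'; simp [Interleavable] at hb'
    | cons o os' =>
      rw [hos] at h1 h2
      simp only [List.map_cons, alternatingMul_cons] at h1 h2 ⊢
      -- Here abot = -(tboa + taob): t enters the initial product, while a or b takes over its even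
      -- place.
      have hc := h.cyclic (z a) (z b) (z o) (z t)
      rw [h.comm (z b), h.comm (z a) (z t), add_assoc, ← eq_neg_iff_add_eq_zero] at hc
      rw [hc, alternatingMul_neg, alternatingMul_add]
      exact N.neg_mem (N.add_mem h2 h1)

end IsMetabelianJordan

end MultilinearNormalForm

/-! ### The free metabelian Jordan algebra -/

section FreeAlgebra

variable {F : Type u} [Field F] {X : Type}

theorem FreeMetabelianJordanAlgebra.isMetabelianJordan (F : Type u) [Field F] (X : Type) :
    IsMetabelianJordan (FreeMetabelianJordanAlgebra F X) where
  comm x y := by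
    obtain ⟨f, rfl⟩ := AlgIdeal.toQuot_surjective _ x
    obtain ⟨g, rfl⟩ := AlgIdeal.toQuot_surjective _ y
    rw [← AlgIdeal.toQuot_mul, ← AlgIdeal.toQuot_mul, AlgIdeal.toQuot_eq_iff]
    intro B _ _ _ _ hB z
    rw [map_sub, map_mul, map_mul, hB.comm, sub_self]
  jordan x y := by
    obtain ⟨f, rfl⟩ := AlgIdeal.toQuot_surjective _ x
    obtain ⟨g, rfl⟩ := AlgIdeal.toQuot_surjective _ y
    simp only [← AlgIdeal.toQuot_mul]
    rw [AlgIdeal.toQuot_eq_iff]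
    intro B _ _ _ _ hB z
    simp only [map_sub, map_mul]
    rw [hB.jordan, sub_self]
  metabelian x y z t := by
    obtain ⟨f, rfl⟩ := AlgIdeal.toQuot_surjective _ x
    obtain ⟨g, rfl⟩ := AlgIdeal.toQuot_surjective _ y
    obtain ⟨h, rfl⟩ := AlgIdeal.toQuot_surjective _ z
    obtain ⟨k, rfl⟩ := AlgIdeal.toQuot_surjective _ t
    simp only [← AlgIdeal.toQuot_mul]
    rw [AlgIdeal.toQuot_eq_zero]
    intro B _ _ _ _ hB z
    simp only [map_mul]
    rw [hB.metabelian]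

theorem AlgIdeal.toQuot_eq_lift (J : AlgIdeal F (FreeNonUnitalNonAssocAlgebra F X))
    (f : FreeNonUnitalNonAssocAlgebra F X) : J.toQuot f =
      FreeNonUnitalNonAssocAlgebra.lift F
        (fun x => J.toQuot (FreeNonUnitalNonAssocAlgebra.of F x)) f := by
  let φ : FreeNonUnitalNonAssocAlgebra F X →ₙₐ[F] J.Quot :=
    { toFun := J.toQuot
      map_smul' := fun c x => map_smul _ c x
      map_zero' := map_zero _
      map_add' := map_add _
      map_mul' := J.toQuot_mul }
  have h := FreeNonUnitalNonAssocAlgebra.map_lift φ (FreeNonUnitalNonAssocAlgebra.of F) f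
  have h2 : FreeNonUnitalNonAssocAlgebra.lift F (FreeNonUnitalNonAssocAlgebra.of F) f = f := by
    have : FreeNonUnitalNonAssocAlgebra.lift F (FreeNonUnitalNonAssocAlgebra.of F (X := X)) =
        NonUnitalAlgHom.id F _ :=
      FreeNonUnitalNonAssocAlgebra.hom_ext F fun x => by
        rw [FreeNonUnitalNonAssocAlgebra.lift_of_apply]; rfl
    rw [this]; rfl
  rw [h2] at h
  exact h

theorem FreeNonUnitalNonAssocAlgebra.lift_eq_sum {A : Type*} [NonUnitalNonAssocSemiring A] [Module F A]
    [IsScalarTower F A A] [SMulCommClass F A A] (z : X → A)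
    (f : FreeNonUnitalNonAssocAlgebra F X) :
    FreeNonUnitalNonAssocAlgebra.lift F z f =
      f.coeff.sum fun w c => c • FreeMagma.lift z w := by
  conv_lhs => rw [← MonoidAlgebra.sum_coeff_single f]
  rw [Finsupp.sum, map_sum]
  exact Finset.sum_congr rfl fun w _ => FreeNonUnitalNonAssocAlgebra.lift_single z w _

/-- Modulo the identities of metabelian Jordan algebras, a multilinear polynomial is a linear
combination of normal forms. -/
theorem exists_normalForm_coeff [CharZero F] {n : ℕ} (hn : 2 ≤ n) (τ : Finset (Fin n) → Fin n)
    (hτ : ∀ T : Finset (Fin n), T.Nonempty → τ T ∈ T)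
    (f : FreeNonUnitalNonAssocAlgebra F (Fin n)) (hf : IsMultilinearPoly f) :
    ∃ α : normalFormIndices τ → F, f - (letI := Fintype.ofFinite (normalFormIndices τ)
      ∑ x : normalFormIndices τ, α x • normalForm (FreeNonUnitalNonAssocAlgebra.of F) τ x) ∈
        (metabelianJordanIdeal F (Fin n)).toSubmodule := by
  let := Fintype.ofFinite (normalFormIndices τ)
  set J := metabelianJordanIdeal F (Fin n)
  have := isAddTorsionFree_of_field F J.Quot
  have hQ := FreeMetabelianJordanAlgebra.isMetabelianJordan F (Fin n)
  set z : Fin n → J.Quot := fun x => J.toQuot (FreeNonUnitalNonAssocAlgebra.of F x)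
  let N := Submodule.span F (Set.range fun x : normalFormIndices τ => normalForm z τ x)
  have hmem : J.toQuot f ∈ N := by
    rw [AlgIdeal.toQuot_eq_lift, FreeNonUnitalNonAssocAlgebra.lift_eq_sum]
    refine Submodule.sum_mem _ fun w hw => Submodule.smul_mem _ _ ?_
    refine hQ.lift_word_mem z τ hτ N.toAddSubgroup (fun x hx => ?_) w hn (hf w hw)
    exact Submodule.subset_span ⟨⟨x, hx⟩, rfl⟩
  obtain ⟨α, hα⟩ := (Submodule.mem_span_range_iff_exists_fun F).1 hmem
  refine ⟨α, ?_⟩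
  rw [← AlgIdeal.toQuot_eq_zero, map_sub, sub_eq_zero, ← hα, map_sum]
  refine Finset.sum_congr rfl fun x _ => ?_
  rw [map_smul]
  congr 1
  have hmul : ∀ a b, J.toQuot (a * b) = J.toQuot a * J.toQuot b := J.toQuot_mul
  exact (map_normalForm (⟨J.toQuot, hmul⟩ : _ →ₙ* J.Quot)
    (FreeNonUnitalNonAssocAlgebra.of F) τ x).symm

end FreeAlgebra

/-! ### Evaluation of normal forms in the ladder superalgebra -/

/-- Wherever c occurs after the first two letters it multiplies a product. Hence a product
substituted for a letter forces that letter into the initial pair. -/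
theorem alternatingMul_eq_zero_of_annihilates {B : Type*} [NonUnitalNonAssocRing B] {c : B}
    (hc : ∀ p q : B, p * q * c = 0) : ∀ (p q : B) (os es : List B), Interleavable os es →
      (c ∈ os ∨ c ∈ es) → alternatingMul (p * q) os es = 0
  | p, q, [], es, hb, h => by
    have : es = [] := by simpa [Interleavable] using hb.1
    simp [this] at h
  | p, q, o :: os, es, hb, h => by
    rw [alternatingMul_cons]
    by_cases ho : c = o
    · rw [← ho, hc, alternatingMul_zero]
    · refine alternatingMul_eq_zero_of_annihilates hc _ _ es os hb.tail ?_
      simp only [List.mem_cons, ho, false_or] at h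
      exact h.symm
termination_by _ _ os es => os.length + es.length

theorem GrassmannAlgebra.tmul_ne_zero {F : Type u} [Field F] {A : Type*} [AddCommGroup A]
    [Module F A] {g : GrassmannAlgebra F} {a : A} (hg : g ≠ 0) (ha : a ≠ 0) : g ⊗ₜ[F] a ≠ 0 := by
  intro h
  let b := Module.Free.chooseBasis F (GrassmannAlgebra F)
  obtain ⟨i, hi⟩ : ∃ i, b.repr g i ≠ 0 := by
    by_contra! hall
    exact hg (b.repr.injective (by ext i; simp [hall i]))
  have := congrArg (fun t => TensorProduct.equivFinsuppOfBasisLeft b t i) h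
  simp [hi, ha] at this

section LadderEvaluation

variable (F : Type u) [Field F]

/-- The element `e_i ⊗ y_b` of the Grassmann envelope of the ladder superalgebra. -/
def ladderLetter (i : ℕ) (b : Bool) : (ladder F).envelope :=
  ⟨GrassmannAlgebra.gen F i ⊗ₜ ladderBasis F (.inl b),
    (ladder F).tmul_mem_envelope (GrassmannAlgebra.gen_mem_part i)
      (ladderBasis_mem_part F (.inl b))⟩

variable {n : ℕ} (s : Fin n → Bool)

/-- The letters that act on the rungs of the ladder. -/
def ladderTensor (i : Fin n) : GrassmannAlgebra F ⊗[F] BilinearAlgebra (ladderMul F) :=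
  GrassmannAlgebra.gen F i ⊗ₜ ladderBasis F (.inl (s i))

theorem tmul_mul_ladderTensor (g : GrassmannAlgebra F) (k : ℕ) (i : Fin n) :
    g ⊗ₜ[F] ladderBasis F (.inr k) * ladderTensor F s i = if k.bodd = s i then
      (g * GrassmannAlgebra.gen F i) ⊗ₜ[F] ladderBasis F (.inr (k + 1)) else 0 := by
  rw [ladderTensor, Algebra.TensorProduct.tmul_mul_tmul, ladderBasis_inr_mul_inl]
  split_ifs
  · rfl
  · rw [TensorProduct.tmul_zero]

/-- At rung k only the letter y whose index has the parity of k acts, and this parity alternates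
along with the two lists. A single letter with the wrong index therefore kills the word. -/
theorem alternatingMul_ladder_eq_zero : ∀ (os es : List (Fin n)) (k : ℕ) (g : GrassmannAlgebra F),
    Interleavable os es → ((∃ o ∈ os, k.bodd ≠ s o) ∨ (∃ e ∈ es, (!k.bodd) ≠ s e)) →
    alternatingMul (g ⊗ₜ[F] ladderBasis F (.inr k)) (os.map (ladderTensor F s))
      (es.map (ladderTensor F s)) = 0
  | [], es, k, g, hb, h => by
    have : es = [] := by simpa [Interleavable] using hb.1
    simp [this] at h
  | o :: os, es, k, g, hb, h => by
    rw [List.map_cons, alternatingMul_cons, tmul_mul_ladderTensor]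
    split_ifs with ho
    · refine alternatingMul_ladder_eq_zero es os (k + 1) _ hb.tail ?_
      simp only [Nat.bodd_succ, Bool.not_not]
      rcases h with ⟨o', ho', h⟩ | h
      · rcases List.mem_cons.1 ho' with rfl | ho'
        · exact absurd ho h
        · exact Or.inr ⟨o', ho', h⟩
      · exact Or.inl h
    · exact alternatingMul_zero _ _
termination_by os es => os.length + es.length

theorem alternatingMul_ladder_eq : ∀ (os es : List (Fin n)) (k : ℕ) (g : GrassmannAlgebra F),
    Interleavable os es → (∀ o ∈ os, k.bodd = s o) → (∀ e ∈ es, (!k.bodd) = s e) →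
    ∃ (l : List (Fin n)) (m : ℕ), l.Perm (os ++ es) ∧
      alternatingMul (g ⊗ₜ[F] ladderBasis F (.inr k)) (os.map (ladderTensor F s))
        (es.map (ladderTensor F s)) =
      (g * (l.map fun i : Fin n => GrassmannAlgebra.gen F i).prod) ⊗ₜ[F] ladderBasis F (.inr m)
  | [], es, k, g, hb, _, _ => by
    have : es = [] := by simpa [Interleavable] using hb.1
    exact ⟨[], k, by simp [this], by simp⟩
  | o :: os, es, k, g, hb, ho, he => by
    obtain ⟨l, m, hl, h⟩ := alternatingMul_ladder_eq es os (k + 1)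
      (g * GrassmannAlgebra.gen F o) hb.tail (fun e h => by rw [Nat.bodd_succ]; exact he e h)
      (fun e h => by
        rw [Nat.bodd_succ, Bool.not_not]; exact ho e (List.mem_cons_of_mem _ h))
    refine ⟨o :: l, m, (hl.trans List.perm_append_comm).cons o, ?_⟩
    rw [List.map_cons, alternatingMul_cons, tmul_mul_ladderTensor, if_pos (ho o List.mem_cons_self),
      h, List.map_cons, List.prod_cons, mul_assoc]
termination_by os es => os.length + es.length

/-- The substitution that distinguishes the normal form `x` from all other normal forms. -/
def ladderPoint (x : Finset (Fin n) × Fin n) (i : Fin n) : (ladder F).envelope :=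
  if i = x.2 then ladderLetter F n false * ladderLetter F (n + 1) true
    else ladderLetter F i (decide (i ∈ x.1))

variable {F}

/-- Together with interleavability this determines the number of letters at odd places from n alone.
-/
theorem card_evenLetters {τ : Finset (Fin n) → Fin n}
    (hτ : ∀ T : Finset (Fin n), T.Nonempty → τ T ∈ T) {x : Finset (Fin n) × Fin n}
    (hx : x ∈ normalFormIndices τ) : x.1.card + (evenLetters τ x).length + 2 = n := by
  obtain ⟨h1, h2, -⟩ := hx
  have hb : x.2 ∈ x.1ᶜ := Finset.mem_compl.2 h1
  have ht := hτ _ ⟨_, hb⟩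
  rw [evenLetters, Finset.length_toList, Finset.card_erase_of_mem (Finset.mem_erase.2 ⟨h2, hb⟩),
    Finset.card_erase_of_mem ht, Finset.card_compl, Fintype.card_fin]
  have h3 := Finset.card_le_univ x.1
  have h4 : 2 ≤ x.1ᶜ.card := Finset.one_lt_card.2 ⟨_, hb, _, ht, h2⟩
  rw [Finset.card_compl, Fintype.card_fin] at h4
  rw [Fintype.card_fin] at h3
  omega

/-- The underlying map of the Grassmann envelope of the ladder superalgebra. -/
def ladderCoe (F : Type u) [Field F] : (ladder F).envelope →ₙ*
    (GrassmannAlgebra F ⊗[F] BilinearAlgebra (ladderMul F)) where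
  toFun := Subtype.val
  map_mul' _ _ := rfl

theorem ladderCoe_mul (i j : ℕ) :
    ladderCoe F (ladderLetter F i false * ladderLetter F j true) =
      (GrassmannAlgebra.gen F i * GrassmannAlgebra.gen F j) ⊗ₜ ladderBasis F (.inr 0) := by
  have h := ladderBasis_inl_mul_inl F false true
  rw [if_neg (by decide), if_neg (by decide), one_smul] at h
  rw [← h, map_mul, ← Algebra.TensorProduct.tmul_mul_tmul]
  rfl

theorem map_ladderPoint (x : Finset (Fin n) × Fin n) (l : List (Fin n)) (hl : x.2 ∉ l) :
    (l.map (ladderPoint F x)).map (ladderCoe F) =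
      l.map (ladderTensor F fun i => decide (i ∈ x.1)) := by
  rw [List.map_map]
  refine List.map_congr_left fun i hi => ?_
  have : i ≠ x.2 := fun h => hl (h ▸ hi)
  rw [Function.comp_apply, ladderPoint, if_neg this]
  rfl

/-- The letter x.2 becomes a multiple of the rung w₀, so its partner c is the first letter to act on
the ladder. This shifts all places by one and exchanges the two lists. -/
theorem ladderCoe_alternatingMul [CharZero F] (x : Finset (Fin n) × Fin n) (c : Fin n)
    (os es : List (Fin n)) (hc : x.2 ≠ c) (ho : x.2 ∉ os) (he : x.2 ∉ es) :
    ladderCoe F (alternatingMul (ladderPoint F x x.2 * ladderPoint F x c)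
      (os.map (ladderPoint F x)) (es.map (ladderPoint F x))) =
    alternatingMul ((GrassmannAlgebra.gen F n * GrassmannAlgebra.gen F (n + 1)) ⊗ₜ
      ladderBasis F (.inr 0)) ((c :: es).map (ladderTensor F fun i => decide (i ∈ x.1)))
        (os.map (ladderTensor F fun i => decide (i ∈ x.1))) := by
  rw [← alternatingMul_cons, map_alternatingMul, ← List.map_cons, map_ladderPoint,
    map_ladderPoint x os ho, ladderPoint, if_pos rfl]
  · congr 1
    exact ladderCoe_mul _ _
  · simp [hc, he]

/-- The product substituted for x.2 kills the normal form y unless x.2 is one of its two initial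
letters. In that case nonvanishing would require y.1 ⊆ x.1, hence y.1 = x.1 by cardinality; then the
representatives agree as well, and so do the remaining initial letters. -/
theorem normalForm_ladderPoint_eq_zero [CharZero F] {τ : Finset (Fin n) → Fin n}
    (hτ : ∀ T : Finset (Fin n), T.Nonempty → τ T ∈ T) {x y : Finset (Fin n) × Fin n}
    (hx : x ∈ normalFormIndices τ) (hy : y ∈ normalFormIndices τ) (hxy : x ≠ y) :
    normalForm (ladderPoint F x) τ y = 0 := by
  have hV : IsMetabelianJordan (ladder F).envelope := ladder_mem F
  have hmem : ∀ {i}, i ∈ evenLetters τ y ↔ i ≠ y.2 ∧ i ≠ τ y.1ᶜ ∧ i ∉ y.1 := fun {i} => by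
    simp [evenLetters]
  by_cases h : x.2 = y.2 ∨ x.2 = τ y.1ᶜ
  · have hne : y.1 ≠ x.1 := by
      intro he
      rcases h with h | h
      · exact hxy (Prod.ext he.symm h)
      · rw [he] at h
        exact hx.2.1 h
    have hcard : y.1.card = x.1.card := by
      have h1 := card_evenLetters hτ hx
      have h2 := card_evenLetters hτ hy
      have h3 := hx.2.2
      have h4 := hy.2.2
      simp only [Interleavable, Finset.length_toList] at h3 h4
      omega
    -- Some letter at an odd place of y is assigned y₀ instead of y₁, so it cannot act on its rung.
    have hsub : ¬ y.1 ⊆ x.1 := fun hs => hne (Finset.eq_of_subset_of_card_le hs hcard.ge)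
    obtain ⟨o, hoy, hox⟩ := Finset.not_subset.1 hsub
    have key : ∀ c : Fin n, x.2 ≠ c → x.2 ∉ y.1 → x.2 ∉ evenLetters τ y →
        alternatingMul (ladderPoint F x x.2 * ladderPoint F x c)
          (y.1.toList.map (ladderPoint F x)) ((evenLetters τ y).map (ladderPoint F x)) = 0 := by
      intro c hc h1 h2
      have h3 := ladderCoe_alternatingMul (F := F) x c y.1.toList (evenLetters τ y) hc
        (by simpa using h1) h2
      rw [alternatingMul_ladder_eq_zero F _ (c :: evenLetters τ y) y.1.toList 0 _ ?_ ?_] at h3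
      · exact Subtype.ext h3
      · have := hy.2.2
        simp only [Interleavable, List.length_cons] at this ⊢
        omega
      · exact Or.inr ⟨o, by simpa using hoy, by simpa using hox⟩
    have hty : τ y.1ᶜ ∈ y.1ᶜ := hτ _ ⟨y.2, Finset.mem_compl.2 hy.1⟩
    rw [normalForm]
    rcases h with h | h
    · rw [hV.comm, ← h]
      refine key _ ?_ (h ▸ hy.1) ?_
      · rw [h]; exact hy.2.1
      · rw [hmem]; tauto
    · rw [← h]
      refine key _ ?_ ?_ ?_
      · rw [h]; exact hy.2.1.symm
      · rw [h]; exact Finset.mem_compl.1 hty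
      · rw [hmem]; tauto
  · push Not at h
    refine alternatingMul_eq_zero_of_annihilates (c := ladderPoint F x x.2) ?_ _ _ _ _
      (hy.2.2.map _ _) ?_
    · intro p q
      rw [ladderPoint, if_pos rfl]
      exact hV.metabelian _ _ _ _
    · by_cases ho : x.2 ∈ y.1
      · exact Or.inl (List.mem_map_of_mem (Finset.mem_toList.2 ho))
      · exact Or.inr (List.mem_map_of_mem (hmem.2 ⟨h.1, h.2, ho⟩))

/-- All letters carry the index that their rung demands, so the value is a product of distinct
Grassmann generators tensored with a rung. -/
theorem normalForm_ladderPoint_ne_zero [CharZero F] {τ : Finset (Fin n) → Fin n}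
    (hτ : ∀ T : Finset (Fin n), T.Nonempty → τ T ∈ T) {x : Finset (Fin n) × Fin n}
    (hx : x ∈ normalFormIndices τ) : normalForm (ladderPoint F x) τ x ≠ 0 := by
  have hV : IsMetabelianJordan (ladder F).envelope := ladder_mem F
  have hmem : ∀ {i}, i ∈ evenLetters τ x ↔ i ≠ x.2 ∧ i ≠ τ x.1ᶜ ∧ i ∉ x.1 := fun {i} => by
    simp [evenLetters]
  have htx : τ x.1ᶜ ∈ x.1ᶜ := hτ _ ⟨x.2, Finset.mem_compl.2 hx.1⟩
  intro h0
  rw [normalForm, hV.comm] at h0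
  have h3 := ladderCoe_alternatingMul (F := F) x (τ x.1ᶜ) x.1.toList (evenLetters τ x) hx.2.1
    (by simpa using hx.1) (by rw [hmem]; tauto)
  rw [h0] at h3
  obtain ⟨l, m, hl, h⟩ := alternatingMul_ladder_eq F (fun i => decide (i ∈ x.1))
    (τ x.1ᶜ :: evenLetters τ x) x.1.toList 0
    (GrassmannAlgebra.gen F n * GrassmannAlgebra.gen F (n + 1)) (by
      have := hx.2.2
      simp only [Interleavable, List.length_cons] at this ⊢
      omega) (by
      intro i hi
      have : i ∉ x.1 := by
        rcases List.mem_cons.1 hi with rfl | hi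
        · exact Finset.mem_compl.1 htx
        · exact (hmem.1 hi).2.2
      simp [this]) (by
      intro i hi
      simpa using hi)
  rw [h] at h3
  have hnd : (τ x.1ᶜ :: evenLetters τ x ++ x.1.toList).Nodup := by
    rw [List.cons_append, List.nodup_cons, List.nodup_append]
    refine ⟨?_, Finset.nodup_toList _, Finset.nodup_toList _, ?_⟩
    · rw [List.mem_append, hmem, Finset.mem_toList]
      have := Finset.mem_compl.1 htx
      tauto
    · intro a ha b hb hab
      rw [hmem] at ha
      rw [Finset.mem_toList] at hb
      exact ha.2.2 (hab ▸ hb)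
  have hne : GrassmannAlgebra.gen F n * GrassmannAlgebra.gen F (n + 1) *
      (l.map fun i : Fin n => GrassmannAlgebra.gen F i).prod ≠ 0 := by
    have := GrassmannAlgebra.prod_gen_ne_zero (F := F) (n :: (n + 1) :: l.map Fin.val) (by
      have hlv : ∀ m ∈ l.map Fin.val, m < n := by
        intro m hm
        obtain ⟨i, -, rfl⟩ := List.mem_map.1 hm
        exact i.2
      rw [List.nodup_cons, List.nodup_cons]
      refine ⟨?_, fun h => absurd (hlv _ h) (by omega),
        (hl.nodup_iff.2 hnd).map Fin.val_injective⟩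
      rw [List.mem_cons]
      rintro (h | h)
      · omega
      · exact absurd (hlv _ h) (by omega))
    rw [List.map_cons, List.prod_cons, List.map_cons, List.prod_cons, ← mul_assoc,
      List.map_map] at this
    exact this
  have hb : ladderBasis F (.inr m) ≠ 0 := by
    intro h
    have := (BilinearAlgebra.mk (ladderMul F)).injective (h.trans (map_zero _).symm)
    simp at this
  exact GrassmannAlgebra.tmul_ne_zero hne hb h3.symm

end LadderEvaluation

/-! ### Polynomials with prescribed letters -/

section Letters

variable {F : Type u} [Field F] {X : Type*}

/-- The polynomials all monomials of which have the multiset `M` of letters. -/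
def polysWithLetters (F : Type u) [Field F] {X : Type*} (M : Multiset X) :
    Submodule F (FreeNonUnitalNonAssocAlgebra F X) :=
  Submodule.span F {f | ∃ w : FreeMagma X, FreeMagma.letters w = M ∧ f = MonoidAlgebra.single w 1}

theorem of_mem_polysWithLetters (x : X) :
    FreeNonUnitalNonAssocAlgebra.of F x ∈ polysWithLetters F {x} :=
  Submodule.subset_span ⟨FreeMagma.of x, rfl, rfl⟩

theorem mul_mem_polysWithLetters {M N : Multiset X} {f g : FreeNonUnitalNonAssocAlgebra F X}
    (hf : f ∈ polysWithLetters F M) (hg : g ∈ polysWithLetters F N) :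
    f * g ∈ polysWithLetters F (M + N) := by
  induction hf using Submodule.span_induction with
  | mem f hf =>
    obtain ⟨v, rfl, rfl⟩ := hf
    induction hg using Submodule.span_induction with
    | mem g hg =>
      obtain ⟨w, rfl, rfl⟩ := hg
      refine Submodule.subset_span ⟨FreeMagma.mul v w, rfl, ?_⟩
      rw [MonoidAlgebra.single_mul_single, one_mul]; rfl
    | zero => rw [mul_zero]; exact Submodule.zero_mem _
    | add a b _ _ ha hb => rw [mul_add]; exact Submodule.add_mem _ ha hb
    | smul c a _ ha => rw [mul_smul_comm]; exact Submodule.smul_mem _ c ha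
  | zero => rw [zero_mul]; exact Submodule.zero_mem _
  | add a b _ _ ha hb => rw [add_mul]; exact Submodule.add_mem _ ha hb
  | smul c a _ ha => rw [smul_mul_assoc]; exact Submodule.smul_mem _ c ha

theorem isMultilinearPoly_of_mem {n : ℕ} {f : FreeNonUnitalNonAssocAlgebra F (Fin n)}
    {M : Multiset (Fin n)} (hf : f ∈ polysWithLetters F M)
    (hM : M = (Finset.univ : Finset (Fin n)).val) : IsMultilinearPoly f := by
  classical
  subst hM
  induction hf using Submodule.span_induction with
  | mem f hf =>
    obtain ⟨v, hv, rfl⟩ := hf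
    intro w hw
    rw [MonoidAlgebra.coeff_single] at hw
    rw [Finset.mem_singleton.1 (Finsupp.support_single_subset hw), hv]
  | zero => intro w hw; simp at hw
  | add f g _ _ hf hg =>
    intro w hw
    rw [MonoidAlgebra.coeff_add] at hw
    rcases Finset.mem_union.1 (Finsupp.support_add hw) with hw | hw
    · exact hf w hw
    · exact hg w hw
  | smul c f _ hf =>
    intro w hw
    rw [MonoidAlgebra.coeff_smul] at hw
    exact hf w (Finsupp.support_smul hw)

theorem FreeMagma.letters_ne_zero (w : FreeMagma X) : FreeMagma.letters w ≠ 0 := by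
  induction w using FreeMagma.rec with
  | of x => exact Multiset.singleton_ne_zero x
  | mul v w hv hw =>
    intro h
    exact hv (add_eq_zero.1 h).1

end Letters

/-! ### Multilinear superidentities of the ladder superalgebra -/

section LadderIdentities

variable {F : Type u} [Field F]

/-- The elements of the Grassmann envelope of the ladder superalgebra that are substituted into
multilinear polynomials. -/
def ladderTestSet (F : Type u) [Field F] : Set (ladder F).envelope :=
  {x | (∃ i b, x = ladderLetter F i b) ∨
    ∃ i b j c, x = ladderLetter F i b * ladderLetter F j c}

theorem ladderLetter_ne_zero (i : ℕ) (b : Bool) : ladderLetter F i b ≠ 0 := by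
  intro h
  have h1 : GrassmannAlgebra.gen F i ≠ 0 := by
    simpa using GrassmannAlgebra.prod_gen_ne_zero (F := F) [i] (List.nodup_singleton i)
  have h2 : ladderBasis F (.inl b) ≠ 0 := by
    intro h
    have := (BilinearAlgebra.mk (ladderMul F)).injective (h.trans (map_zero _).symm)
    simp at this
  exact GrassmannAlgebra.tmul_ne_zero h1 h2 (congrArg Subtype.val h)

/-- A multilinear polynomial that vanishes on the Grassmann envelope of the ladder superalgebra
vanishes on all metabelian Jordan algebras. -/
theorem mem_metabelianJordanIdeal_of_ladder [CharZero F] {n : ℕ}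
    (f : FreeNonUnitalNonAssocAlgebra F (Fin n)) (hf : IsMultilinearPoly f)
    (h : ∀ x : Fin n → (ladder F).envelope, (∀ i, x i ∈ ladderTestSet F) →
      FreeNonUnitalNonAssocAlgebra.lift F x f = 0) :
    f ∈ (metabelianJordanIdeal F (Fin n)).toSubmodule := by
  -- Normal forms begin with a product of two letters, so degrees 0 and 1 are treated directly.
  rcases Nat.lt_or_ge n 2 with hn | hn
  · suffices f = 0 by rw [this]; exact Submodule.zero_mem _
    have hn' : n = 0 ∨ n = 1 := by omega
    rcases hn' with rfl | rfl
    · rw [← MonoidAlgebra.coeff_eq_zero, ← Finsupp.support_eq_empty, Finset.eq_empty_iff_forall_notMem]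
      intro w hw
      exact FreeMagma.letters_ne_zero w (hf w hw)
    · have hw : ∀ w ∈ f.coeff.support, w = FreeMagma.of 0 := by
        intro w hw
        have hl := hf w hw
        cases w with
        | of x => rw [Subsingleton.elim x 0]
        | mul v w =>
          have h1 := congrArg Multiset.card hl
          have h2 := Multiset.card_pos.2 (FreeMagma.letters_ne_zero v)
          have h3 := Multiset.card_pos.2 (FreeMagma.letters_ne_zero w)
          simp only [FreeMagma.letters, Multiset.card_add, Finset.card_val, Finset.card_univ,
            Fintype.card_fin] at h1
          omega
      have hfe : f = MonoidAlgebra.single (FreeMagma.of 0) (f.coeff (FreeMagma.of 0)) := by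
        rw [← MonoidAlgebra.coeff_inj, MonoidAlgebra.coeff_single]
        exact (Finsupp.support_subset_singleton.1 fun w h => Finset.mem_singleton.2 (hw w h))
      have h0 := h (fun _ => ladderLetter F 0 false) fun _ => Or.inl ⟨_, _, rfl⟩
      rw [hfe, FreeNonUnitalNonAssocAlgebra.lift_single] at h0
      have : f.coeff (FreeMagma.of 0) = 0 :=
        (smul_eq_zero.1 h0).resolve_right (ladderLetter_ne_zero 0 false)
      rw [hfe, this, MonoidAlgebra.single_zero]
  · obtain ⟨τ, hτ⟩ : ∃ τ : Finset (Fin n) → Fin n, ∀ T : Finset (Fin n), T.Nonempty → τ T ∈ T := by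
      have : ∀ T : Finset (Fin n), ∃ i, T.Nonempty → i ∈ T := by
        intro T
        rcases T.eq_empty_or_nonempty with rfl | ⟨i, hi⟩
        · exact ⟨⟨0, by omega⟩, fun h => absurd h Finset.not_nonempty_empty⟩
        · exact ⟨i, fun _ => hi⟩
      choose τ hτ using this
      exact ⟨τ, hτ⟩
    obtain ⟨α, hα⟩ := exists_normalForm_coeff hn τ hτ f hf
    let := Fintype.ofFinite (normalFormIndices τ)
    -- Evaluation at the point belonging to x isolates the coefficient of x.
    have hzero : ∀ x, α x = 0 := by
      intro x
      have h1 := hα (ladder F).envelope (ladder_mem F) (ladderPoint F x.1)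
      rw [map_sub, sub_eq_zero] at h1
      replace h1 := h1.symm.trans (h _ ?_)
      rw [map_sum, Finset.sum_eq_single x] at h1
      · rw [map_smul, map_normalForm] at h1
        simp only [FreeNonUnitalNonAssocAlgebra.lift_of_apply] at h1
        exact (smul_eq_zero.1 h1).resolve_right (normalForm_ladderPoint_ne_zero hτ x.2)
      · intro y _ hyx
        rw [map_smul, map_normalForm]
        simp only [FreeNonUnitalNonAssocAlgebra.lift_of_apply]
        rw [normalForm_ladderPoint_eq_zero hτ x.2 y.2 (fun h => hyx (Subtype.ext h.symm)),
          smul_zero]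
      · intro hx
        exact absurd (Finset.mem_univ x) hx
      · intro i
        rw [ladderPoint]
        split_ifs
        · exact Or.inr ⟨_, _, _, _, rfl⟩
        · exact Or.inl ⟨_, _, rfl⟩
    simpa [hzero] using hα

end LadderIdentities

/-! ### Homomorphisms of Grassmann envelopes -/

section EnvelopeMap

variable {F : Type u} [Field F] {A B : Superalgebra F}

/-- The homomorphism of Grassmann envelopes induced by a homomorphism of superalgebras. -/
def envelopeMap (φ : A.carrier →ₙₐ[F] B.carrier) (hφ : ∀ i, ∀ a ∈ A.part i, φ a ∈ B.part i) :
    A.envelope →ₙₐ[F] B.envelope :=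
  NonUnitalAlgHom.codRestrict
    ((grassmannMap φ).comp (NonUnitalSubalgebraClass.subtype A.envelope)) B.envelope
    fun t => grassmannMap_mem_envelope φ hφ t.2

theorem coe_envelopeMap (φ : A.carrier →ₙₐ[F] B.carrier)
    (hφ : ∀ i, ∀ a ∈ A.part i, φ a ∈ B.part i) (t : A.envelope) :
    (envelopeMap φ hφ t : GrassmannAlgebra F ⊗[F] B.carrier) = grassmannMap φ t := rfl

theorem Superalgebra.SatisfiesSuperidentity.lift_eq_zero {n : ℕ}
    {f : FreeNonUnitalNonAssocAlgebra F (Fin n)} (hf : A.SatisfiesSuperidentity f)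
    (φ : A.carrier →ₙₐ[F] B.carrier) (hφ : ∀ i, ∀ a ∈ A.part i, φ a ∈ B.part i)
    (x : Fin n → B.envelope) (hx : ∀ i, x i ∈ Set.range (envelopeMap φ hφ)) :
    FreeNonUnitalNonAssocAlgebra.lift F x f = 0 := by
  choose t ht using hx
  have h := FreeNonUnitalNonAssocAlgebra.map_lift (envelopeMap φ hφ) t f
  rw [hf t, map_zero] at h
  rw [h]
  congr 2
  exact funext fun i => (ht i).symm

variable {X : Type} {p : X → ZMod 2}

theorem mem_range_envelopeMap (hB : B ∈ metabelianJordanSupervariety F)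
    (z : X → B.carrier) (hz : ∀ x, z x ∈ B.part (p x)) (x : X) (g : GrassmannAlgebra F)
    (hg : g ∈ GrassmannAlgebra.part F (p x)) :
    (⟨g ⊗ₜ z x, B.tmul_mem_envelope hg (hz x)⟩ : B.envelope) ∈
      Set.range (envelopeMap (freeSuperLift hB z hz) (freeSuperLift_mem_part hB z hz)) := by
  have hx : (metabelianJordanSuperideal F p).toQuot (FreeNonUnitalNonAssocAlgebra.of F x) ∈
      (freeMetabelianJordanSuperalgebra F p).part (p x) :=
    ⟨_, Submodule.subset_span ⟨FreeMagma.of x, by simp [wordParity, FreeMagma.letters], rfl⟩, rfl⟩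
  refine ⟨⟨g ⊗ₜ _, (freeMetabelianJordanSuperalgebra F p).tmul_mem_envelope hg hx⟩, ?_⟩
  apply Subtype.ext
  rw [coe_envelopeMap]
  refine (grassmannMap_tmul _ _ _).trans ?_
  rw [freeSuperLift_toQuot, FreeNonUnitalNonAssocAlgebra.lift_of_apply]

theorem mul_mem_range_envelopeMap (φ : A.carrier →ₙₐ[F] B.carrier)
    (hφ : ∀ i, ∀ a ∈ A.part i, φ a ∈ B.part i) {x y : B.envelope}
    (hx : x ∈ Set.range (envelopeMap φ hφ)) (hy : y ∈ Set.range (envelopeMap φ hφ)) :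
    x * y ∈ Set.range (envelopeMap φ hφ) := by
  obtain ⟨s, rfl⟩ := hx
  obtain ⟨t, rfl⟩ := hy
  exact ⟨s * t, map_mul _ _ _⟩

end EnvelopeMap

/-! ### Two odd generators -/

section TwoOdd

variable {F : Type u} [Field F]

open FreeNonUnitalNonAssocAlgebra in
/-- Superalgebras that satisfy all superidentities of a metabelian Jordan superalgebra are
metabelian Jordan superalgebras. -/
theorem generatedSupervariety_subset [CharZero F] {A : Superalgebra F}
    (hA : A ∈ metabelianJordanSupervariety F) :
    A.generatedSupervariety ⊆ metabelianJordanSupervariety F := by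
  have hA' : IsMetabelianJordan A.envelope := hA
  have := isAddTorsionFree_of_field F A.envelope
  intro B hB
  have hlet : ∀ {n : ℕ} (i : Fin n), of F i ∈ polysWithLetters F {i} := of_mem_polysWithLetters
  have hcomm : ∀ x y : B.envelope, x * y = y * x := by
    intro x y
    have h := hB 2 (of F 0 * of F 1 - of F 1 * of F 0)
      (isMultilinearPoly_of_mem (M := {0} + {1}) (sub_mem
        (mul_mem_polysWithLetters (hlet _) (hlet _))
        (by rw [add_comm]; exact mul_mem_polysWithLetters (hlet _) (hlet _))) rfl)
      (fun a => by simp only [map_sub, map_mul, lift_of_apply]; rw [hA'.comm, sub_self]) ![x, y]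
    simp only [map_sub, map_mul, lift_of_apply] at h
    exact sub_eq_zero.1 h
  have hmet : ∀ x y z t : B.envelope, x * y * (z * t) = 0 := by
    intro x y z t
    have h := hB 4 (of F 0 * of F 1 * (of F 2 * of F 3))
      (isMultilinearPoly_of_mem (M := {0} + {1} + ({2} + {3}))
        (mul_mem_polysWithLetters (mul_mem_polysWithLetters (hlet _) (hlet _))
          (mul_mem_polysWithLetters (hlet _) (hlet _))) rfl)
      (fun a => by simp only [map_mul, lift_of_apply]; exact hA'.metabelian _ _ _ _) ![x, y, z, t]
    simp only [map_mul, lift_of_apply] at h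
    exact h
  have hcyc : ∀ x y : B.envelope, x * x * y * x = 0 := by
    intro x y
    have hmem : ∀ i j k l : Fin 4, of F i * of F j * of F k * of F l ∈
        polysWithLetters F ({i} + {j} + {k} + {l}) := fun i j k l =>
      mul_mem_polysWithLetters (mul_mem_polysWithLetters
        (mul_mem_polysWithLetters (hlet _) (hlet _)) (hlet _)) (hlet _)
    have h := hB 4 (of F 0 * of F 1 * of F 2 * of F 3 + of F 1 * of F 3 * of F 2 * of F 0 +
        of F 0 * of F 3 * of F 2 * of F 1)
      (isMultilinearPoly_of_mem (M := {0} + {1} + {2} + {3})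
        (add_mem (add_mem (hmem _ _ _ _) ((show ({1} + {3} + {2} + {0} : Multiset (Fin 4)) = {0} + {1} + {2} + {3} by decide) ▸ hmem 1 3 2 0))
          ((show ({0} + {3} + {2} + {1} : Multiset (Fin 4)) = {0} + {1} + {2} + {3} by decide) ▸ hmem 0 3 2 1)) rfl)
      (fun a => by simp only [map_mul, map_add, lift_of_apply]; exact hA'.cyclic _ _ _ _)
      ![x, x, y, x]
    simp only [map_mul, map_add, lift_of_apply] at h
    have h3 : (3 : F) • (x * x * y * x) = 0 := by
      rw [← h]
      change (3 : F) • (x * x * y * x) = x * x * y * x + x * x * y * x + x * x * y * x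
      module
    exact (smul_eq_zero.1 h3).resolve_left (by norm_num)
  exact ⟨hcomm, fun x y => by rw [hcyc, hmet], hmet⟩

theorem metabelianJordanSupervarietyOfRank_subset [CharZero F] (r s : ℕ) :
    metabelianJordanSupervarietyOfRank F r s ⊆ metabelianJordanSupervariety F :=
  generatedSupervariety_subset (freeMetabelianJordanSuperalgebra_mem F _)

theorem metabelianJordanSupervarietyOfRank_eq [CharZero F] (r s : ℕ) (hs : 2 ≤ s) :
    metabelianJordanSupervarietyOfRank F r s = metabelianJordanSupervariety F := by
  refine Set.Subset.antisymm (metabelianJordanSupervarietyOfRank_subset r s) ?_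
  intro B hB n f hf hA a
  refine mem_metabelianJordanIdeal_of_ladder f hf (fun x hx => ?_) B.envelope hB a
  -- Even generators go to 0, the odd generator number 1 to y₁ and all other odd ones to y₀; with s
  -- ≥ 2 both ladder generators are reached.
  let z : Fin r ⊕ Fin s → (ladder F).carrier := Sum.elim (fun _ => (0 : BilinearAlgebra (ladderMul F)))
    (fun j => ladderBasis F (.inl (decide (j.val = 1))))
  have hz : ∀ x, z x ∈ (ladder F).part (generatorParity r s x) := by
    rintro (i | j)
    · exact Submodule.zero_mem _
    · exact ladderBasis_mem_part F (.inl _)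
  have hletter : ∀ i b, ladderLetter F i b ∈ Set.range (envelopeMap
      (freeSuperLift (ladder_mem F) z hz) (freeSuperLift_mem_part (ladder_mem F) z hz)) := by
    intro i b
    have h := mem_range_envelopeMap (ladder_mem F) z hz
      (.inr ⟨if b then 1 else 0, by split_ifs <;> omega⟩) (GrassmannAlgebra.gen F i)
      (GrassmannAlgebra.gen_mem_part i)
    convert h using 1
    apply Subtype.ext
    cases b <;> rfl
  refine hA.lift_eq_zero _ (freeSuperLift_mem_part (ladder_mem F) z hz) x fun i => ?_
  rcases hx i with ⟨j, b, h⟩ | ⟨j, b, k, c, h⟩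
  · rw [h]; exact hletter j b
  · rw [h]; exact mul_mem_range_envelopeMap _ _ (hletter j b) (hletter k c)

end TwoOdd

/-! ### Left-normed words and products of symmetrized pairs -/

section Words

/-- The left-normed word `z_0 z_1 ⋯ z_m`. -/
def leftNormed {B : Type*} [Mul B] (z : ℕ → B) : ℕ → B
  | 0 => z 0
  | m + 1 => leftNormed z m * z (m + 1)

/-- The product of `z_0 z_1` with the symmetrized pairs of multiplications by `z_2, z_3`, by
`z_4, z_5`, and so on. -/
def symmetrized {B : Type*} [NonUnitalNonAssocRing B] (z : ℕ → B) : ℕ → B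
  | 0 => z 0 * z 1
  | k + 1 => symMul (symmetrized z k) (z (2 * k + 2), z (2 * k + 3))

theorem map_leftNormed {A B : Type*} [Mul A] [Mul B] (φ : A → B)
    (hmul : ∀ a b, φ (a * b) = φ a * φ b) (z : ℕ → A) (m : ℕ) :
    φ (leftNormed z m) = leftNormed (fun i => φ (z i)) m := by
  induction m with
  | zero => rfl
  | succ m ih => rw [leftNormed, hmul, ih, leftNormed]

theorem leftNormed_congr {B : Type*} [Mul B] {z z' : ℕ → B} {m : ℕ}
    (h : ∀ i ≤ m, z i = z' i) : leftNormed z m = leftNormed z' m := by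
  induction m with
  | zero => exact h 0 le_rfl
  | succ m ih => rw [leftNormed, leftNormed, ih fun i hi => h i (by omega), h _ le_rfl]

theorem map_symmetrized {A B : Type*} [NonUnitalNonAssocRing A] [NonUnitalNonAssocRing B]
    (φ : A → B) (hadd : ∀ a b, φ (a + b) = φ a + φ b) (hmul : ∀ a b, φ (a * b) = φ a * φ b)
    (z : ℕ → A) (k : ℕ) : φ (symmetrized z k) = symmetrized (fun i => φ (z i)) k := by
  induction k with
  | zero => exact hmul _ _
  | succ k ih => simp only [symmetrized, symMul, hadd, hmul, ih]

theorem symmetrized_congr {B : Type*} [NonUnitalNonAssocRing B] {z z' : ℕ → B} {k : ℕ}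
    (h : ∀ i < 2 * k + 2, z i = z' i) : symmetrized z k = symmetrized z' k := by
  induction k with
  | zero => rw [symmetrized, symmetrized, h 0 (by omega), h 1 (by omega)]
  | succ k ih =>
    rw [symmetrized, symmetrized, ih fun i hi => h i (by omega), h (2 * k + 2) (by omega),
      h (2 * k + 3) (by omega)]

theorem symmetrized_eq_foldl {B : Type*} [NonUnitalNonAssocRing B] (z : ℕ → B) (k : ℕ) :
    symmetrized z k =
      ((List.range k).map fun i => (z (2 * i + 2), z (2 * i + 3))).foldl symMul (z 0 * z 1) := by
  induction k with
  | zero => rfl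
  | succ k ih => rw [symmetrized, List.range_succ, List.map_append, List.foldl_append, ih]; rfl

variable (F : Type u) [Field F]

theorem leftNormed_mem_polysWithLetters {X : Type*} (c : ℕ → X) (m : ℕ) :
    leftNormed (fun i => FreeNonUnitalNonAssocAlgebra.of F (c i)) m ∈
      polysWithLetters F ((Multiset.range (m + 1)).map c) := by
  induction m with
  | zero => exact of_mem_polysWithLetters _
  | succ m ih =>
    rw [Multiset.range_succ, Multiset.map_cons, ← Multiset.singleton_add, add_comm]
    exact mul_mem_polysWithLetters ih (of_mem_polysWithLetters _)

theorem symmetrized_mem_polysWithLetters {X : Type*} (c : ℕ → X) (k : ℕ) :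
    symmetrized (fun i => FreeNonUnitalNonAssocAlgebra.of F (c i)) k ∈
      polysWithLetters F ((Multiset.range (2 * k + 2)).map c) := by
  induction k with
  | zero =>
    rw [show (Multiset.range (2 * 0 + 2)).map c = {c 0} + {c 1} by
      simpa [Multiset.range_succ] using Multiset.pair_comm _ _]
    exact mul_mem_polysWithLetters (of_mem_polysWithLetters _) (of_mem_polysWithLetters _)
  | succ k ih =>
    have h1 : (Multiset.range (2 * (k + 1) + 2)).map c =
        (Multiset.range (2 * k + 2)).map c + {c (2 * k + 2)} + {c (2 * k + 3)} := by
      rw [show 2 * (k + 1) + 2 = 2 * k + 2 + 1 + 1 by ring, Multiset.range_succ,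
        Multiset.range_succ, Multiset.map_cons, Multiset.map_cons, ← Multiset.singleton_add,
        ← Multiset.singleton_add]
      abel
    refine add_mem ?_ ?_
    · rw [h1]
      exact mul_mem_polysWithLetters (mul_mem_polysWithLetters ih (of_mem_polysWithLetters _))
        (of_mem_polysWithLetters _)
    · rw [h1, add_right_comm]
      exact mul_mem_polysWithLetters (mul_mem_polysWithLetters ih (of_mem_polysWithLetters _))
        (of_mem_polysWithLetters _)

theorem Fin.map_ofNat_range (n : ℕ) [NeZero n] :
    (Multiset.range n).map (Fin.ofNat n) = (Finset.univ : Finset (Fin n)).val := by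
  change ((List.map (Fin.ofNat n) (List.range n) : List (Fin n)) : Multiset (Fin n)) =
    ((List.finRange n : List (Fin n)) : Multiset (Fin n))
  congr 1
  apply List.ext_getElem
  · simp
  · intro i h1 h2
    apply Fin.ext
    have : i < n := by simpa using h1
    simp [Nat.mod_eq_of_lt this]

/-- The left-normed word as a multilinear polynomial. -/
def leftNormedPoly (m : ℕ) : FreeNonUnitalNonAssocAlgebra F (Fin (m + 1)) :=
  leftNormed (fun i => FreeNonUnitalNonAssocAlgebra.of F (Fin.ofNat (m + 1) i)) m

/-- The product of symmetrized pairs as a multilinear polynomial. -/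
def symmetrizedPoly (k : ℕ) : FreeNonUnitalNonAssocAlgebra F (Fin (2 * k + 2)) :=
  symmetrized (fun i => FreeNonUnitalNonAssocAlgebra.of F (Fin.ofNat (2 * k + 2) i)) k

theorem isMultilinearPoly_leftNormedPoly (m : ℕ) : IsMultilinearPoly (leftNormedPoly F m) :=
  isMultilinearPoly_of_mem (leftNormed_mem_polysWithLetters F _ m) (Fin.map_ofNat_range _)

theorem isMultilinearPoly_symmetrizedPoly (k : ℕ) : IsMultilinearPoly (symmetrizedPoly F k) :=
  isMultilinearPoly_of_mem (symmetrized_mem_polysWithLetters F _ k) (Fin.map_ofNat_range _)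

variable {F} {A : Type*} [NonUnitalNonAssocRing A] [Module F A] [IsScalarTower F A A]
  [SMulCommClass F A A]

theorem lift_leftNormedPoly (x : ℕ → A) (m : ℕ) :
    FreeNonUnitalNonAssocAlgebra.lift F (fun i : Fin (m + 1) => x i) (leftNormedPoly F m) =
      leftNormed x m := by
  rw [leftNormedPoly, map_leftNormed _ (map_mul _)]
  refine leftNormed_congr fun i hi => ?_
  rw [FreeNonUnitalNonAssocAlgebra.lift_of_apply, Fin.val_ofNat,
    Nat.mod_eq_of_lt (Nat.lt_succ_of_le hi)]

theorem lift_symmetrizedPoly (x : ℕ → A) (k : ℕ) :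
    FreeNonUnitalNonAssocAlgebra.lift F (fun i : Fin (2 * k + 2) => x i) (symmetrizedPoly F k) =
      symmetrized x k := by
  rw [symmetrizedPoly, map_symmetrized _ (map_add _) (map_mul _)]
  refine symmetrized_congr fun i hi => ?_
  rw [FreeNonUnitalNonAssocAlgebra.lift_of_apply, Fin.val_ofNat, Nat.mod_eq_of_lt hi]

/-- A product of symmetrized pairs is determined by its values on a spanning set. -/
theorem foldl_symMul_eq_zero_of_span (T : Set A) (hT : Submodule.span F T = ⊤) :
    ∀ (l : List (A × A)) (w : A), (∀ l' : List (A × A), l'.length = l.length →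
      (∀ x ∈ l', x.1 ∈ T ∧ x.2 ∈ T) → l'.foldl symMul w = 0) → l.foldl symMul w = 0 := by
  have hsmul : ∀ (l : List (A × A)) (c : F) (w : A),
      l.foldl symMul (c • w) = c • l.foldl symMul w := by
    intro l
    induction l with
    | nil => exact fun c w => rfl
    | cons x l ih =>
      intro c w
      rw [List.foldl_cons, List.foldl_cons, ← ih]
      simp only [symMul, smul_mul_assoc, smul_add]
  intro l
  induction l with
  | nil => exact fun w h => h [] rfl (by simp)
  | cons x l ih =>
    intro w h
    obtain ⟨p, q⟩ := x
    rw [List.foldl_cons]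
    simp only [List.length_cons] at h
    have hp : p ∈ Submodule.span F T := hT ▸ Submodule.mem_top
    have hq : q ∈ Submodule.span F T := hT ▸ Submodule.mem_top
    induction hp using Submodule.span_induction with
    | mem p hp =>
      induction hq using Submodule.span_induction with
      | mem q hq =>
        refine ih _ fun l' hl' hl => ?_
        refine h ((p, q) :: l') (by simp [hl']) fun x hx => ?_
        rcases List.mem_cons.1 hx with rfl | hx
        · exact ⟨hp, hq⟩
        · exact hl x hx
      | zero => simp [symMul, foldl_symMul_zero]
      | add a b _ _ ha hb =>
        rw [show symMul w (p, a + b) = symMul w (p, a) + symMul w (p, b) by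
          simp only [symMul, mul_add, add_mul]; abel, foldl_symMul_add, ha, hb, add_zero]
      | smul c a _ ha =>
        rw [show symMul w (p, c • a) = c • symMul w (p, a) by
          simp only [symMul, mul_smul_comm, smul_mul_assoc, smul_add], hsmul, ha, smul_zero]
    | zero => simp [symMul, foldl_symMul_zero]
    | add a b _ _ ha hb =>
      rw [show symMul w (a + b, q) = symMul w (a, q) + symMul w (b, q) by
        simp only [symMul, mul_add, add_mul]; abel, foldl_symMul_add, ha, hb, add_zero]
    | smul c a _ ha =>
      rw [show symMul w (c • a, q) = c • symMul w (a, q) by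
        simp only [symMul, mul_smul_comm, smul_mul_assoc, smul_add], hsmul, ha, smul_zero]

end Words

/-! ### Spanning sets of free superalgebras -/

section FreeSpan

variable {F : Type u} [Field F]

theorem Superalgebra.span_part (A : Superalgebra F) :
    Submodule.span F {a | ∃ i, a ∈ A.part i} = ⊤ := by
  have h := ((DirectSum.isInternal_submodule_iff_isCompl _ (zero_ne_one (α := ZMod 2))
    zmod_two_univ).1 A.isInternal).codisjoint.eq_top
  rw [eq_top_iff, ← h]
  exact sup_le (fun a ha => Submodule.subset_span ⟨0, ha⟩)
    (fun a ha => Submodule.subset_span ⟨1, ha⟩)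

/-- A superalgebra with metabelian Jordan envelope is metabelian. -/
theorem mul_mul_mul_eq_zero_of_mem {A : Superalgebra F} (hA : A ∈ metabelianJordanSupervariety F)
    (a b c d : A.carrier) : a * b * (c * d) = 0 := by
  have hom : ∀ i j k l : ZMod 2, ∀ a ∈ A.part i, ∀ b ∈ A.part j, ∀ c ∈ A.part k, ∀ d ∈ A.part l,
      a * b * (c * d) = 0 := by
    intro i j k l a ha b hb c hc d hd
    by_contra hne
    -- Even factors are paired with 1 and odd ones with distinct generators, so the Grassmann
    -- coefficient of the product is nonzero.
    let s : ZMod 2 → ℕ → List ℕ := fun i k => if i = 0 then [] else [k]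
    let g : ZMod 2 → ℕ → GrassmannAlgebra F := fun i k => ((s i k).map (GrassmannAlgebra.gen F)).prod
    have hg : ∀ i k, g i k ∈ GrassmannAlgebra.part F i := by
      intro i k
      rcases ZMod.eq_zero_or_eq_one i with rfl | rfl
      · simpa [g, s] using GrassmannAlgebra.one_mem_part
      · simpa [g, s] using GrassmannAlgebra.gen_mem_part k
    have h1 : g i 0 * g j 1 * (g k 2 * g l 3) ≠ 0 := by
      simp only [g, ← List.prod_append, ← List.map_append]
      refine GrassmannAlgebra.prod_gen_ne_zero _ ?_
      rcases ZMod.eq_zero_or_eq_one i with rfl | rfl <;>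
      rcases ZMod.eq_zero_or_eq_one j with rfl | rfl <;>
      rcases ZMod.eq_zero_or_eq_one k with rfl | rfl <;>
      rcases ZMod.eq_zero_or_eq_one l with rfl | rfl <;> simp [s]
    refine GrassmannAlgebra.tmul_ne_zero h1 hne ?_
    have h2 := ((isMetabelianJordan_coe_iff _).1 hA).2.2 _ (A.tmul_mem_envelope (hg i 0) ha)
      _ (A.tmul_mem_envelope (hg j 1) hb) _ (A.tmul_mem_envelope (hg k 2) hc)
      _ (A.tmul_mem_envelope (hg l 3) hd)
    simpa only [Algebra.TensorProduct.tmul_mul_tmul] using h2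
  have ext : ∀ P : A.carrier → Prop, (∀ i, ∀ a ∈ A.part i, P a) → P 0 →
      (∀ a b, P a → P b → P (a + b)) → (∀ (c : F) a, P a → P (c • a)) → ∀ a, P a := by
    intro P hP h0 hadd hsmul a
    have ha : a ∈ Submodule.span F {a | ∃ i, a ∈ A.part i} := A.span_part ▸ Submodule.mem_top
    induction ha using Submodule.span_induction with
    | mem a ha => exact hP _ a ha.choose_spec
    | zero => exact h0
    | add a b _ _ ha hb => exact hadd a b ha hb
    | smul c a _ ha => exact hsmul c a ha
  revert a b c d
  refine ext _ (fun i a ha => ?_) (by simp) ?_ ?_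
  · refine ext _ (fun j b hb => ?_) (by simp) ?_ ?_
    · refine ext _ (fun k c hc => ?_) (by simp) ?_ ?_
      · refine ext _ (fun l d hd => hom i j k l a ha b hb c hc d hd) (by simp) ?_ ?_
        · intro x y hx hy; rw [mul_add, mul_add, hx, hy, add_zero]
        · intro e x hx; rw [mul_smul_comm, mul_smul_comm, hx, smul_zero]
      · intro x y hx hy d; rw [add_mul, mul_add, hx, hy, add_zero]
      · intro e x hx d; rw [smul_mul_assoc, mul_smul_comm, hx, smul_zero]
    · intro x y hx hy c d; rw [mul_add, add_mul, hx, hy, add_zero]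
    · intro e x hx c d; rw [mul_smul_comm, smul_mul_assoc, hx, smul_zero]
  · intro x y hx hy b c d; rw [add_mul, add_mul, hx, hy, add_zero]
  · intro e x hx b c d; rw [smul_mul_assoc, smul_mul_assoc, hx, smul_zero]

variable {X : Type} (p : X → ZMod 2)

theorem freeMetabelianJordanSuperalgebra_part_le_span (i : ZMod 2) :
    (freeMetabelianJordanSuperalgebra F p).part i ≤ Submodule.span F
      {a | a ∈ (freeMetabelianJordanSuperalgebra F p).part i ∧
        ((∃ x, p x = i ∧ a = (metabelianJordanSuperideal F p).toQuot
          (FreeNonUnitalNonAssocAlgebra.of F x)) ∨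
        ∃ b c : (freeMetabelianJordanSuperalgebra F p).carrier, a = b * c)} := by
  change (freePart F p i).map _ ≤ _
  refine Submodule.map_le_iff_le_comap.2 (Submodule.span_le.2 ?_)
  rintro _ ⟨w, hw, rfl⟩
  refine Submodule.subset_span ⟨⟨_, Submodule.subset_span ⟨w, hw, rfl⟩, rfl⟩, ?_⟩
  cases w with
  | of x =>
    refine Or.inl ⟨x, ?_, rfl⟩
    rw [← hw]
    simp [wordParity, FreeMagma.letters]
  | mul v w =>
    refine Or.inr ⟨(metabelianJordanSuperideal F p).toQuot (MonoidAlgebra.single v 1),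
      (metabelianJordanSuperideal F p).toQuot (MonoidAlgebra.single w 1), ?_⟩
    refine Eq.trans ?_ (AlgIdeal.toQuot_mul _ _ _)
    rw [MonoidAlgebra.single_mul_single, one_mul]; rfl

end FreeSpan

/-! ### Symmetrized pairs in superalgebras with one odd generator -/

section OneOdd

variable {F : Type u} [Field F]

section Tensor

variable {A : Type*} [NonUnitalNonAssocRing A] [Module F A] [IsScalarTower F A A]
  [SMulCommClass F A A] {g h : GrassmannAlgebra F} (a : A) (w u : GrassmannAlgebra F ⊗[F] A)

theorem mul_tmul_even_comm (hg : g ∈ GrassmannAlgebra.part F 0) :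
    w * (g ⊗ₜ a) * (h ⊗ₜ a) = w * (h ⊗ₜ a) * (g ⊗ₜ a) := by
  induction w using TensorProduct.induction_on with
  | zero => simp only [zero_mul]
  | add x y hx hy => simp only [add_mul, hx, hy]
  | tmul k b =>
    simp only [Algebra.TensorProduct.tmul_mul_tmul]
    rw [mul_assoc, GrassmannAlgebra.even_comm hg, ← mul_assoc]

theorem mul_tmul_even_mul_comm (hg : g ∈ GrassmannAlgebra.part F 0)
    (hh : h ∈ GrassmannAlgebra.part F 0) :
    w * (g ⊗ₜ a) * u * (h ⊗ₜ a) = w * (h ⊗ₜ a) * u * (g ⊗ₜ a) := by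
  induction w using TensorProduct.induction_on with
  | zero => simp only [zero_mul]
  | add x y hx hy => simp only [add_mul, hx, hy]
  | tmul k b =>
    induction u using TensorProduct.induction_on with
    | zero => simp only [zero_mul, mul_zero]
    | add x y hx hy => simp only [mul_add, add_mul, hx, hy]
    | tmul l c =>
      simp only [Algebra.TensorProduct.tmul_mul_tmul]
      rw [mul_assoc k g l, mul_assoc k h l, GrassmannAlgebra.even_comm hg l,
        GrassmannAlgebra.even_comm hh l, ← mul_assoc k, ← mul_assoc k, mul_assoc (k * l),
        mul_assoc (k * l), GrassmannAlgebra.even_comm hg h]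

/-- The sign comes from the Grassmann factors alone, since both tensors carry the same a. This is
what makes a symmetrized pair over a single odd generator vanish. -/
theorem mul_tmul_odd_comm (hg : g ∈ GrassmannAlgebra.part F 1)
    (hh : h ∈ GrassmannAlgebra.part F 1) :
    w * (g ⊗ₜ a) * (h ⊗ₜ a) = -(w * (h ⊗ₜ a) * (g ⊗ₜ a)) := by
  induction w using TensorProduct.induction_on with
  | zero => simp only [zero_mul, neg_zero]
  | add x y hx hy => simp only [add_mul, hx, hy, neg_add]
  | tmul k b =>
    simp only [Algebra.TensorProduct.tmul_mul_tmul]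
    rw [mul_assoc, GrassmannAlgebra.odd_anticomm hg hh, mul_neg, ← mul_assoc,
      TensorProduct.neg_tmul]

theorem mul_mul_eq_zero_of_tmul {w : GrassmannAlgebra F ⊗[F] A}
    (hw : ∀ (g : GrassmannAlgebra F) (b c : A), w * (g ⊗ₜ (b * c)) = 0)
    (p q : GrassmannAlgebra F ⊗[F] A) : w * (p * q) = 0 := by
  induction p using TensorProduct.induction_on with
  | zero => simp only [zero_mul, mul_zero]
  | add x y hx hy => simp only [add_mul, mul_add, hx, hy, add_zero]
  | tmul k b =>
    induction q using TensorProduct.induction_on with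
    | zero => simp only [mul_zero]
    | add x y hx hy => simp only [mul_add, hx, hy, add_zero]
    | tmul l c => rw [Algebra.TensorProduct.tmul_mul_tmul, hw]

theorem mul_mul_tmul_mul_eq_zero (hA : ∀ a b c d : A, a * b * (c * d) = 0)
    (p q : GrassmannAlgebra F ⊗[F] A) (g : GrassmannAlgebra F) (b c : A) :
    p * q * (g ⊗ₜ (b * c)) = 0 := by
  induction p using TensorProduct.induction_on with
  | zero => simp only [zero_mul]
  | add x y hx hy => simp only [add_mul, hx, hy, add_zero]
  | tmul k b =>
    induction q using TensorProduct.induction_on with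
    | zero => simp only [mul_zero, zero_mul]
    | add x y hx hy => simp only [mul_add, add_mul, hx, hy, add_zero]
    | tmul l c =>
      simp only [Algebra.TensorProduct.tmul_mul_tmul, hA, TensorProduct.tmul_zero]

end Tensor

/-- Even Grassmann factors are central, so exchanging p and q changes nothing. At places of equal
parity the exchange also changes the sign, and wpuq equals its own negative. -/
theorem Superalgebra.isEvenLetter [CharZero F] (A : Superalgebra F)
    (hA : A ∈ metabelianJordanSupervariety F) (a : A.carrier) :
    IsEvenLetter {t : A.envelope | ∃ g ∈ GrassmannAlgebra.part F 0,
      (t : GrassmannAlgebra F ⊗[F] A.carrier) = g ⊗ₜ a} where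
  comm := by
    rintro ⟨_, hp⟩ ⟨g, hg, rfl⟩ ⟨_, hq⟩ ⟨h, hh, rfl⟩ w
    exact Subtype.ext (mul_tmul_even_comm a w.1 hg)
  mul_mul := by
    have := isAddTorsionFree_of_field F A.envelope
    rintro p ⟨g, hg, hp⟩ q ⟨h, hh, hq⟩ w hw u
    have hA' : IsMetabelianJordan A.envelope := hA
    have h1 := hA'.mul_mul_mul_comm_neg hw p u q
    have h2 : w * p * u * q = w * q * u * p := by
      apply Subtype.ext
      change (w : GrassmannAlgebra F ⊗[F] A.carrier) * p * u * q = w * q * u * p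
      rw [hp, hq]
      exact mul_tmul_even_mul_comm a w.1 u.1 hg hh
    rw [← h2, eq_neg_iff_add_eq_zero, ← two_nsmul] at h1
    exact (nsmul_right_injective two_ne_zero) (h1.trans (nsmul_zero 2).symm)

/-- A product of more than `r` symmetrized pairs vanishes on the envelope of a superalgebra that is
spanned, modulo its square, by `r` even elements and one odd element. -/
theorem symmetrized_succ_eq_zero_of_span [CharZero F] {A : Superalgebra F}
    (hA : A ∈ metabelianJordanSupervariety F) (r : ℕ) (x : Fin r → A.carrier) (y : A.carrier)
    (hxy : ∀ i, A.part i ≤ Submodule.span F {a | a ∈ A.part i ∧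
      ((i = 0 ∧ ∃ j, a = x j) ∨ (i = 1 ∧ a = y) ∨ ∃ b c, a = b * c)})
    (z : ℕ → A.envelope) : symmetrized z (r + 1) = 0 := by
  have hspan := A.envelope_le_span _ hxy
  have hE : IsMetabelianJordan A.envelope := hA
  have hA4 := mul_mul_mul_eq_zero_of_mem hA
  have := isAddTorsionFree_of_field F A.envelope
  let X : Fin r → Set A.envelope := fun j => {t | ∃ g ∈ GrassmannAlgebra.part F 0,
      (t : GrassmannAlgebra F ⊗[F] A.carrier) = g ⊗ₜ x j}
  -- Tensors with products are counted with the odd letter: they annihilate K, hence anticommute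
  -- trivially on it.
  let Y : Set A.envelope := {t | (∃ g ∈ GrassmannAlgebra.part F 1,
      (t : GrassmannAlgebra F ⊗[F] A.carrier) = g ⊗ₜ y) ∨
      ∃ (g : GrassmannAlgebra F) (b c : A.carrier),
        (t : GrassmannAlgebra F ⊗[F] A.carrier) = g ⊗ₜ (b * c)}
  -- The condition is on all tensors g ⊗ bc, because an element of the envelope of this shape need
  -- not be presented as a product of two elements of the envelope.
  let K : Set A.envelope := {w | ∀ (g : GrassmannAlgebra F) (b c : A.carrier),
      (w : GrassmannAlgebra F ⊗[F] A.carrier) * (g ⊗ₜ (b * c)) = 0}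
  have hKmul : ∀ u v : A.envelope, u * v ∈ K :=
    fun u v g b c => mul_mul_tmul_mul_eq_zero hA4 u.1 v.1 g b c
  have hKkill : ∀ w ∈ K, ∀ p : A.envelope, (∃ (g : GrassmannAlgebra F) (b c : A.carrier),
      (p : GrassmannAlgebra F ⊗[F] A.carrier) = g ⊗ₜ (b * c)) → w * p = 0 := by
    rintro w hw p ⟨g, b, c, hp⟩
    refine Subtype.ext ?_
    change (w : GrassmannAlgebra F ⊗[F] A.carrier) * p = 0
    rw [hp]
    exact hw g b c
  have hT : Submodule.span F (Y ∪ ⋃ j ∈ Finset.univ, X j) = ⊤ := by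
    rw [eq_top_iff]
    intro t _
    have h1 : Submodule.span F {t | ∃ i g a, g ∈ GrassmannAlgebra.part F i ∧
        (a ∈ A.part i ∧ ((i = 0 ∧ ∃ j, a = x j) ∨ (i = 1 ∧ a = y) ∨ ∃ b c, a = b * c)) ∧
          t = g ⊗ₜ a} ≤
        (Submodule.span F (Y ∪ ⋃ j ∈ Finset.univ, X j)).map
          (NonUnitalSubalgebraClass.subtype A.envelope :
            A.envelope →ₗ[F] GrassmannAlgebra F ⊗[F] A.carrier) := by
      rw [Submodule.span_le]
      rintro _ ⟨i, g, a, hg, ⟨ha, h⟩, rfl⟩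
      refine ⟨⟨g ⊗ₜ a, A.tmul_mem_envelope hg ha⟩, Submodule.subset_span ?_, rfl⟩
      rcases h with ⟨rfl, j, rfl⟩ | ⟨rfl, rfl⟩ | ⟨b, c, rfl⟩
      · exact Or.inr (Set.mem_biUnion (Finset.mem_coe.2 (Finset.mem_univ j)) ⟨g, hg, rfl⟩)
      · exact Or.inl (Or.inl ⟨g, hg, rfl⟩)
      · exact Or.inl (Or.inr ⟨g, b, c, rfl⟩)
    obtain ⟨s, hs, hst⟩ := h1 (hspan t.2)
    rwa [← Subtype.ext hst]
  rw [symmetrized_eq_foldl]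
  refine foldl_symMul_eq_zero_of_span _ hT _ _ fun l' hl' hl => ?_
  refine hE.foldl_symMul_eq_zero X (fun j => A.isEvenLetter hA _) Y K
    (fun w hw p q => Subtype.ext (mul_mul_eq_zero_of_tmul hw p.1 q.1)) (fun w hw t => ?_) ?_
    Finset.univ l' hl ?_ _ (hKmul _ _)
  · intro g b c
    refine (add_mul _ _ _).trans ?_
    rw [hKmul, hKmul, add_zero]
  · rintro p (⟨g, hg, hp⟩ | hp) q (⟨h, hh, hq⟩ | hq) w hw
    · apply Subtype.ext
      change (w : GrassmannAlgebra F ⊗[F] A.carrier) * p * q = -(w * q * p)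
      rw [hp, hq]
      exact mul_tmul_odd_comm _ w.1 hg hh
    · rw [hKkill _ (hKmul _ _) q hq, hKkill w hw q hq, zero_mul]
      exact (@neg_zero A.envelope _).symm
    · rw [hKkill w hw p hp, hKkill _ (hKmul _ _) p hp, zero_mul]
      exact (@neg_zero A.envelope _).symm
    · rw [hKkill w hw p hp, hKkill _ (hKmul _ _) p hp, zero_mul]
      exact (@neg_zero A.envelope _).symm
  · rw [hl', List.length_map, List.length_range, Finset.card_univ, Fintype.card_fin]
    exact Nat.lt_succ_self r

theorem symmetrized_succ_eq_zero [CharZero F] (r : ℕ)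
    (z : ℕ → (freeMetabelianJordanSuperalgebra F (generatorParity r 1)).envelope) :
    symmetrized z (r + 1) = 0 := by
  refine symmetrized_succ_eq_zero_of_span (freeMetabelianJordanSuperalgebra_mem F _) r
    (fun j => (metabelianJordanSuperideal F (generatorParity r 1)).toQuot
      (FreeNonUnitalNonAssocAlgebra.of F (.inl j)))
    ((metabelianJordanSuperideal F (generatorParity r 1)).toQuot
      (FreeNonUnitalNonAssocAlgebra.of F (.inr 0)))
    (fun i => (freeMetabelianJordanSuperalgebra_part_le_span _ i).trans (Submodule.span_mono ?_)) z
  rintro a ⟨ha, ⟨x | x, hx, rfl⟩ | h⟩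
  · exact ⟨ha, Or.inl ⟨hx.symm, x, rfl⟩⟩
  · refine ⟨ha, Or.inr (Or.inl ⟨hx.symm, ?_⟩)⟩
    rw [Subsingleton.elim x 0]
  · exact ⟨ha, Or.inr (Or.inr h)⟩

end OneOdd

/-! ### Nilpotency and superidentities -/

section Nilpotency

variable {F : Type u} [Field F]

theorem FreeMagma.lift_comp {X Y B : Type*} [Mul B] (z : Y → B) (e : X → Y) (w : FreeMagma X) :
    FreeMagma.lift (fun x => z (e x)) w = FreeMagma.lift z (FreeMagma.map e w) := by
  induction w using FreeMagma.rec with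
  | of x => rfl
  | mul v w hv hw =>
    exact (FreeMagma.lift_mul' _ v w).trans ((congrArg₂ _ hv hw).trans
      (FreeMagma.lift_mul' z (FreeMagma.map e v) (FreeMagma.map e w)).symm)

theorem AlgIdeal.span_lift_eq_top {X : Type} (J : AlgIdeal F (FreeNonUnitalNonAssocAlgebra F X)) :
    Submodule.span F (Set.range fun w : FreeMagma X =>
      FreeMagma.lift (fun x => J.toQuot (FreeNonUnitalNonAssocAlgebra.of F x)) w) = ⊤ := by
  rw [eq_top_iff]
  intro a _
  obtain ⟨f, rfl⟩ := J.toQuot_surjective a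
  rw [J.toQuot_eq_lift, FreeNonUnitalNonAssocAlgebra.lift_eq_sum]
  exact Submodule.sum_mem _ fun w _ => Submodule.smul_mem _ _ (Submodule.subset_span ⟨w, rfl⟩)

/-- Quotients of the free nonassociative algebra on `n` generators that are metabelian Jordan
algebras are nilpotent. -/
theorem AlgIdeal.lift_id_eq_zero [CharZero F] {X : Type} {n : ℕ} (e : X ≃ Fin n)
    (J : AlgIdeal F (FreeNonUnitalNonAssocAlgebra F X)) (hJ : IsMetabelianJordan J.Quot)
    (w : FreeMagma J.Quot) (hw : 2 * n + 2 ≤ w.length) :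
    FreeMagma.lift (id : J.Quot → J.Quot) w = 0 := by
  have := isAddTorsionFree_of_field F J.Quot
  refine hJ.lift_id_eq_zero F
    (fun i => J.toQuot (FreeNonUnitalNonAssocAlgebra.of F (e.symm i))) ?_ w hw
  rw [eq_top_iff, ← J.span_lift_eq_top]
  refine Submodule.span_mono ?_
  rintro _ ⟨w, rfl⟩
  refine ⟨FreeMagma.map e w, ?_⟩
  refine (FreeMagma.lift_comp _ e w).symm.trans ?_
  simp only [Equiv.symm_apply_apply]

theorem lift_id_tmul_mem_span {A : Type*} [NonUnitalNonAssocRing A] [Module F A]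
    [IsScalarTower F A A] [SMulCommClass F A A] (w : FreeMagma (GrassmannAlgebra F ⊗[F] A)) :
    FreeMagma.lift (id : GrassmannAlgebra F ⊗[F] A → _) w ∈ Submodule.span F
      {t | ∃ (g : GrassmannAlgebra F) (v : FreeMagma A), v.length = w.length ∧
        t = g ⊗ₜ FreeMagma.lift (id : A → A) v} := by
  induction w using FreeMagma.rec with
  | of t =>
    change t ∈ _
    induction t using TensorProduct.induction_on with
    | zero => exact Submodule.zero_mem _
    | add x y hx hy => exact Submodule.add_mem _ hx hy
    | tmul g a => exact Submodule.subset_span ⟨g, FreeMagma.of a, rfl, rfl⟩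
  | mul v w hv hw =>
    rw [FreeMagma.lift_mul']
    generalize FreeMagma.lift (id : GrassmannAlgebra F ⊗[F] A → _) v = s at hv
    generalize FreeMagma.lift (id : GrassmannAlgebra F ⊗[F] A → _) w = t at hw
    induction hv using Submodule.span_induction with
    | mem s hs =>
      obtain ⟨g, v', hv', rfl⟩ := hs
      induction hw using Submodule.span_induction with
      | mem t ht =>
        obtain ⟨h, w', hw', rfl⟩ := ht
        refine Submodule.subset_span ⟨g * h, FreeMagma.mul v' w', congrArg₂ _ hv' hw', ?_⟩
        rw [Algebra.TensorProduct.tmul_mul_tmul, FreeMagma.lift_mul']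
      | zero => rw [mul_zero]; exact Submodule.zero_mem _
      | add a b _ _ ha hb => rw [mul_add]; exact Submodule.add_mem _ ha hb
      | smul c a _ ha => rw [mul_smul_comm]; exact Submodule.smul_mem _ c ha
    | zero => rw [zero_mul]; exact Submodule.zero_mem _
    | add a b _ _ ha hb => rw [add_mul]; exact Submodule.add_mem _ ha hb
    | smul c a _ ha => rw [smul_mul_assoc]; exact Submodule.smul_mem _ c ha

theorem FreeMagma.length_map {X Y : Type*} (e : X → Y) (w : FreeMagma X) :
    (FreeMagma.map e w).length = w.length := by
  induction w using FreeMagma.rec with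
  | of x => rfl
  | mul v w hv hw => exact congrArg₂ _ hv hw

/-- A superalgebra all products of `n` elements of which vanish satisfies all superidentities of
degree `n`. -/
theorem Superalgebra.satisfiesSuperidentity_of_lift_id_eq_zero (A : Superalgebra F) {n : ℕ}
    (hA : ∀ w : FreeMagma A.carrier, w.length = n → FreeMagma.lift (id : A.carrier → _) w = 0)
    {f : FreeNonUnitalNonAssocAlgebra F (Fin n)} (hf : IsMultilinearPoly f) :
    A.SatisfiesSuperidentity f := by
  intro a
  apply Subtype.ext
  refine (FreeNonUnitalNonAssocAlgebra.map_lift (NonUnitalSubalgebraClass.subtype A.envelope)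
    a f).trans ?_
  rw [FreeNonUnitalNonAssocAlgebra.lift_eq_sum]
  refine Finset.sum_eq_zero fun w hw => ?_
  have hlen : w.length = n := by
    rw [← FreeMagma.card_letters, hf w hw, Finset.card_val, Finset.card_univ, Fintype.card_fin]
  have h0 := lift_id_tmul_mem_span (FreeMagma.map
    (fun i => (a i : GrassmannAlgebra F ⊗[F] A.carrier)) w)
  rw [← FreeMagma.lift_comp, FreeMagma.length_map, hlen] at h0
  have h1 : Submodule.span F {t | ∃ (g : GrassmannAlgebra F) (v : FreeMagma A.carrier),
      v.length = n ∧ t = g ⊗ₜ[F] FreeMagma.lift (id : A.carrier → A.carrier) v} ≤ ⊥ := by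
    rw [Submodule.span_le]
    rintro _ ⟨g, v, hv, rfl⟩
    rw [hA v hv, TensorProduct.tmul_zero]
    exact Submodule.zero_mem _
  have h2 := (Submodule.mem_bot F).1 (h1 h0)
  refine (congrArg _ h2).trans (smul_zero _)

/-- A metabelian Jordan superalgebra without odd elements is a metabelian Jordan algebra. -/
theorem isMetabelianJordan_of_part_eq_top {A : Superalgebra F}
    (hA : A ∈ metabelianJordanSupervariety F) (h0 : ∀ a, a ∈ A.part 0) :
    IsMetabelianJordan A.carrier := by
  have h := (isMetabelianJordan_coe_iff _).1 hA
  have hmem : ∀ a, (1 : GrassmannAlgebra F) ⊗ₜ[F] a ∈ A.envelope :=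
    fun a => A.tmul_mem_envelope GrassmannAlgebra.one_mem_part (h0 a)
  have hinj : ∀ a b : A.carrier, (1 : GrassmannAlgebra F) ⊗ₜ[F] a = 1 ⊗ₜ b → a = b := by
    intro a b hab
    by_contra hne
    refine GrassmannAlgebra.tmul_ne_zero (F := F) (one_ne_zero) (sub_ne_zero.2 hne) ?_
    rw [TensorProduct.tmul_sub, hab, sub_self]
  refine ⟨fun x y => hinj _ _ ?_, fun x y => hinj _ _ ?_, mul_mul_mul_eq_zero_of_mem hA⟩
  · simpa only [Algebra.TensorProduct.tmul_mul_tmul, mul_one] using h.1 _ (hmem x) _ (hmem y)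
  · simpa only [Algebra.TensorProduct.tmul_mul_tmul, mul_one] using h.2.1 _ (hmem x) _ (hmem y)

theorem isMetabelianJordan_of_generatorParity_zero [CharZero F] (r : ℕ) :
    IsMetabelianJordan (freeMetabelianJordanSuperalgebra F (generatorParity r 0)).carrier := by
  refine isMetabelianJordan_of_part_eq_top (freeMetabelianJordanSuperalgebra_mem F _) fun a => ?_
  obtain ⟨f, rfl⟩ := AlgIdeal.toQuot_surjective _ a
  refine ⟨f, ?_, rfl⟩
  have h1 : freePart F (generatorParity r 0) 1 = ⊥ := by
    rw [freePart, Submodule.span_eq_bot]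
    rintro _ ⟨w, hw, -⟩
    have : generatorParity r 0 = fun _ => 0 := by
      funext x
      rcases x with x | x
      · rfl
      · exact x.elim0
    simp [wordParity, this] at hw
  have h := freePart_sup_eq_top F (generatorParity r 0)
  rw [h1, sup_bot_eq] at h
  exact h ▸ Submodule.mem_top

/-- Without odd generators the free superalgebra is an ordinary metabelian Jordan algebra on r
generators, so all its products of length 2r+2 vanish. -/
theorem satisfiesSuperidentity_of_generatorParity_zero [CharZero F] (r : ℕ)
    {f : FreeNonUnitalNonAssocAlgebra F (Fin (2 * r + 2))} (hf : IsMultilinearPoly f) :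
    (freeMetabelianJordanSuperalgebra F (generatorParity r 0)).SatisfiesSuperidentity f :=
  Superalgebra.satisfiesSuperidentity_of_lift_id_eq_zero _
    (fun w hw => AlgIdeal.lift_id_eq_zero (Equiv.sumEmpty (Fin r) (Fin 0)) _
      (isMetabelianJordan_of_generatorParity_zero r) w hw.ge) hf

end Nilpotency

/-! ### Nonzero products -/

section GrassmannModel

variable {F : Type u} [Field F]

-- The word is x₀x₀·x₀x₁·x₁x₂⋯xᵢ₋₁xᵢ; truncated subtraction makes its first letter x₀. Its letters
-- from the second on contribute the Grassmann generators 0, 1, …, 2i, each once, and c = 2 comes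
-- from the initial square.
open GrassmannModel GrassmannAlgebra in
theorem leftNormed_letter [CharZero F] (i : ℕ) : ∃ (c : F) (l : List ℕ), c ≠ 0 ∧ l.Nodup ∧
    (∀ x ∈ l, x < 2 * i + 1) ∧ leftNormed (fun m => letter F ((m - 1) / 2)) (2 * i + 1) =
      square F (c • (l.map (gen F)).prod) := by
  induction i with
  | zero =>
    refine ⟨2, [0], two_ne_zero, List.nodup_singleton _, by simp, ?_⟩
    refine (letter_mul_letter F 0).trans ?_
    simp
  | succ i ih =>
    obtain ⟨c, l, hc, hl, hlt, he⟩ := ih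
    refine ⟨c, l ++ [2 * i + 1, 2 * i + 2], hc, ?_, ?_, ?_⟩
    · rw [List.nodup_append]
      refine ⟨hl, by simp, ?_⟩
      intro x hx y hy
      have := hlt x hx
      simp only [List.mem_cons, List.not_mem_nil, or_false] at hy
      omega
    · intro x hx
      rw [List.mem_append] at hx
      rcases hx with hx | hx
      · have := hlt x hx
        omega
      · simp only [List.mem_cons, List.not_mem_nil, or_false] at hx
        omega
    · rw [show 2 * (i + 1) + 1 = 2 * i + 1 + 1 + 1 by ring, leftNormed, leftNormed, he,
        show (2 * i + 1 + 1 - 1) / 2 = i by omega, show (2 * i + 1 + 1 + 1 - 1) / 2 = i + 1 by omega,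
        mul_letter_mul_letter]
      congr 1
      simp [mul_assoc, mul_add]

theorem leftNormed_letter_ne_zero [CharZero F] (i : ℕ) :
    leftNormed (fun m => GrassmannModel.letter F ((m - 1) / 2)) (2 * i + 1) ≠ 0 := by
  obtain ⟨c, l, hc, hl, -, he⟩ := leftNormed_letter (F := F) i
  rw [he]
  intro h
  rcases smul_eq_zero.1 (GrassmannModel.square_eq_zero F h) with h | h
  · exact hc h
  · exact GrassmannAlgebra.prod_gen_ne_zero l hl h

theorem GrassmannModel.square_add_self (g : GrassmannAlgebra F) :
    square F g + square F g = square F ((2 : F) • g) := by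
  rw [square, square, ← map_add, two_smul]
  congr 1
  simp

/-- The values in which products of symmetrized pairs do not vanish. -/
def symmetrizedPoint (F : Type u) [Field F] (r m : ℕ) : GrassmannModel F :=
  if m = 1 then GrassmannModel.letter F (r + 1) else GrassmannModel.letter F ((m - 2) / 2)

-- The word is x₀xᵣ₊₁{x₀,x₀}{x₁,x₁}⋯, with first letter x₀ again by truncated subtraction. The
-- initial product gives the generator 2(r+1), and the pair of x_k gives twice the product of 2k+1
-- and 2k, so no generator repeats.
open GrassmannModel GrassmannAlgebra in
theorem symmetrized_symmetrizedPoint [CharZero F] (r k : ℕ) (hk : k ≤ r + 1) :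
    ∃ (c : F) (l : List ℕ), c ≠ 0 ∧ l.Nodup ∧
      (∀ x ∈ l, x < 2 * k ∨ x = 2 * (r + 1)) ∧ symmetrized (symmetrizedPoint F r) k =
        square F (c • (l.map (gen F)).prod) := by
  induction k with
  | zero =>
    refine ⟨1, [2 * (r + 1)], one_ne_zero, List.nodup_singleton _, by simp, ?_⟩
    refine (letter_mul_letter F (r + 1)).trans ?_
    simp
  | succ k ih =>
    obtain ⟨c, l, hc, hl, hlt, he⟩ := ih (by omega)
    refine ⟨2 * c, l ++ [2 * k + 1, 2 * k], mul_ne_zero two_ne_zero hc, ?_, ?_, ?_⟩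
    · rw [List.nodup_append]
      refine ⟨hl, by simp, ?_⟩
      intro x hx y hy
      have := hlt x hx
      simp only [List.mem_cons, List.not_mem_nil, or_false] at hy
      omega
    · intro x hx
      rw [List.mem_append] at hx
      rcases hx with hx | hx
      · have := hlt x hx
        omega
      · simp only [List.mem_cons, List.not_mem_nil, or_false] at hx
        omega
    · have h2 : symmetrizedPoint F r (2 * k + 2) = letter F k := by
        rw [symmetrizedPoint, if_neg (by omega)]
        congr 1; omega
      have h3 : symmetrizedPoint F r (2 * k + 3) = letter F k := by
        rw [symmetrizedPoint, if_neg (by omega)]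
        congr 1; omega
      rw [symmetrized, he, h2, h3, symMul, mul_letter_mul_letter]
      rw [square_add_self]
      congr 1
      simp [mul_assoc, mul_smul]

theorem symmetrized_symmetrizedPoint_ne_zero [CharZero F] (r : ℕ) :
    symmetrized (symmetrizedPoint F r) (r + 1) ≠ 0 := by
  obtain ⟨c, l, hc, hl, -, he⟩ := symmetrized_symmetrizedPoint (F := F) r (r + 1) le_rfl
  rw [he]
  intro h
  rcases smul_eq_zero.1 (GrassmannModel.square_eq_zero F h) with h | h
  · exact hc h
  · exact GrassmannAlgebra.prod_gen_ne_zero l hl h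

end GrassmannModel

/-- The free metabelian Jordan algebra on `n` generators is nilpotent of index `2n + 2`. -/
theorem isNilpotentOfIndex_freeMetabelianJordanAlgebra (F : Type u) [Field F] [CharZero F] (n : ℕ)
    (hn : 1 ≤ n) : IsNilpotentOfIndex (FreeMetabelianJordanAlgebra F (Fin n)) (2 * n + 2) := by
  refine ⟨⟨by omega, fun w hw => AlgIdeal.lift_id_eq_zero (Equiv.refl _) _
    (FreeMetabelianJordanAlgebra.isMetabelianJordan F _) w hw.ge⟩, ?_⟩
  rintro m ⟨hm1, hm⟩
  by_contra! hlt
  have : NeZero n := ⟨by omega⟩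
  obtain ⟨k, rfl⟩ : ∃ k, m = k + 1 := ⟨m - 1, by omega⟩
  let J := metabelianJordanIdeal F (Fin n)
  let c : ℕ → Fin n := fun i => Fin.ofNat n ((i - 1) / 2)
  let f : ℕ → FreeNonUnitalNonAssocAlgebra F (Fin n) := fun i =>
    FreeNonUnitalNonAssocAlgebra.of F (c i)
  have hlen : ∀ k, (leftNormed (fun i => FreeMagma.of (J.toQuot (f i))) k).length = k + 1 := by
    intro k
    induction k with
    | zero => rfl
    | succ k ih => exact congrArg (· + 1) ih
  have h1 := hm _ (hlen k)
  rw [map_leftNormed _ (FreeMagma.lift_mul' _)] at h1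
  change leftNormed (fun i => J.toQuot (f i)) k = 0 at h1
  rw [← map_leftNormed _ J.toQuot_mul, AlgIdeal.toQuot_eq_zero] at h1
  have h2 := h1 (GrassmannModel F) (GrassmannModel.isMetabelianJordan F)
    (fun j => GrassmannModel.letter F j)
  rw [map_leftNormed _ (map_mul _)] at h2
  simp only [f, FreeNonUnitalNonAssocAlgebra.lift_of_apply] at h2
  -- If the word vanished at a length below 2n+2, all its prolongations would vanish, in particular
  -- the one of length 2n+1.
  have h3 : ∀ d, leftNormed (fun i => GrassmannModel.letter F (c i)) (k + d) = 0 := by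
    intro d
    induction d with
    | zero => exact h2
    | succ d ih => rw [← add_assoc, leftNormed, ih, zero_mul]
  have h4 := h3 (2 * n - k)
  rw [show k + (2 * n - k) = 2 * n by omega] at h4
  -- The nonzero word of length 2n+2 uses the additional letter number n only in its last place; its
  -- prefix of length 2n+1 is a word in the n generators.
  refine leftNormed_letter_ne_zero (F := F) n ?_
  rw [leftNormed]
  refine (congrArg (· * _) ((leftNormed_congr fun i hi => ?_).trans h4)).trans (zero_mul _)
  simp only [c, Fin.val_ofNat]
  rw [Nat.mod_eq_of_lt (by omega)]

/-! ### Inclusions between the supervarieties -/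

section Inclusions

variable {F : Type u} [Field F]

/-- A retract of a superalgebra satisfies all of its superidentities. -/
theorem Superalgebra.SatisfiesSuperidentity.of_retract {A B : Superalgebra F} {n : ℕ}
    {f : FreeNonUnitalNonAssocAlgebra F (Fin n)} (hf : A.SatisfiesSuperidentity f)
    (φ : A.carrier →ₙₐ[F] B.carrier) (hφ : ∀ i, ∀ a ∈ A.part i, φ a ∈ B.part i)
    (ψ : B.carrier →ₙₐ[F] A.carrier) (hψ : ∀ i, ∀ b ∈ B.part i, ψ b ∈ A.part i)
    (h : ∀ b, φ (ψ b) = b) : B.SatisfiesSuperidentity f := by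
  intro x
  refine hf.lift_eq_zero φ hφ x fun i => ⟨envelopeMap ψ hψ (x i), Subtype.ext ?_⟩
  rw [coe_envelopeMap, coe_envelopeMap]
  generalize (x i : GrassmannAlgebra F ⊗[F] B.carrier) = t
  induction t using TensorProduct.induction_on with
  | zero => rw [map_zero, map_zero]
  | add s t hs ht => rw [map_add, map_add, hs, ht]
  | tmul g b => rw [grassmannMap_tmul, grassmannMap_tmul, h]

/-- The free superalgebra on fewer generators is a retract of the larger one: the superfluous
generators are sent to 0. -/
theorem Superalgebra.SatisfiesSuperidentity.of_injective [CharZero F] {X Y : Type}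
    {p : X → ZMod 2} {q : Y → ZMod 2} (e : X → Y) (he : Function.Injective e)
    (hpq : ∀ x, q (e x) = p x) {n : ℕ} {f : FreeNonUnitalNonAssocAlgebra F (Fin n)}
    (hf : (freeMetabelianJordanSuperalgebra F q).SatisfiesSuperidentity f) :
    (freeMetabelianJordanSuperalgebra F p).SatisfiesSuperidentity f := by
  have hgen : ∀ {X : Type} (p : X → ZMod 2) (x : X),
      (metabelianJordanSuperideal F p).toQuot (FreeNonUnitalNonAssocAlgebra.of F x) ∈
        (freeMetabelianJordanSuperalgebra F p).part (p x) := fun p x =>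
    ⟨_, Submodule.subset_span ⟨FreeMagma.of x, by simp [wordParity, FreeMagma.letters], rfl⟩, rfl⟩
  let u : X → (freeMetabelianJordanSuperalgebra F p).carrier :=
    fun x => (metabelianJordanSuperideal F p).toQuot (FreeNonUnitalNonAssocAlgebra.of F x)
  let z : Y → (freeMetabelianJordanSuperalgebra F p).carrier := Function.extend e u fun _ => 0
  have hz : ∀ y, z y ∈ (freeMetabelianJordanSuperalgebra F p).part (q y) := by
    intro y
    by_cases hy : ∃ x, e x = y
    · obtain ⟨x, rfl⟩ := hy
      rw [hpq]
      simp only [z, he.extend_apply]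
      exact hgen p x
    · simp only [z, Function.extend_apply' _ _ _ hy]
      exact Submodule.zero_mem _
  let z' : X → (freeMetabelianJordanSuperalgebra F q).carrier :=
    fun x => (metabelianJordanSuperideal F q).toQuot (FreeNonUnitalNonAssocAlgebra.of F (e x))
  have hz' : ∀ x, z' x ∈ (freeMetabelianJordanSuperalgebra F q).part (p x) :=
    fun x => hpq x ▸ hgen q (e x)
  have hA := freeMetabelianJordanSuperalgebra_mem F p
  have hB := freeMetabelianJordanSuperalgebra_mem F q
  refine hf.of_retract (freeSuperLift hA z hz) (freeSuperLift_mem_part hA z hz)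
    (freeSuperLift hB z' hz') (freeSuperLift_mem_part hB z' hz') fun b => ?_
  obtain ⟨b, rfl⟩ := AlgIdeal.toQuot_surjective _ b
  rw [freeSuperLift_toQuot, FreeNonUnitalNonAssocAlgebra.map_lift]
  refine Eq.trans ?_ (AlgIdeal.toQuot_eq_lift _ b).symm
  congr 2
  funext x
  refine (freeSuperLift_toQuot hA z hz _).trans ?_
  rw [FreeNonUnitalNonAssocAlgebra.lift_of_apply]
  exact he.extend_apply _ _ _

theorem satisfiesSuperidentity_of_le [CharZero F] {r s r' s' : ℕ} (hr : r ≤ r') (hs : s ≤ s')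
    {n : ℕ} {f : FreeNonUnitalNonAssocAlgebra F (Fin n)}
    (hf : (freeMetabelianJordanSuperalgebra F (generatorParity r' s')).SatisfiesSuperidentity f) :
    (freeMetabelianJordanSuperalgebra F (generatorParity r s)).SatisfiesSuperidentity f := by
  refine hf.of_injective (Sum.map (Fin.castLE hr) (Fin.castLE hs))
    ((Fin.castLE_injective hr).sumMap (Fin.castLE_injective hs)) ?_
  rintro (x | x) <;> rfl

theorem metabelianJordanSupervarietyOfRank_ssubset [CharZero F] {r s r' s' : ℕ} (hr : r ≤ r')
    (hs : s ≤ s') {n : ℕ} {f : FreeNonUnitalNonAssocAlgebra F (Fin n)} (hf : IsMultilinearPoly f)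
    (h : (freeMetabelianJordanSuperalgebra F (generatorParity r s)).SatisfiesSuperidentity f)
    (h' : ¬ (freeMetabelianJordanSuperalgebra F (generatorParity r' s')).SatisfiesSuperidentity f) :
    metabelianJordanSupervarietyOfRank F r s ⊂ metabelianJordanSupervarietyOfRank F r' s' := by
  have hsub : metabelianJordanSupervarietyOfRank F r s ⊆
      metabelianJordanSupervarietyOfRank F r' s' :=
    fun B hB n f hf h => hB n f hf (satisfiesSuperidentity_of_le hr hs h)
  rw [Set.ssubset_iff_of_subset hsub]
  exact ⟨freeMetabelianJordanSuperalgebra F (generatorParity r' s'), fun _ _ _ h => h,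
    fun hmem => h' (hmem n f hf h)⟩

end Inclusions

/-! ### Superidentities that fail -/

section Failing

variable {F : Type u} [Field F]

namespace oddExtension

variable (F) (H : Type u) [NonUnitalNonAssocRing H] [Module F H]
  [IsScalarTower F H H] [SMulCommClass F H H]

/-- The embeddings of `H` into the even and the odd part of `H + εH`. -/
def incl (i : ZMod 2) : H →ₗ[F] (oddExtension F H).carrier := oddExtensionIncl F H i

theorem incl_mem_part (i : ZMod 2) (a : H) : incl F H i a ∈ (oddExtension F H).part i := ⟨a, rfl⟩

theorem incl_zero_mul (i : ZMod 2) (a b : H) :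
    incl F H 0 a * incl F H i b = incl F H i (a * b) := by
  refine (oddExtensionIncl_mul F H 0 i a b).trans ?_
  rw [if_neg (by simp), zero_add]; rfl

theorem incl_mul_zero (i : ZMod 2) (a b : H) :
    incl F H i a * incl F H 0 b = incl F H i (a * b) := by
  refine (oddExtensionIncl_mul F H i 0 a b).trans ?_
  rw [if_neg (by simp), add_zero]; rfl

theorem incl_ne_zero (i : ZMod 2) {a : H} (ha : a ≠ 0) : incl F H i a ≠ 0 := by
  intro h
  refine ha ?_
  have h' : oddExtensionIncl F H i a = BilinearAlgebra.mk (oddExtensionMul F H) 0 := h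
  rcases ZMod.eq_zero_or_eq_one i with rfl | rfl
  · exact congrArg Prod.fst ((BilinearAlgebra.mk (oddExtensionMul F H)).injective h')
  · exact congrArg Prod.snd ((BilinearAlgebra.mk (oddExtensionMul F H)).injective h')

end oddExtension

/-- Superidentities of a free superalgebra hold for arbitrary Grassmann multiples of
homogeneous elements of the respective parities. -/
theorem Superalgebra.SatisfiesSuperidentity.lift_tmul_eq_zero {X : Type} {p : X → ZMod 2} {n : ℕ}
    {f : FreeNonUnitalNonAssocAlgebra F (Fin n)}
    (hf : (freeMetabelianJordanSuperalgebra F p).SatisfiesSuperidentity f) {B : Superalgebra F}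
    (hB : B ∈ metabelianJordanSupervariety F) (z : X → B.carrier) (hz : ∀ x, z x ∈ B.part (p x))
    (c : Fin n → X) (g : Fin n → GrassmannAlgebra F)
    (hg : ∀ i, g i ∈ GrassmannAlgebra.part F (p (c i))) :
    FreeNonUnitalNonAssocAlgebra.lift F (fun i => g i ⊗ₜ[F] z (c i)) f = 0 := by
  have h := hf.lift_eq_zero (freeSuperLift hB z hz) (freeSuperLift_mem_part hB z hz)
    (fun i => ⟨g i ⊗ₜ z (c i), B.tmul_mem_envelope (hg i) (hz _)⟩)
    fun i => mem_range_envelopeMap hB z hz (c i) (g i) (hg i)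
  have h1 := FreeNonUnitalNonAssocAlgebra.map_lift (NonUnitalSubalgebraClass.subtype B.envelope)
    (fun i => (⟨g i ⊗ₜ z (c i), B.tmul_mem_envelope (hg i) (hz _)⟩ : B.envelope)) f
  rw [h, map_zero] at h1
  exact h1.symm

open oddExtension

/-- All letters but the last are even. The parity of y is left open, so that one argument separates
rank (r,0) both from (r+1,0) and, when r ≥ 1, from (r,1). -/
theorem not_satisfiesSuperidentity_leftNormedPoly [CharZero F] {X : Type} {p : X → ZMod 2} (r : ℕ)
    (x : ℕ → X) (y : X) (hx : ∀ i, p (x i) = 0) (l : X → ℕ) (hlx : ∀ i ≤ 2 * r, l (x i) = (i - 1) / 2)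
    (hly : l y = r) :
    ¬ (freeMetabelianJordanSuperalgebra F p).SatisfiesSuperidentity (leftNormedPoly F (2 * r + 1)) := by
  intro hf
  let H := GrassmannModel F
  let g : ZMod 2 → GrassmannAlgebra F := fun i => if i = 0 then 1 else GrassmannAlgebra.gen F 0
  have hg : ∀ i, g i ∈ GrassmannAlgebra.part F i ∧ g i ≠ 0 := by
    intro i
    rcases ZMod.eq_zero_or_eq_one i with rfl | rfl
    · exact ⟨GrassmannAlgebra.one_mem_part, one_ne_zero⟩
    · refine ⟨GrassmannAlgebra.gen_mem_part 0, ?_⟩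
      change GrassmannAlgebra.gen F 0 ≠ 0
      simpa using GrassmannAlgebra.prod_gen_ne_zero (F := F) [0] (List.nodup_singleton 0)
  let c : ℕ → X := fun i => if i = 2 * r + 1 then y else x i
  let z : X → (oddExtension F H).carrier := fun x => incl F H (p x) (GrassmannModel.letter F (l x))
  have h := hf.lift_tmul_eq_zero (oddExtension_mem (F := F) (H := H) (GrassmannModel.isMetabelianJordan F)) z
    (fun x => incl_mem_part F H _ _) (fun i => c i) (fun i => g (p (c i))) fun i => (hg _).1
  have h1 : leftNormed (fun i => g (p (c i)) ⊗ₜ[F] z (c i)) (2 * r + 1) = 0 :=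
    (lift_leftNormedPoly _ _).symm.trans h
  rw [leftNormed] at h1
  have h2 : leftNormed (fun i => g (p (c i)) ⊗ₜ[F] z (c i)) (2 * r) = 1 ⊗ₜ[F] incl F H 0
      (leftNormed (fun m => GrassmannModel.letter F ((m - 1) / 2)) (2 * r)) := by
    rw [map_leftNormed (fun a : H => (1 : GrassmannAlgebra F) ⊗ₜ[F] incl F H 0 a)]
    · refine leftNormed_congr fun i hi => ?_
      have : c i = x i := if_neg (by omega)
      simp only [this, hx, z, hlx i hi]
      rfl
    · intro a b
      rw [Algebra.TensorProduct.tmul_mul_tmul, incl_zero_mul, one_mul]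
  have h3 : c (2 * r + 1) = y := if_pos rfl
  rw [h2, h3, Algebra.TensorProduct.tmul_mul_tmul, incl_zero_mul, one_mul, hly] at h1
  refine GrassmannAlgebra.tmul_ne_zero (hg _).2 (incl_ne_zero F H _ ?_) h1
  have h4 := leftNormed_letter_ne_zero (F := F) r
  rw [leftNormed, show (2 * r + 1 - 1) / 2 = r by omega] at h4
  exact h4

/-- The odd generator enters once, as second letter, and only carries the value into εH; the
nonvanishing is that of the `GrassmannModel`. -/
theorem not_satisfiesSuperidentity_symmetrizedPoly [CharZero F] (r : ℕ) :
    ¬ (freeMetabelianJordanSuperalgebra F (generatorParity (r + 1) 1)).SatisfiesSuperidentity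
      (symmetrizedPoly F (r + 1)) := by
  intro hf
  let H := GrassmannModel F
  let l : Fin (r + 1) ⊕ Fin 1 → ℕ := Sum.elim (fun i => i) fun _ => r + 1
  let c : ℕ → Fin (r + 1) ⊕ Fin 1 := fun i =>
    if i = 1 then .inr 0 else .inl (Fin.ofNat (r + 1) ((i - 2) / 2))
  let g : ℕ → GrassmannAlgebra F := fun i => if i = 1 then GrassmannAlgebra.gen F 0 else 1
  let z : Fin (r + 1) ⊕ Fin 1 → (oddExtension F H).carrier := fun x =>
    incl F H (generatorParity (r + 1) 1 x) (GrassmannModel.letter F (l x))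
  have hg : ∀ i, g i ∈ GrassmannAlgebra.part F (generatorParity (r + 1) 1 (c i)) := by
    intro i
    by_cases hi : i = 1
    · simp only [g, c, if_pos hi]
      exact GrassmannAlgebra.gen_mem_part 0
    · simp only [g, c, if_neg hi]
      exact GrassmannAlgebra.one_mem_part
  have h := hf.lift_tmul_eq_zero (oddExtension_mem (F := F) (H := H) (GrassmannModel.isMetabelianJordan F)) z
    (fun x => incl_mem_part F H _ _) (fun i => c i) (fun i => g i) fun i => hg i
  have h1 : symmetrized (fun i => g i ⊗ₜ[F] z (c i)) (r + 1) = 0 :=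
    (lift_symmetrizedPoly _ _).symm.trans h
  have hz1 : g 1 ⊗ₜ[F] z (c 1) = GrassmannAlgebra.gen F 0 ⊗ₜ[F] incl F H 1 (symmetrizedPoint F r 1) :=
    rfl
  have hz : ∀ i < 2 * (r + 1) + 2, i ≠ 1 →
      g i ⊗ₜ[F] z (c i) = 1 ⊗ₜ[F] incl F H 0 (symmetrizedPoint F r i) := by
    intro i hi hi1
    have h2 : Fin.ofNat (r + 1) ((i - 2) / 2) = ⟨(i - 2) / 2, by omega⟩ :=
      Fin.ext (Nat.mod_eq_of_lt (by omega))
    simp only [g, c, symmetrizedPoint, if_neg hi1, h2]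
    rfl
  have h2 : ∀ k ≤ r + 1, symmetrized (fun i => g i ⊗ₜ[F] z (c i)) k =
      GrassmannAlgebra.gen F 0 ⊗ₜ[F] incl F H 1 (symmetrized (symmetrizedPoint F r) k) := by
    intro k hk
    induction k with
    | zero =>
      simp only [symmetrized]
      rw [hz1, hz 0 (by omega) (by omega), Algebra.TensorProduct.tmul_mul_tmul, incl_zero_mul,
        one_mul]
    | succ k ih =>
      simp only [symmetrized, symMul]
      rw [ih (by omega), hz _ (by omega) (by omega), hz _ (by omega) (by omega)]
      simp only [Algebra.TensorProduct.tmul_mul_tmul, incl_mul_zero, mul_one]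
      rw [← TensorProduct.tmul_add, ← map_add]
  rw [h2 _ le_rfl] at h1
  refine GrassmannAlgebra.tmul_ne_zero ?_ (incl_ne_zero F H _
    (symmetrized_symmetrizedPoint_ne_zero r)) h1
  simpa using GrassmannAlgebra.prod_gen_ne_zero (F := F) [0] (List.nodup_singleton 0)

theorem satisfiesSuperidentity_symmetrizedPoly [CharZero F] (r : ℕ) :
    (freeMetabelianJordanSuperalgebra F (generatorParity r 1)).SatisfiesSuperidentity
      (symmetrizedPoly F (r + 1)) := by
  intro x
  have h := symmetrized_succ_eq_zero r fun i => x (Fin.ofNat (2 * (r + 1) + 2) i)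
  refine Eq.trans ?_ ((lift_symmetrizedPoly (F := F) _ _).trans h)
  congr 2
  funext i
  exact congrArg x (Fin.ext (Nat.mod_eq_of_lt i.2).symm)

theorem metabelianJordanSupervarietyOfRank_zero_ssubset_succ [CharZero F] (r : ℕ) :
    metabelianJordanSupervarietyOfRank F r 0 ⊂ metabelianJordanSupervarietyOfRank F (r + 1) 0 := by
  refine metabelianJordanSupervarietyOfRank_ssubset (Nat.le_succ r) le_rfl
    (isMultilinearPoly_leftNormedPoly F (2 * r + 1))
    (satisfiesSuperidentity_of_generatorParity_zero r (isMultilinearPoly_leftNormedPoly F _))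
    (not_satisfiesSuperidentity_leftNormedPoly r
      (fun i => .inl (Fin.ofNat (r + 1) ((i - 1) / 2))) (.inl (Fin.last r)) (fun _ => rfl)
      (Sum.elim (fun i => i) fun _ => 0) (fun i hi => ?_) rfl)
  exact Nat.mod_eq_of_lt (by omega)

theorem metabelianJordanSupervarietyOfRank_one_ssubset_succ [CharZero F] (r : ℕ) :
    metabelianJordanSupervarietyOfRank F r 1 ⊂ metabelianJordanSupervarietyOfRank F (r + 1) 1 :=
  metabelianJordanSupervarietyOfRank_ssubset (Nat.le_succ r) le_rfl
    (isMultilinearPoly_symmetrizedPoly F (r + 1)) (satisfiesSuperidentity_symmetrizedPoly r)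
    (not_satisfiesSuperidentity_symmetrizedPoly r)

theorem metabelianJordanSupervarietyOfRank_one_ssubset_two [CharZero F] (r : ℕ) :
    metabelianJordanSupervarietyOfRank F r 1 ⊂ metabelianJordanSupervarietyOfRank F r 2 := by
  refine metabelianJordanSupervarietyOfRank_ssubset le_rfl (Nat.le_succ 1)
    (isMultilinearPoly_symmetrizedPoly F (r + 1)) (satisfiesSuperidentity_symmetrizedPoly r)
    fun h => not_satisfiesSuperidentity_symmetrizedPoly (F := F) r ?_
  -- Rank (r,2) generates everything, so its superidentities would also hold in rank (r+1,1), where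
  -- this one fails.
  have hmem : freeMetabelianJordanSuperalgebra F (generatorParity (r + 1) 1) ∈
      metabelianJordanSupervarietyOfRank F r 2 := by
    rw [metabelianJordanSupervarietyOfRank_eq r 2 le_rfl]
    exact freeMetabelianJordanSuperalgebra_mem F _
  exact hmem _ _ (isMultilinearPoly_symmetrizedPoly F (r + 1)) h

theorem metabelianJordanSupervarietyOfRank_zero_ssubset_one [CharZero F] (r : ℕ) :
    metabelianJordanSupervarietyOfRank F r 0 ⊂ metabelianJordanSupervarietyOfRank F r 1 := by
  -- The general word needs an even generator. For r = 0 the identity x = 0 separates the zero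
  -- superalgebra from one with a nonzero odd element.
  rcases Nat.eq_zero_or_eq_succ_pred r with rfl | hr
  · refine metabelianJordanSupervarietyOfRank_ssubset le_rfl (Nat.le_succ 0)
      (isMultilinearPoly_leftNormedPoly F 0)
      (Superalgebra.satisfiesSuperidentity_of_lift_id_eq_zero _ (fun w _ => ?_)
        (isMultilinearPoly_leftNormedPoly F 0)) fun hf => ?_
    · obtain ⟨f, hf⟩ := AlgIdeal.toQuot_surjective _ (FreeMagma.lift
        (id : (freeMetabelianJordanSuperalgebra F (generatorParity 0 0)).carrier → _) w)
      have : f = 0 := by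
        rw [← MonoidAlgebra.coeff_eq_zero]
        ext w
        exact isEmptyElim (FreeMagma.rec (motive := fun _ => Fin 0 ⊕ Fin 0) (fun x => x)
          (fun _ _ x _ => x) w)
      rw [← hf, this, map_zero]; rfl
    · have h := hf.lift_tmul_eq_zero (oddExtension_mem (F := F) (H := GrassmannModel F)
        (GrassmannModel.isMetabelianJordan F))
        (fun _ => incl F (GrassmannModel F) 1 (GrassmannModel.square F 1))
        (fun x => ?_) (fun _ => .inr 0) (fun _ => GrassmannAlgebra.gen F 0)
        fun _ => GrassmannAlgebra.gen_mem_part 0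
      · have h1 := (lift_leftNormedPoly (F := F) (fun _ => GrassmannAlgebra.gen F 0 ⊗ₜ[F]
          incl F (GrassmannModel F) 1 (GrassmannModel.square F 1)) 0).symm.trans h
        refine GrassmannAlgebra.tmul_ne_zero ?_ (incl_ne_zero F _ _ fun h2 => ?_) h1
        · simpa using GrassmannAlgebra.prod_gen_ne_zero (F := F) [0] (List.nodup_singleton 0)
        · exact one_ne_zero (GrassmannModel.square_eq_zero F h2)
      · rcases x with x | x
        · exact x.elim0
        · exact incl_mem_part F _ 1 _
  · obtain ⟨k, rfl⟩ : ∃ k, r = k + 1 := ⟨_, hr⟩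
    refine metabelianJordanSupervarietyOfRank_ssubset le_rfl (Nat.le_succ 0)
      (isMultilinearPoly_leftNormedPoly F (2 * (k + 1) + 1))
      (satisfiesSuperidentity_of_generatorParity_zero (k + 1) (isMultilinearPoly_leftNormedPoly F _))
      (not_satisfiesSuperidentity_leftNormedPoly (k + 1)
        (fun i => .inl (Fin.ofNat (k + 1) ((i - 1) / 2))) (.inr 0) (fun _ => rfl)
        (Sum.elim (fun i => i) fun _ => k + 1) (fun i hi => ?_) rfl)
    exact Nat.mod_eq_of_lt (by omega)

end Failing

end

theorem mainTheorem3 (F : Type u) [Field F] [CharZero F] :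
    (∀ r : ℕ, metabelianJordanSupervarietyOfRank F r 0 ⊂
      metabelianJordanSupervarietyOfRank F (r + 1) 0) ∧
    (∀ r : ℕ, metabelianJordanSupervarietyOfRank F r 1 ⊂
      metabelianJordanSupervarietyOfRank F (r + 1) 1) ∧
    (∀ r : ℕ, metabelianJordanSupervarietyOfRank F r 0 ⊂
      metabelianJordanSupervarietyOfRank F r 1) ∧
    (∀ r : ℕ, metabelianJordanSupervarietyOfRank F r 1 ⊂
      metabelianJordanSupervarietyOfRank F r 2) ∧
    (∀ r s : ℕ, 2 ≤ s →
      metabelianJordanSupervarietyOfRank F r s = metabelianJordanSupervariety F) ∧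
    (∀ n : ℕ, 1 ≤ n →
      IsNilpotentOfIndex (FreeMetabelianJordanAlgebra F (Fin n)) (2 * n + 2)) :=
  ⟨metabelianJordanSupervarietyOfRank_zero_ssubset_succ,
    metabelianJordanSupervarietyOfRank_one_ssubset_succ,
    metabelianJordanSupervarietyOfRank_zero_ssubset_one,
    metabelianJordanSupervarietyOfRank_one_ssubset_two,
    metabelianJordanSupervarietyOfRank_eq,
    isNilpotentOfIndex_freeMetabelianJordanAlgebra F⟩
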